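/- All Lie algebras are finite-dimensional, complex and nonsplit (not the direct sum of two nonzero ideals). For a nilpotent Lie algebra $\mathfrak g$ let $C^0\mathfrak g=\mathfrak g$, $C^{i+1}\mathfrak g=[\mathfrak g,C^i\mathfrak g]$, and let $\operatorname{gr}(\mathfrak g)=\bigoplus_{i\ge 0}C^i\mathfrak g/C^{i+1}\mathfrak g$ be the associated graded Lie algebra, with the bracket induced by that of $\mathfrak g$; $\mathfrak g$ is called naturally graded if $\mathfrak g\cong\operatorname{gr}(\mathfrak g)$. For $X\in\mathfrak g\setminus C^1\mathfrak g$ let $c(X)$ be the non-increasing sequence of the dimensions of the Jordan blocks of the nilpotent operator $\operatorname{ad}X$. The characteristic sequence of $\mathfrak g$ is the lexicographic maximum $c(\mathfrak g)=\max\{c(X): X\in\mathfrak g\setminus C^1\mathfrak g\}$; it is called linear if it has the form $(q,1,\dots,1)$ with $q\ge 2$. Corollary. For every integer $n\ge 7$ there are, up to isomorphism, only finitely many nonsplit naturally graded nilpotent complex Lie algebras of dimension $n$ with linear characteristic sequence. -/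

import Mathlib

open scoped DirectSum

universe u

noncomputable section

namespace NatGraded

section Graded

variable (L : Type u) [LieRing L] [LieAlgebra ℂ L]

/-- The ideal `C^i(L)` of the descending central sequence, as a subspace:
`C^0(L) = L` and `C^(i+1)(L) = [L, C^i(L)]`. -/
def lcs (i : ℕ) : Submodule ℂ L :=
  (LieModule.lowerCentralSeries ℂ L L i).toSubmodule

theorem lcs_antitone : Antitone (lcs L) := fun _ _ h =>
  LieModule.antitone_lowerCentralSeries ℂ L L h

variable {L} in
theorem lie_mem_lcs_succ (x : L) {j : ℕ} {y : L} (hy : y ∈ lcs L j) : ⁅x, y⁆ ∈ lcs L (j + 1) := by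
  change ⁅x, y⁆ ∈ LieModule.lowerCentralSeries ℂ L L (j + 1)
  rw [LieModule.lowerCentralSeries_succ]
  exact LieSubmodule.lie_mem_lie (LieSubmodule.mem_top x) hy

variable {L} in
theorem lie_mem_lcs {i j : ℕ} {x y : L} (hx : x ∈ lcs L i) (hy : y ∈ lcs L j) :
    ⁅x, y⁆ ∈ lcs L (i + j + 1) := by
  induction i generalizing x y j with
  | zero => simpa using lie_mem_lcs_succ x hy
  | succ i ih =>
    have hx' : x ∈ (LieModule.lowerCentralSeries ℂ L L (i + 1)).toSubmodule := hx
    rw [LieModule.lowerCentralSeries_succ, LieSubmodule.lieIdeal_oper_eq_linear_span'] at hx'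
    induction hx' using Submodule.span_induction with
    | mem z hz =>
      obtain ⟨a, -, b, hb, rfl⟩ := hz
      have hb' : b ∈ lcs L i := hb
      rw [lie_lie]
      refine Submodule.sub_mem _ ?_ ?_
      · have := lie_mem_lcs_succ a (ih hb' hy)
        rwa [show i + 1 + j + 1 = i + j + 1 + 1 by ring]
      · have := ih hb' (lie_mem_lcs_succ a hy)
        rwa [show i + 1 + j + 1 = i + (j + 1) + 1 by ring]
    | zero => simp
    | add a b ha hb iha ihb =>
      rw [add_lie]
      refine Submodule.add_mem _ (iha ?_) (ihb ?_) <;>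
      · change _ ∈ (LieModule.lowerCentralSeries ℂ L L (i + 1)).toSubmodule
        rw [LieModule.lowerCentralSeries_succ, LieSubmodule.lieIdeal_oper_eq_linear_span']
        assumption
    | smul c a ha iha =>
      rw [smul_lie]
      refine Submodule.smul_mem _ _ (iha ?_)
      change _ ∈ (LieModule.lowerCentralSeries ℂ L L (i + 1)).toSubmodule
      rw [LieModule.lowerCentralSeries_succ, LieSubmodule.lieIdeal_oper_eq_linear_span']
      assumption

/-- The homogeneous piece `C^i(L) / C^(i+1)(L)`. -/
abbrev Piece (i : ℕ) : Type u :=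
  ↥(lcs L i) ⧸ (lcs L (i + 1)).submoduleOf (lcs L i)

variable {L} in
/-- The class in `C^i(L) / C^(i+1)(L)` of an element `x` of `C^i(L)`. -/
def cls (i : ℕ) (x : L) (hx : x ∈ lcs L i) : Piece L i :=
  Submodule.Quotient.mk ⟨x, hx⟩

variable {L} in
theorem cls_eq_zero {i : ℕ} {x : L} (hx : x ∈ lcs L i) (h : x ∈ lcs L (i + 1)) :
    cls i x hx = 0 :=
  (Submodule.Quotient.mk_eq_zero _).2 h

/-- The bracket `C^i(L) × C^j(L) → C^(i+j+1)(L) / C^(i+j+2)(L)`. -/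
def preBracket (i j : ℕ) : ↥(lcs L i) →ₗ[ℂ] ↥(lcs L j) →ₗ[ℂ] Piece L (i + j + 1) :=
  LinearMap.mk₂ ℂ (fun x y => cls (i + j + 1) ⁅(x : L), (y : L)⁆ (lie_mem_lcs x.2 y.2))
    (fun x x' y => by
      rw [cls, cls, cls, ← Submodule.Quotient.mk_add]; congr 1; ext; simp)
    (fun c x y => by
      rw [cls, cls, ← Submodule.Quotient.mk_smul]; congr 1; ext; simp)
    (fun x y y' => by
      rw [cls, cls, cls, ← Submodule.Quotient.mk_add]; congr 1; ext; simp)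
    (fun c x y => by
      rw [cls, cls, ← Submodule.Quotient.mk_smul]; congr 1; ext; simp)

/-- The induced bracket of homogeneous pieces, `[x + C^(i+1), y + C^(j+1)] = [x, y] + C^(i+j+2)`. -/
def pieceBracket (i j : ℕ) : Piece L i →ₗ[ℂ] Piece L j →ₗ[ℂ] Piece L (i + j + 1) :=
  (Submodule.liftQ _ (Submodule.liftQ _ (preBracket L i j) (by
      intro x hx
      rw [LinearMap.mem_ker]
      ext y
      refine cls_eq_zero _ ?_
      have h := lie_mem_lcs (i := i + 1) (j := j) (x := (x : L)) (y := (y : L)) hx y.2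
      rwa [show i + j + 1 + 1 = i + 1 + j + 1 by ring])).flip (by
      intro y hy
      rw [LinearMap.mem_ker]
      refine LinearMap.ext fun x => ?_
      obtain ⟨x, rfl⟩ := Submodule.Quotient.mk_surjective _ x
      refine cls_eq_zero _ ?_
      have h := lie_mem_lcs (i := i) (j := j + 1) (x := (x : L)) (y := (y : L)) x.2 hy
      rwa [show i + j + 1 + 1 = i + (j + 1) + 1 by ring])).flip

variable {L} in
theorem pieceBracket_cls {i j : ℕ} {x y : L} (hx : x ∈ lcs L i) (hy : y ∈ lcs L j) :
    pieceBracket L i j (cls i x hx) (cls j y hy) = cls (i + j + 1) ⁅x, y⁆ (lie_mem_lcs hx hy) :=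
  rfl

/-- The underlying space of the graded Lie algebra `gr(L) = ⨁ C^i(L) / C^(i+1)(L)`. -/
abbrev Gr : Type u := ⨁ i : ℕ, Piece L i

/-- The inclusion of the `i`-th homogeneous piece in `gr(L)`. -/
def Gr.incl (i : ℕ) : Piece L i →ₗ[ℂ] Gr L := DirectSum.lof ℂ ℕ (fun i => Piece L i) i

/-- The bilinear bracket of `gr(L)`. -/
def Gr.bracket : Gr L →ₗ[ℂ] Gr L →ₗ[ℂ] Gr L :=
  DirectSum.toModule ℂ ℕ (Gr L →ₗ[ℂ] Gr L) fun i =>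
    (DirectSum.toModule ℂ ℕ (Piece L i →ₗ[ℂ] Gr L) fun j =>
      ((pieceBracket L i j).compr₂ (Gr.incl L (i + j + 1))).flip).flip

variable {L}

theorem Gr.bracket_incl {i j : ℕ} (a : Piece L i) (b : Piece L j) :
    Gr.bracket L (Gr.incl L i a) (Gr.incl L j b) =
      Gr.incl L (i + j + 1) (pieceBracket L i j a b) := by
  unfold Gr.bracket Gr.incl
  erw [DirectSum.toModule_lof, LinearMap.flip_apply, DirectSum.toModule_lof]
  rfl

theorem Gr.induction {p : Gr L → Prop} (h0 : p 0)
    (h1 : ∀ (i : ℕ) (x : L) (hx : x ∈ lcs L i), p (Gr.incl L i (cls i x hx)))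
    (h2 : ∀ a b, p a → p b → p (a + b)) (a : Gr L) : p a := by
  refine DirectSum.induction_on (β := fun i => Piece L i) (motive := p) a h0 ?_ h2
  intro i x
  obtain ⟨⟨x, hx⟩, rfl⟩ := Submodule.Quotient.mk_surjective _ x
  exact h1 i x hx

theorem Gr.incl_cls_congr {i j : ℕ} (h : i = j) {x y : L} (hxy : x = y) (hx : x ∈ lcs L i)
    (hy : y ∈ lcs L j) : Gr.incl L i (cls i x hx) = Gr.incl L j (cls j y hy) := by
  subst h; subst hxy; rfl

theorem Gr.incl_cls_add {i : ℕ} {x y : L} (hx : x ∈ lcs L i) (hy : y ∈ lcs L i) :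
    Gr.incl L i (cls i x hx) + Gr.incl L i (cls i y hy) =
      Gr.incl L i (cls i (x + y) (Submodule.add_mem _ hx hy)) :=
  (map_add (Gr.incl L i) _ _).symm

theorem Gr.incl_cls_neg {i : ℕ} {x : L} (hx : x ∈ lcs L i) :
    -Gr.incl L i (cls i x hx) = Gr.incl L i (cls i (-x) (Submodule.neg_mem _ hx)) :=
  (map_neg (Gr.incl L i) _).symm

theorem Gr.bracket_skew (a b : Gr L) : Gr.bracket L a b = -Gr.bracket L b a := by
  induction a using Gr.induction with
  | h0 => simp
  | h2 a a' h h' => rw [map_add, LinearMap.add_apply, h, h', map_add]; abel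
  | h1 i x hx =>
    induction b using Gr.induction with
    | h0 => simp
    | h2 b b' h h' => rw [map_add, h, h', map_add, LinearMap.add_apply]; abel
    | h1 j y hy =>
      rw [Gr.bracket_incl, Gr.bracket_incl, pieceBracket_cls, pieceBracket_cls, Gr.incl_cls_neg]
      exact Gr.incl_cls_congr (by ring) (lie_skew x y).symm _ _

theorem Gr.bracket_self (a : Gr L) : Gr.bracket L a a = 0 :=
  by
  have h : (2 : ℂ) • Gr.bracket L a a = 0 := by
    rw [two_smul]
    nth_rewrite 2 [Gr.bracket_skew a a]
    exact add_neg_cancel _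
  exact (smul_eq_zero.1 h).resolve_left two_ne_zero

theorem Gr.bracket_leibniz (a b c : Gr L) :
    Gr.bracket L a (Gr.bracket L b c) =
      Gr.bracket L (Gr.bracket L a b) c + Gr.bracket L b (Gr.bracket L a c) := by
  induction a using Gr.induction with
  | h0 => simp
  | h2 a a' h h' => simp only [map_add, LinearMap.add_apply, h, h']; abel
  | h1 i x hx =>
    induction b using Gr.induction with
    | h0 => simp
    | h2 b b' h h' => simp only [map_add, LinearMap.add_apply, h, h']; abel
    | h1 j y hy =>
      induction c using Gr.induction with
      | h0 => simp
      | h2 c c' h h' => simp only [map_add, h, h']; abel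
      | h1 k z hz =>
        simp only [Gr.bracket_incl, pieceBracket_cls]
        have hm := lie_mem_lcs (lie_mem_lcs hx hy) hz
        have hm' := lie_mem_lcs hy (lie_mem_lcs hx hz)
        have e : j + (i + k + 1) + 1 = i + j + 1 + k + 1 := by ring
        rw [Gr.incl_cls_congr e rfl hm' (e ▸ hm'), Gr.incl_cls_add]
        exact Gr.incl_cls_congr (by ring) (leibniz_lie x y z) _ _

instance : LieRing (Gr L) where
  bracket a b := Gr.bracket L a b
  add_lie a b c := by
    change Gr.bracket L (a + b) c = Gr.bracket L a c + Gr.bracket L b c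
    rw [map_add, LinearMap.add_apply]
  lie_add a b c := map_add (Gr.bracket L a) b c
  lie_self a := Gr.bracket_self a
  leibniz_lie a b c := Gr.bracket_leibniz a b c

instance : LieAlgebra ℂ (Gr L) where
  lie_smul t a b := map_smul (Gr.bracket L a) t b

/-- The bracket of `gr(L)` on classes of homogeneous elements. -/
theorem Gr.lie_incl_cls {i j : ℕ} {x y : L} (hx : x ∈ lcs L i) (hy : y ∈ lcs L j) :
    ⁅Gr.incl L i (cls i x hx), Gr.incl L j (cls j y hy)⁆ =
      Gr.incl L (i + j + 1) (cls (i + j + 1) ⁅x, y⁆ (lie_mem_lcs hx hy)) :=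
  Gr.bracket_incl _ _

end Graded

/-- `L` is isomorphic to its associated graded Lie algebra `gr(L)`. -/
def IsNaturallyGraded (L : Type u) [LieRing L] [LieAlgebra ℂ L] : Prop :=
  Nonempty (L ≃ₗ⁅ℂ⁆ Gr L)

/-- `L` is not the direct sum of two nonzero ideals. -/
def IsNonsplit (L : Type u) [LieRing L] [LieAlgebra ℂ L] : Prop :=
  ∀ I J : LieIdeal ℂ L, IsCompl I J → I = ⊥ ∨ J = ⊥

/-- `s` is the sequence, in non-increasing order, of the dimensions of the Jordan blocks of the
nilpotent operator `f`: in some basis `b`, indexed by pairs (block `j`, position `i` in the block),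
`f` maps each basis vector to the next one of its block, and the last one of a block to `0`. -/
def IsJordanType {V : Type u} [AddCommGroup V] [Module ℂ V] (f : Module.End ℂ V)
    (s : List ℕ) : Prop :=
  s.Pairwise (fun a b => b ≤ a) ∧ (∀ k ∈ s, 1 ≤ k) ∧
    ∃ b : Module.Basis (Σ j : Fin s.length, Fin (s.get j)) ℂ V,
      ∀ (j : Fin s.length) (i : Fin (s.get j)),
        f (b ⟨j, i⟩) = if h : (i : ℕ) + 1 < s.get j then b ⟨j, ⟨(i : ℕ) + 1, h⟩⟩ else 0

/-- `s` is the characteristic sequence of the nilpotent Lie algebra `L`: the maximum, in the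
lexicographic order, of the sequences of Jordan block dimensions of the operators `ad X`
for `X` outside `C^1(L) = [L, L]`. -/
def IsCharacteristicSequence (L : Type u) [LieRing L] [LieAlgebra ℂ L] (s : List ℕ) : Prop :=
  IsGreatest {t : List ℕ | ∃ X : L, X ∉ lcs L 1 ∧ IsJordanType (LieAlgebra.ad ℂ L X) t} s

/-- The characteristic sequence of `L` has the form `(q, 1, …, 1)` with `q ≥ 2`. -/
def HasLinearCharacteristicSequence (L : Type u) [LieRing L] [LieAlgebra ℂ L] : Prop :=
  ∃ q r : ℕ, 2 ≤ q ∧ IsCharacteristicSequence L (q :: List.replicate r 1)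

/-- The finite-dimensional complex nonsplit nilpotent Lie algebras of dimension `n` that are
naturally graded and have a linear characteristic sequence. -/
structure LinearAlg (n : ℕ) where
  carrier : Type u
  [lieRing : LieRing carrier]
  [lieAlgebra : LieAlgebra ℂ carrier]
  [finiteDimensional : FiniteDimensional ℂ carrier]
  finrank_eq : Module.finrank ℂ carrier = n
  nilpotent : LieRing.IsNilpotent carrier
  nonsplit : IsNonsplit carrier
  naturallyGraded : IsNaturallyGraded carrier
  linear : HasLinearCharacteristicSequence carrier

attribute [instance] LinearAlg.lieRing LinearAlg.lieAlgebra LinearAlg.finiteDimensional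

/-- Isomorphism of Lie algebras, as an equivalence relation. -/
instance isoSetoid (n : ℕ) : Setoid (LinearAlg.{u} n) where
  r A B := Nonempty (A.carrier ≃ₗ⁅ℂ⁆ B.carrier)
  iseqv :=
    { refl := fun _ => ⟨LieEquiv.refl⟩
      symm := fun ⟨e⟩ => ⟨e.symm⟩
      trans := fun ⟨e⟩ ⟨f⟩ => ⟨e.trans f⟩ }

/-- The set of isomorphism classes. -/
def IsoClasses (n : ℕ) : Type (u + 1) := Quotient (isoSetoid.{u} n)

end NatGraded

end

/-! A natural grading writes the algebra as a sum of components L_1, L_2, … with L_{i+1} = [L_1,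
L_i]. If the characteristic sequence is (q, 1, …, 1), an operator ad Z with Z outside C^1 and (ad
Z)^(q-1) ≠ 0 has rank at most q - 1, the smallest possible rank (`finrank_range_ad_le`).
Nonvanishing and linear independence are Zariski open along a line, so this bound passes to all of
L_1: the components above degree q vanish, and each ad z with z in L_1 has rank at most one on each
L_i (`IsGrading.thin`). Moreover (ad x)^(q-1) y ≠ 0 for some x, y in L_1.

Hence [L_1, L_1] is the line of [x, y]. If q = 2, nonsplitness makes the bracket a nondegenerate
alternating form on L_1, so the dimension determines a Heisenberg algebra. If q ≥ 3, nonsplitness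
forces L_1 = ⟨x, y⟩, and every component is spanned by `y i` = (ad x)^(i-1) y and a vector `w i`
killed by ad x. The algebra is then determined by q, by the set S of degrees where `w` is nonzero,
and by scalars c_j, l_r with [y_1, y_j] = c_j y_{j+1} + w_{j+1} and [y_1, w_r] = -l_r y_{r+1}
(`IsFrame`, `IsFrame.nonempty_equiv`).

Antisymmetry and the Jacobi identity constrain these scalars: `w` and l vanish in even degrees, and
the first deviation of c from a known solution is controlled by l. After normalizing c_2 = 0, let r
≥ 3 be minimal with l_r ≠ 0, r < q. If there is no such r, only c_{q-1} can be nonzero. If r = 2m +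
1 ≥ 7, then q ≤ 2m + 3 and m determines everything up to scaling. If r = 3, c vanishes below the top
degree and l is constant in odd degrees. If r = 5, c and l follow a pattern of period six below the
top degree.

In the last two cases one scalar in the top degree could still be a continuous parameter. It is
zero, or absorbed into `w q`, or removed by a one-parameter change of generators
(`exists_frame_hyperbolic`, `exists_frame_torus`), except for finitely many values. Since dim L = q
+ |S|, finitely many codes (q, S, c, l) remain in each dimension. -/

noncomputable section

namespace NatGraded

/-! ### Jordan types of nilpotent operators -/

section JordanType

variable {V : Type u} [AddCommGroup V] [Module ℂ V]

open Polynomial in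
/-- The powers of the variable form a basis of `ℂ[X] / (X ^ k)`. -/
theorem exists_basis_quotient_X_pow (k : ℕ) :
    ∃ b : Module.Basis (Fin k) ℂ (ℂ[X] ⧸ ((ℂ[X]) ∙ (X : ℂ[X]) ^ k)),
      ∀ i : Fin k, (X : ℂ[X]) • b i = if h : (i : ℕ) + 1 < k then b ⟨(i : ℕ) + 1, h⟩ else 0 := by
  have hm : ((X : ℂ[X]) ^ k).Monic := monic_X_pow k
  have hd : (AdjoinRoot.powerBasis' hm).dim = k := by simp
  let b : Module.Basis (Fin k) ℂ (AdjoinRoot ((X : ℂ[X]) ^ k)) :=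
    (AdjoinRoot.powerBasis' hm).basis.reindex (finCongr hd)
  have hb : ∀ i : Fin k, b i = AdjoinRoot.mk _ ((X : ℂ[X]) ^ (i : ℕ)) := by
    intro i
    have := (AdjoinRoot.powerBasis' hm).basis_eq_pow ((finCongr hd).symm i)
    simp only [b, Module.Basis.reindex_apply, this, AdjoinRoot.powerBasis'_gen, map_pow]
    rfl
  have key : ∀ i : Fin k, AdjoinRoot.mk ((X : ℂ[X]) ^ k) X * b i =
      if h : (i : ℕ) + 1 < k then b ⟨(i : ℕ) + 1, h⟩ else 0 := by
    intro i
    rw [hb, ← map_mul, ← pow_succ']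
    split_ifs with h
    · rw [hb]
    · have : (i : ℕ) + 1 = k := by omega
      rw [this]
      exact AdjoinRoot.mk_self
  exact ⟨b, key⟩

open Polynomial in
/-- A nilpotent endomorphism has a basis consisting of chains. -/
theorem exists_chain_basis [FiniteDimensional ℂ V] {f : Module.End ℂ V} (hf : IsNilpotent f) :
    ∃ (d : ℕ) (k : Fin d → ℕ) (b : Module.Basis (Σ j : Fin d, Fin (k j)) ℂ V),
      ∀ (j : Fin d) (i : Fin (k j)),
        f (b ⟨j, i⟩) = if h : (i : ℕ) + 1 < k j then b ⟨j, ⟨(i : ℕ) + 1, h⟩⟩ else 0 := by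
  obtain ⟨N, hN⟩ := hf
  -- With the variable acting as `f`, the space is a torsion module over ℂ[X] annihilated by a power
  -- of X, hence a sum of modules ℂ[X]/(X^k).
  have htor : Module.IsTorsion' (Module.AEval' f) (Submonoid.powers (X : ℂ[X])) := by
    intro m
    refine ⟨⟨X ^ N, N, rfl⟩, ?_⟩
    obtain ⟨v, rfl⟩ := (Module.AEval'.of f).surjective m
    change (X ^ N : ℂ[X]) • (Module.AEval'.of f v) = 0
    rw [Module.AEval'.X_pow_smul_of, hN]
    simp
  obtain ⟨d, k, ⟨e⟩⟩ := Module.torsion_by_prime_power_decomposition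
    (p := (X : ℂ[X])) Polynomial.irreducible_X htor
  choose b hb using exists_basis_quotient_X_pow
  let e' : V ≃ₗ[ℂ] (∀ i : Fin d, ℂ[X] ⧸ ((ℂ[X]) ∙ (X : ℂ[X]) ^ k i)) :=
    (Module.AEval'.of f).trans ((e.trans (DirectSum.linearEquivFunOnFintype ℂ[X] (Fin d)
      (fun i => ℂ[X] ⧸ ((ℂ[X]) ∙ (X : ℂ[X]) ^ k i)))).restrictScalars ℂ)
  have he' : ∀ v, e' (f v) = (X : ℂ[X]) • e' v := by
    intro v
    simp only [e', LinearEquiv.trans_apply, ← Module.AEval'.X_smul_of]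
    exact map_smul (e.trans (DirectSum.linearEquivFunOnFintype ℂ[X] (Fin d)
      (fun i => ℂ[X] ⧸ ((ℂ[X]) ∙ (X : ℂ[X]) ^ k i)))) _ _
  refine ⟨d, k, (Pi.basis fun i => b (k i)).map e'.symm, fun j i => ?_⟩
  apply e'.injective
  rw [he']
  have hs : (X : ℂ[X]) • (Pi.single j (b (k j) i) : ∀ i : Fin d, ℂ[X] ⧸ ((ℂ[X]) ∙ (X : ℂ[X]) ^ k i))
      = Pi.single j ((X : ℂ[X]) • b (k j) i) := by
    rw [← Pi.single_smul]
  simp only [Module.Basis.map_apply, LinearEquiv.apply_symm_apply, Pi.basis_apply]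
  rw [hs, hb]
  split_ifs with h
  · simp
  · simp

/-- A nilpotent endomorphism has a Jordan type. -/
theorem exists_isJordanType [FiniteDimensional ℂ V] {f : Module.End ℂ V} (hf : IsNilpotent f) :
    ∃ s : List ℕ, IsJordanType f s := by
  obtain ⟨d, k, b, hb⟩ := exists_chain_basis hf
  -- The structure theorem allows blocks with `k i = 0`. They are discarded here, and the others are
  -- sorted through the order dual to obtain a non-increasing list.
  let e₀ := Fintype.equivFin {i : Fin d // k i ≠ 0}
  set m := Fintype.card {i : Fin d // k i ≠ 0}
  let k₀ : Fin m → ℕ := fun j => k (e₀.symm j)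
  let σ := Tuple.sort (fun j => OrderDual.toDual (k₀ j))
  have hσ : Antitone (k₀ ∘ σ) := fun i j h => Tuple.monotone_sort (fun j => OrderDual.toDual (k₀ j)) h
  let s : List ℕ := List.ofFn (k₀ ∘ σ)
  have hlen : s.length = m := by simp [s]
  let e : Fin s.length → Fin d := fun j => (e₀.symm (σ (Fin.cast hlen j))).1
  have hek : ∀ j, s.get j = k (e j) := by
    intro j
    simp only [s, e, k₀, List.get_ofFn, Function.comp_apply]
  have heinj : Function.Injective e := by
    intro i j h
    have := σ.injective (e₀.symm.injective (Subtype.ext h))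
    simpa [Fin.ext_iff] using this
  have hesurj : ∀ i, k i ≠ 0 → ∃ j, e j = i := by
    intro i hi
    refine ⟨Fin.cast hlen.symm (σ.symm (e₀ ⟨i, hi⟩)), ?_⟩
    simp [e]
  let F : (Σ j : Fin s.length, Fin (s.get j)) → (Σ j : Fin d, Fin (k j)) :=
    fun p => ⟨e p.1, Fin.cast (hek p.1) p.2⟩
  have hFinj : Function.Injective F := by
    rintro ⟨j, i⟩ ⟨j', i'⟩ h
    have h1 : e j = e j' := congrArg Sigma.fst h
    have := heinj h1
    subst this
    have h2 := eq_of_heq (Sigma.mk.inj h).2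
    have : i = i' := by simpa [Fin.ext_iff] using h2
    rw [this]
  have hFsurj : Function.Surjective F := by
    rintro ⟨j, i⟩
    obtain ⟨j', rfl⟩ := hesurj j (by have := i.2; omega)
    exact ⟨⟨j', Fin.cast (hek j').symm i⟩, by simp [F]⟩
  let E := Equiv.ofBijective F ⟨hFinj, hFsurj⟩
  have hE : ∀ j i, E ⟨j, i⟩ = ⟨e j, Fin.cast (hek j) i⟩ := fun j i => rfl
  refine ⟨s, ?_, ?_, b.reindex E.symm, ?_⟩
  · rw [List.pairwise_ofFn]
    exact fun i j h => hσ h.le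
  · intro x hx
    obtain ⟨j, rfl⟩ := (List.mem_ofFn' _ _).1 hx
    exact Nat.one_le_iff_ne_zero.2 (e₀.symm (σ j)).2
  · intro j i
    simp only [Module.Basis.reindex_apply, Equiv.symm_symm, hE]
    rw [hb]
    have hh : (((Fin.cast (hek j) i : Fin (k (e j))) : ℕ) + 1 < k (e j)) ↔ ((i : ℕ) + 1 < s.get j) := by
      simp only [Fin.val_cast, hek]
    by_cases h : (i : ℕ) + 1 < s.get j
    · rw [dif_pos h, dif_pos (hh.2 h)]
      rfl
    · rw [dif_neg h, dif_neg (fun h' => h (hh.1 h'))]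

/-- The iterates of a nilpotent operator on a chain. -/
theorem IsJordanType.exists_pow_ne_zero {f : Module.End ℂ V} {q : ℕ} {t : List ℕ} (hq : 1 ≤ q)
    (h : IsJordanType f (q :: t)) : f ^ (q - 1) ≠ 0 := by
  obtain ⟨-, -, b, hb⟩ := h
  let z : Fin (q :: t).length := ⟨0, by simp⟩
  have hz : (q :: t).get z = q := rfl
  have key : ∀ i (hi : i < q), (f ^ i) (b ⟨z, ⟨0, by omega⟩⟩) = b ⟨z, ⟨i, hi⟩⟩ := by
    intro i
    induction i with
    | zero => intro hi; rfl
    | succ i ih =>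
      intro hi
      rw [pow_succ', Module.End.mul_apply, ih (by omega), hb, dif_pos]
  intro h0
  have := key (q - 1) (by omega)
  rw [h0] at this
  exact b.ne_zero _ this.symm

/-- If all blocks have dimension at most `m`, then the `m`-th power vanishes. -/
theorem IsJordanType.pow_eq_zero {f : Module.End ℂ V} {s : List ℕ} {m : ℕ}
    (h : IsJordanType f s) (hs : ∀ k ∈ s, k ≤ m) : f ^ m = 0 := by
  obtain ⟨-, -, b, hb⟩ := h
  have key : ∀ l (j : Fin s.length) (i : Fin (s.get j)), s.get j ≤ i + l →
      (f ^ l) (b ⟨j, i⟩) = 0 := by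
    intro l
    induction l with
    | zero => intro j i h; have := i.2; omega
    | succ l ih =>
      intro j i h
      rw [pow_succ, Module.End.mul_apply, hb]
      split_ifs with h'
      · exact ih j ⟨i + 1, h'⟩ (by simp only; omega)
      · simp
  refine b.ext fun ⟨j, i⟩ => ?_
  exact key m j i (by have := hs _ (List.get_mem s j); omega)

/-- The rank of an operator of Jordan type `(q, 1, …, 1)`. -/
theorem IsJordanType.finrank_range_le [FiniteDimensional ℂ V] {f : Module.End ℂ V} {q r : ℕ}
    (h : IsJordanType f (q :: List.replicate r 1)) :
    Module.finrank ℂ (LinearMap.range f) ≤ q - 1 := by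
  obtain ⟨-, -, b, hb⟩ := h
  let z : Fin (q :: List.replicate r 1).length := ⟨0, by simp⟩
  have hz : (q :: List.replicate r 1).get z = q := rfl
  -- The vectors of the long block other than its first one; blocks of dimension one are sent to
  -- zero.
  let v : Fin (q - 1) → V := fun i => b ⟨z, ⟨i + 1, by have := i.2; rw [hz]; omega⟩⟩
  have hle : LinearMap.range f ≤ Submodule.span ℂ (Set.range v) := by
    rw [LinearMap.range_eq_map, ← b.span_eq, Submodule.map_span, Submodule.span_le]
    rintro _ ⟨_, ⟨⟨j, i⟩, rfl⟩, rfl⟩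
    rw [SetLike.mem_coe, hb]
    split_ifs with h
    · by_cases hj : j = z
      · subst hj
        refine Submodule.subset_span ⟨⟨i, Nat.lt_sub_of_add_lt h⟩, rfl⟩
      · exfalso
        obtain ⟨j, hj'⟩ := j
        rcases j with _ | j
        · exact hj rfl
        · simp at h
    · exact Submodule.zero_mem _
  calc Module.finrank ℂ (LinearMap.range f) ≤ Module.finrank ℂ (Submodule.span ℂ (Set.range v)) :=
        Submodule.finrank_mono hle
    _ ≤ Fintype.card (Fin (q - 1)) := finrank_range_le_card v
    _ = q - 1 := Fintype.card_fin _

theorem List.le_of_cons_le_cons {a b : ℕ} {s t : List ℕ} (h : a :: s ≤ b :: t) :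
    a < b ∨ a = b ∧ s ≤ t := by
  by_contra hc
  push Not at hc
  apply not_lt.2 h
  rcases lt_trichotomy a b with h1 | h1 | h1
  · omega
  · subst h1
    exact List.Lex.cons (hc.2 rfl)
  · exact List.Lex.rel h1

/-- A sorted list that is lexicographically at most `(1, …, 1)` consists of ones. -/
theorem eq_replicate_of_le {t : List ℕ} {r : ℕ} (hs : t.Pairwise (fun a b => b ≤ a))
    (h1 : ∀ k ∈ t, 1 ≤ k) (hle : t ≤ List.replicate r 1) : t = List.replicate t.length 1 := by
  rw [List.eq_replicate_iff]
  refine ⟨rfl, fun k hk => ?_⟩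
  cases t with
  | nil => simp at hk
  | cons a t =>
    cases r with
    | zero => exact absurd List.Lex.nil (not_lt.2 hle)
    | succ r =>
      have ha : a ≤ 1 := by
        rcases List.le_of_cons_le_cons hle with h | h <;> omega
      have : k ≤ a := by
        rcases List.mem_cons.1 hk with rfl | hk
        · exact le_rfl
        · exact List.rel_of_pairwise_cons hs hk
      have := h1 k hk
      omega

end JordanType

/-! ### The rank bound contained in a linear characteristic sequence -/

section Rank

variable {L : Type u} [LieRing L] [LieAlgebra ℂ L]

/-- If the characteristic sequence is `(q, 1, …, 1)`, then every element outside the derived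
algebra whose adjoint operator has a nonzero power `q - 1` has adjoint rank at most `q - 1`. -/
theorem finrank_range_ad_le [FiniteDimensional ℂ L] {q r : ℕ} (hq : 2 ≤ q)
    (hc : IsCharacteristicSequence L (q :: List.replicate r 1))
    {Z : L} (hZ : Z ∉ lcs L 1) (hn : IsNilpotent (LieAlgebra.ad ℂ L Z))
    (hp : (LieAlgebra.ad ℂ L Z) ^ (q - 1) ≠ 0) :
    Module.finrank ℂ (LinearMap.range (LieAlgebra.ad ℂ L Z)) ≤ q - 1 := by
  obtain ⟨t, ht⟩ := exists_isJordanType hn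
  have hle : t ≤ q :: List.replicate r 1 := hc.2 ⟨Z, hZ, ht⟩
  cases t with
  | nil =>
    exfalso
    exact hp (ht.pow_eq_zero (by simp))
  | cons a t =>
    -- If the first block were shorter than `q`, all blocks would be, and the power `q - 1` would
    -- vanish. Maximality of (q, 1, …, 1) then leaves only `a = q` followed by ones.
    have haq : q ≤ a := by
      by_contra hlt
      refine hp (ht.pow_eq_zero fun k hk => ?_)
      rcases List.mem_cons.1 hk with rfl | hk
      · omega
      · have := List.rel_of_pairwise_cons ht.1 hk
        omega
    rcases List.le_of_cons_le_cons hle with h | ⟨rfl, h⟩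
    · omega
    · have := eq_replicate_of_le (List.Pairwise.of_cons ht.1)
        (fun k hk => ht.2.1 k (List.mem_cons_of_mem _ hk)) h
      rw [this] at ht
      exact ht.finrank_range_le

end Rank

end NatGraded

end

noncomputable section

namespace NatGraded

/-! ### Polynomial families and generic parameters -/

section Generic

open Polynomial

variable {W W' : Type*} [AddCommGroup W] [Module ℂ W] [AddCommGroup W'] [Module ℂ W']

/-- A family of vectors that depends polynomially on a parameter. -/
def IsPoly (f : ℂ → W) : Prop := ∀ l : Module.Dual ℂ W, ∃ P : ℂ[X], ∀ t, l (f t) = P.eval t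

theorem isPoly_const (v : W) : IsPoly fun _ => v := fun l => ⟨C (l v), by simp⟩

theorem IsPoly.map {f : ℂ → W} (hf : IsPoly f) (A : W →ₗ[ℂ] W') : IsPoly fun t => A (f t) :=
  fun l => hf (l.comp A)

theorem IsPoly.add {f g : ℂ → W} (hf : IsPoly f) (hg : IsPoly g) : IsPoly fun t => f t + g t := by
  intro l
  obtain ⟨P, hP⟩ := hf l
  obtain ⟨Q, hQ⟩ := hg l
  exact ⟨P + Q, fun t => by simp [hP, hQ]⟩

theorem IsPoly.smul {f : ℂ → W} (hf : IsPoly f) (Q : ℂ[X]) : IsPoly fun t => Q.eval t • f t := by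
  intro l
  obtain ⟨P, hP⟩ := hf l
  exact ⟨Q * P, fun t => by simp [hP]⟩

/-- Linear independence is an open condition for the Zariski topology of the affine line. -/
theorem exists_finite_linearIndependent {ι : Type*} [Fintype ι] {v : ι → ℂ → W}
    (hv : ∀ i, IsPoly (v i)) {t₀ : ℂ} (h : LinearIndependent ℂ fun i => v i t₀) :
    {t | ¬ LinearIndependent ℂ fun i => v i t}.Finite := by
  classical
  have hinj : LinearMap.ker (Fintype.linearCombination ℂ fun i => v i t₀) = ⊥ :=
    by
    rw [LinearMap.ker_eq_bot']
    intro m hm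
    funext i
    exact Fintype.linearIndependent_iff.1 h m (by simpa [Fintype.linearCombination_apply] using hm) i
  -- A left inverse `g` of the combination map at `t₀` turns the family into a square matrix with
  -- polynomial entries. Its determinant is 1 at `t₀`, and independence can fail only at its roots.
  obtain ⟨g, hg⟩ := LinearMap.exists_leftInverse_of_injective _ hinj
  choose P hP using fun i j => hv i ((LinearMap.proj j).comp g)
  let M : Matrix ι ι ℂ[X] := Matrix.of P
  have hM : ∀ t, M.det.eval t = (Matrix.of fun i j => g (v i t) j).det := by
    intro t
    rw [← coe_evalRingHom, RingHom.map_det]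
    congr 1
    ext i j
    simpa [M] using (hP i j t).symm
  have h0 : M.det ≠ 0 := by
    intro h0
    have h1 : (Matrix.of fun i j => g (v i t₀) j) = 1 := by
      ext i j
      have := LinearMap.congr_fun hg (Pi.single i 1)
      simp only [LinearMap.comp_apply, Fintype.linearCombination_apply_single, one_smul,
        LinearMap.id_apply] at this
      simp [this, Matrix.one_apply, Pi.single_apply, eq_comm]
    have := hM t₀
    rw [h0, h1] at this
    simp at this
  refine (M.det.roots.toFinset.finite_toSet).subset fun t ht => ?_
  simp only [Finset.mem_coe, Multiset.mem_toFinset, mem_roots h0]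
  by_contra hr
  apply ht
  have hdet : (Matrix.of fun i j => g (v i t) j).det ≠ 0 := by rw [← hM]; exact hr
  exact LinearIndependent.of_comp g (Matrix.linearIndependent_rows_of_det_ne_zero hdet)

theorem exists_finite_ne_zero {v : ℂ → W} (hv : IsPoly v) {t₀ : ℂ} (h : v t₀ ≠ 0) :
    {t | v t = 0}.Finite := by
  have := exists_finite_linearIndependent (ι := Unit) (v := fun _ => v) (fun _ => hv) (t₀ := t₀)
    (LinearIndependent.of_subsingleton () h)
  refine this.subset fun t ht hl => hl.ne_zero () ht

end Generic

/-- The projections to the homogeneous components of a grading in positive degrees, generated in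
degree one. -/
structure IsGrading {L : Type u} [LieRing L] [LieAlgebra ℂ L] (p : ℕ → L →ₗ[ℂ] L) (N : ℕ) :
    Prop where
  zero : p 0 = 0
  idem : ∀ i v, p i (p i v) = p i v
  orth : ∀ i j v, i ≠ j → p i (p j v) = 0
  eq_zero : ∀ i, N < i → p i = 0
  sum : ∀ v, ∑ i ∈ Finset.range (N + 1), p i v = v
  lie : ∀ i j u v, p (i + j) ⁅p i u, p j v⁆ = ⁅p i u, p j v⁆
  gen : ∀ i, 1 ≤ i → ∀ v, p (i + 1) v ∈
    Submodule.span ℂ {z : L | ∃ a b, p 1 a = a ∧ p i b = b ∧ ⁅a, b⁆ = z}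

/-! ### The grading carried by a naturally graded algebra -/

section GrGrading

variable (L : Type u) [LieRing L] [LieAlgebra ℂ L]

/-- The projection of `gr(L)` to its component of degree `i`, with degrees starting at one. -/
def Gr.proj : ℕ → Gr L →ₗ[ℂ] Gr L
  | 0 => 0
  | i + 1 => (Gr.incl L i).comp (DirectSum.component ℂ ℕ (fun i => Piece L i) i)

variable {L}

theorem Gr.proj_incl (i : ℕ) (a : Piece L i) :
    Gr.proj L (i + 1) (Gr.incl L i a) = Gr.incl L i a := by
  simp only [Gr.proj, LinearMap.comp_apply, Gr.incl]
  rw [DirectSum.component.lof_self]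

theorem Gr.proj_incl_ne (i j : ℕ) (h : j ≠ i + 1) (a : Piece L i) :
    Gr.proj L j (Gr.incl L i a) = 0 := by
  cases j with
  | zero => rfl
  | succ j =>
    simp only [Gr.proj, LinearMap.comp_apply, Gr.incl]
    have : DirectSum.component ℂ ℕ (fun i => Piece L i) j (DirectSum.lof ℂ ℕ (fun i => Piece L i) i a)
      = 0 := by
      rw [DirectSum.component.of, dif_neg (by omega)]
    rw [this, map_zero]

/-- Starting degrees at one makes the bracket additive in degrees, since it maps pieces `i` and `j`
to piece `i + j + 1`. Generation in degree one is the equality C^(i+1) = [L, C^i]. -/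
theorem Gr.isGrading {N : ℕ} (hN : lcs L N = ⊥) : IsGrading (Gr.proj L) N where
  zero := rfl
  idem i v := by
    cases i with
    | zero => rfl
    | succ i => exact Gr.proj_incl _ _
  orth i j v h := by
    cases j with
    | zero => simp [Gr.proj]
    | succ j => exact Gr.proj_incl_ne _ _ h _
  eq_zero i hi := by
    obtain ⟨i, rfl⟩ := Nat.exists_eq_succ_of_ne_zero (by omega : i ≠ 0)
    refine LinearMap.ext fun v => ?_
    simp only [Gr.proj, LinearMap.comp_apply, LinearMap.zero_apply]
    obtain ⟨⟨x, hx⟩, hx'⟩ := Submodule.Quotient.mk_surjective _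
      (DirectSum.component ℂ ℕ (fun i => Piece L i) i v)
    have : x = 0 := by
      have := lcs_antitone L (show N ≤ i by omega) hx
      rw [hN] at this
      exact this
    subst this
    rw [← hx']
    exact map_zero (Gr.incl L i)
  sum v := by
    induction v using Gr.induction with
    | h0 => simp
    | h2 a b ha hb =>
      simp only [map_add, Finset.sum_add_distrib, ha, hb]
    | h1 i x hx =>
      by_cases hi : i + 1 < N + 1
      · rw [Finset.sum_eq_single (i + 1)]
        · exact Gr.proj_incl _ _
        · intro j _ hj
          exact Gr.proj_incl_ne _ _ hj _
        · intro h
          exact absurd (Finset.mem_range.2 hi) h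
      · have : x = 0 := by
          have := lcs_antitone L (show N ≤ i by omega) hx
          rw [hN] at this
          exact this
        subst this
        have : Gr.incl L i (cls i 0 hx) = 0 := map_zero (Gr.incl L i)
        rw [this]
        simp
  lie i j u v := by
    cases i with
    | zero => simp [Gr.proj]
    | succ i =>
      cases j with
      | zero => simp [Gr.proj]
      | succ j =>
        have : ⁅Gr.proj L (i + 1) u, Gr.proj L (j + 1) v⁆ = Gr.incl L (i + j + 1) (pieceBracket L i j
          (DirectSum.component ℂ ℕ (fun i => Piece L i) i u)
          (DirectSum.component ℂ ℕ (fun i => Piece L i) j v)) := Gr.bracket_incl _ _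
        rw [this, show i + 1 + (j + 1) = i + j + 1 + 1 by ring]
        exact Gr.proj_incl _ _
  gen i hi v := by
    obtain ⟨i, rfl⟩ := Nat.exists_eq_succ_of_ne_zero (by omega : i ≠ 0)
    obtain ⟨⟨x, hx⟩, hx'⟩ := Submodule.Quotient.mk_surjective _
      (DirectSum.component ℂ ℕ (fun i => Piece L i) (i + 1) v)
    have hp : Gr.proj L (i + 1 + 1) v = Gr.incl L (i + 1) (cls (i + 1) x hx) := by
      simp only [Gr.proj, LinearMap.comp_apply]
      rw [← hx']
      rfl
    simp only [Nat.succ_eq_add_one]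
    rw [hp]
    clear hp hx'
    have hx₀ := hx
    change x ∈ (LieModule.lowerCentralSeries ℂ L L (i + 1)).toSubmodule at hx₀
    rw [LieModule.lowerCentralSeries_succ, LieSubmodule.lieIdeal_oper_eq_linear_span'] at hx₀
    -- Membership in `lcs L (i + 1)` is carried through the span induction because the class of `x`
    -- is defined only with it.
    have key : ∀ x ∈ Submodule.span ℂ {x : L | ∃ a ∈ (⊤ : LieIdeal ℂ L),
        ∃ b ∈ LieModule.lowerCentralSeries ℂ L L i, ⁅a, b⁆ = x}, ∃ hx : x ∈ lcs L (i + 1),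
        Gr.incl L (i + 1) (cls (i + 1) x hx) ∈
        Submodule.span ℂ {z : Gr L | ∃ a b, Gr.proj L 1 a = a ∧ Gr.proj L (i + 1) b = b ∧ ⁅a, b⁆ = z} := by
      intro x hx
      induction hx using Submodule.span_induction with
      | mem z hz =>
        obtain ⟨a, -, b, hb, rfl⟩ := hz
        have hb' : b ∈ lcs L i := hb
        have ha' : a ∈ lcs L 0 := by
          change a ∈ LieModule.lowerCentralSeries ℂ L L 0
          simp
        refine ⟨lie_mem_lcs_succ a hb', Submodule.subset_span ⟨Gr.incl L 0 (cls 0 a ha'),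
          Gr.incl L i (cls i b hb'), Gr.proj_incl _ _, Gr.proj_incl _ _, ?_⟩⟩
        rw [Gr.lie_incl_cls]
        exact Gr.incl_cls_congr (by ring) rfl _ _
      | zero =>
        refine ⟨zero_mem _, ?_⟩
        have : Gr.incl L (i + 1) (cls (i + 1) 0 (zero_mem _)) = 0 := map_zero (Gr.incl L _)
        rw [this]
        exact zero_mem _
      | add a b _ _ iha ihb =>
        obtain ⟨ha, ha'⟩ := iha
        obtain ⟨hb, hb'⟩ := ihb
        refine ⟨add_mem ha hb, ?_⟩
        rw [← Gr.incl_cls_add ha hb]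
        exact add_mem ha' hb'
      | smul c a _ iha =>
        obtain ⟨ha, ha'⟩ := iha
        refine ⟨Submodule.smul_mem _ c ha, ?_⟩
        have : Gr.incl L (i + 1) (cls (i + 1) (c • a) (Submodule.smul_mem _ c ha)) =
          c • Gr.incl L (i + 1) (cls (i + 1) a ha) := map_smul (Gr.incl L (i + 1)) c (cls (i + 1) a ha)
        rw [this]
        exact Submodule.smul_mem _ c ha'
    exact (key x hx₀).2

theorem exists_lcs_eq_bot [LieRing.IsNilpotent L] : ∃ N, lcs L N = ⊥ := by
  obtain ⟨k, hk⟩ := LieModule.IsNilpotent.nilpotent ℂ L L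
  exact ⟨k, by rw [lcs, hk]; rfl⟩

/-- A naturally graded nilpotent Lie algebra has a grading generated in degree one. -/
theorem exists_isGrading [LieRing.IsNilpotent L] (h : IsNaturallyGraded L) :
    ∃ (p : ℕ → L →ₗ[ℂ] L) (N : ℕ), IsGrading p N := by
  obtain ⟨e⟩ := h
  obtain ⟨N, hN⟩ := exists_lcs_eq_bot (L := L)
  have hg := Gr.isGrading hN
  have hl : ∀ a b : Gr L, e.symm ⁅a, b⁆ = ⁅e.symm a, e.symm b⁆ := fun a b => LieEquiv.map_lie e.symm a b
  have hz : ∀ i v, (e.symm : Gr L →ₗ[ℂ] L) ((Gr.proj L i) (e v)) = e.symm (Gr.proj L i (e v)) :=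
    fun i v => rfl
  refine ⟨fun i => ((e.symm : Gr L →ₗ[ℂ] L).comp (Gr.proj L i)).comp (e : L →ₗ[ℂ] Gr L), N,
    ?_, ?_, ?_, ?_, ?_, ?_, ?_⟩
  · ext v; simp [hg.zero]
  · intro i v
    simp [hg.idem]
  · intro i j v h
    simp [hg.orth _ _ _ h]
  · intro i hi
    ext v; simp [hg.eq_zero i hi]
  · intro v
    have := congrArg e.symm (hg.sum (e v))
    rw [map_sum] at this
    simpa using this
  · intro i j u v
    have := congrArg e.symm (hg.lie i j (e u) (e v))
    rw [hl] at this
    change e.symm (Gr.proj L (i + j) (e ⁅e.symm (Gr.proj L i (e u)), e.symm (Gr.proj L j (e v))⁆)) =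
      ⁅e.symm (Gr.proj L i (e u)), e.symm (Gr.proj L j (e v))⁆
    rw [LieEquiv.map_lie, LieEquiv.apply_symm_apply, LieEquiv.apply_symm_apply, this]
  · intro i hi v
    have := Submodule.mem_map_of_mem (f := (e.symm : Gr L →ₗ[ℂ] L)) (hg.gen i hi (e v))
    rw [Submodule.map_span] at this
    refine Submodule.span_mono ?_ this
    rintro _ ⟨_, ⟨a, b, ha, hb, rfl⟩, rfl⟩
    refine ⟨e.symm a, e.symm b, ?_, ?_, ?_⟩
    · simp [ha]
    · simp [hb]
    · exact (hl a b).symm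

end GrGrading

end NatGraded

end

noncomputable section

namespace NatGraded

/-! ### Leading terms in a grading and the thinness of adjoint operators -/

section Pencil

open Polynomial

variable {L : Type u} [LieRing L] [LieAlgebra ℂ L]

theorem isPoly_line {W : Type*} [AddCommGroup W] [Module ℂ W] (a b : W) :
    IsPoly fun t => a + t • b := by
  have := (isPoly_const a).add ((isPoly_const b).smul X)
  simpa using this

theorem isPoly_ad_pow (a b u : L) (k : ℕ) :
    IsPoly fun t => ((LieAlgebra.ad ℂ L (a + t • b)) ^ k) u := by
  induction k with
  | zero => simpa using isPoly_const u
  | succ k ih =>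
    have := (ih.map (LieAlgebra.ad ℂ L a)).add ((ih.map (LieAlgebra.ad ℂ L b)).smul X)
    convert this using 2 with t
    rw [pow_succ', Module.End.mul_apply]
    simp

theorem card_le_finrank_range {V : Type*} [AddCommGroup V] [Module ℂ V] [FiniteDimensional ℂ V]
    (f : Module.End ℂ V) {ι : Type*} [Fintype ι] {v : ι → V} (hv : LinearIndependent ℂ v)
    (h : ∀ i, v i ∈ LinearMap.range f) :
    Fintype.card ι ≤ Module.finrank ℂ (LinearMap.range f) := by
  rw [← finrank_span_eq_card hv]
  exact Submodule.finrank_mono (Submodule.span_le.2 (by rintro _ ⟨i, rfl⟩; exact h i))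

end Pencil

namespace IsGrading

variable {L : Type u} [LieRing L] [LieAlgebra ℂ L] {p : ℕ → L →ₗ[ℂ] L} {N : ℕ}

theorem lie_mem (h : IsGrading p N) {i j : ℕ} {a b : L} (ha : p i a = a) (hb : p j b = b) :
    p (i + j) ⁅a, b⁆ = ⁅a, b⁆ := by
  have := h.lie i j a b
  rwa [ha, hb] at this

theorem apply_of_ne (h : IsGrading p N) {i j : ℕ} (hij : i ≠ j) {a : L} (ha : p j a = a) :
    p i a = 0 := by
  rw [← ha, h.orth _ _ _ hij]

theorem apply_lie (h : IsGrading p N) (k : ℕ) (u v : L) :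
    p k ⁅u, v⁆ = ∑ i ∈ Finset.range (N + 1), ∑ j ∈ Finset.range (N + 1),
      if i + j = k then ⁅p i u, p j v⁆ else 0 := by
  conv_lhs => rw [← h.sum u, ← h.sum v]
  simp only [sum_lie, lie_sum, map_sum]
  rw [Finset.sum_comm]
  refine Finset.sum_congr rfl fun i _ => Finset.sum_congr rfl fun j _ => ?_
  split_ifs with hij
  · rw [← hij, h.lie]
  · rw [← h.lie, h.orth _ _ _ (Ne.symm hij)]

/-- All degrees are positive, so bracketing raises the lowest degree by at least one. -/
theorem apply_lie_of_lt (h : IsGrading p N) {k : ℕ} {u v : L} (hv : ∀ i < k, p i v = 0) :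
    ∀ i < k + 1, p i ⁅u, v⁆ = 0 := by
  intro i hi
  rw [h.apply_lie]
  refine Finset.sum_eq_zero fun i' _ => Finset.sum_eq_zero fun j' _ => ?_
  split_ifs with hij
  · rcases Nat.eq_zero_or_pos i' with rfl | h'
    · simp [h.zero]
    · rw [hv j' (by omega), lie_zero]
  · rfl

/-- Only the pair of degrees (1, k) contributes in degree k + 1, as components of `u` in degree 0
and of `v` below k vanish. -/
theorem apply_lie_succ (h : IsGrading p N) {k : ℕ} {u v : L} (hv : ∀ i < k, p i v = 0) :
    p (k + 1) ⁅u, v⁆ = ⁅p 1 u, p k v⁆ := by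
  rw [h.apply_lie]
  have key : ∀ i j, (if i + j = k + 1 then ⁅p i u, p j v⁆ else 0) =
      if i = 1 then (if j = k then ⁅p 1 u, p k v⁆ else 0) else 0 := by
    intro i j
    by_cases h1 : i = 1
    · subst h1
      by_cases h2 : j = k
      · subst h2; simp [add_comm]
      · rw [if_neg (by omega), if_pos rfl, if_neg h2]
    · rw [if_neg h1]
      split_ifs with hij
      · rcases Nat.eq_zero_or_pos i with rfl | h'
        · simp [h.zero]
        · rw [hv j (by omega), lie_zero]
      · rfl
  simp only [key]
  by_cases hk : k < N + 1
  · by_cases h1 : 1 < N + 1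
    · simp [Finset.sum_ite_eq', h1, hk]
    · have : p 1 = 0 := h.eq_zero 1 (by omega)
      simp [this]
  · have : p k = 0 := h.eq_zero k (by omega)
    simp [this]

theorem apply_one_of_mem_lcs (h : IsGrading p N) {v : L} (hv : v ∈ lcs L 1) : p 1 v = 0 := by
  change v ∈ (LieModule.lowerCentralSeries ℂ L L 1).toSubmodule at hv
  rw [LieModule.lowerCentralSeries_succ, LieSubmodule.lieIdeal_oper_eq_linear_span'] at hv
  induction hv using Submodule.span_induction with
  | mem z hz =>
    obtain ⟨a, -, b, -, rfl⟩ := hz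
    exact h.apply_lie_of_lt (k := 1) (fun i hi => by
      rw [Nat.lt_one_iff.1 hi, h.zero, LinearMap.zero_apply]) 1 (by omega)
  | zero => simp
  | add a b _ _ ha hb => simp [ha, hb]
  | smul c a _ ha => simp [ha]

theorem linearIndependent (h : IsGrading p N) {ι : Type*} {v : ι → L} {d : ι → ℕ}
    (hd : Function.Injective d) (hv : ∀ i, p (d i) (v i) = v i) (h0 : ∀ i, v i ≠ 0) :
    LinearIndependent ℂ v := by
  classical
  rw [linearIndependent_iff']
  intro s g hg i hi
  have := congrArg (p (d i)) hg
  rw [map_sum, map_zero, Finset.sum_eq_single i] at this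
  · rw [map_smul, hv] at this
    exact (smul_eq_zero.1 this).resolve_right (h0 i)
  · intro j _ hj
    rw [map_smul, h.apply_of_ne (fun h' => hj (hd h').symm) (hv j), smul_zero]
  · exact fun h' => absurd hi h'

theorem succ_eq_zero (h : IsGrading p N) {i : ℕ} (hi : 1 ≤ i)
    (h0 : ∀ a b, p 1 a = a → p i b = b → ⁅a, b⁆ = 0) : p (i + 1) = 0 := by
  refine LinearMap.ext fun v => ?_
  have := h.gen i hi v
  rw [show {z : L | ∃ a b, p 1 a = a ∧ p i b = b ∧ ⁅a, b⁆ = z} ⊆ {0} → p (i + 1) v = 0 from ?_]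
  · rfl
  · rintro _ ⟨a, b, ha, hb, rfl⟩
    exact h0 a b ha hb
  · intro hs
    have := Submodule.span_mono hs this
    simpa using this

theorem eq_zero_of_le (h : IsGrading p N) {i j : ℕ} (hi : 1 ≤ i) (hij : i ≤ j) (h0 : p i = 0) :
    p j = 0 := by
  induction j, hij using Nat.le_induction with
  | base => exact h0
  | succ j hj ih =>
    refine h.succ_eq_zero (by omega) fun a b _ hb => ?_
    rw [← hb, ih, LinearMap.zero_apply, lie_zero]

/-- Passing to lowest terms: the component of (ad X)^k u in the first possible degree k + 1 sees
only the degree-one parts of `X` and `u`. -/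
theorem apply_ad_pow (h : IsGrading p N) (X u : L) (k : ℕ) :
    (∀ i < k + 1, p i (((LieAlgebra.ad ℂ L X) ^ k) u) = 0) ∧
      p (k + 1) (((LieAlgebra.ad ℂ L X) ^ k) u) = ((LieAlgebra.ad ℂ L (p 1 X)) ^ k) (p 1 u) := by
  induction k with
  | zero =>
    refine ⟨fun i hi => ?_, rfl⟩
    rw [Nat.lt_one_iff.1 hi, h.zero, LinearMap.zero_apply]
  | succ k ih =>
    rw [pow_succ', pow_succ']
    simp only [Module.End.mul_apply, LieAlgebra.ad_apply]
    exact ⟨h.apply_lie_of_lt ih.1, by rw [h.apply_lie_succ ih.1, ih.2]⟩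

theorem ad_pow_mem (h : IsGrading p N) {x y : L} (hx : p 1 x = x) (hy : p 1 y = y) (k : ℕ) :
    p (k + 1) (((LieAlgebra.ad ℂ L x) ^ k) y) = ((LieAlgebra.ad ℂ L x) ^ k) y := by
  rw [(h.apply_ad_pow x y k).2, hx, hy]

/-- If L_{q+1} ≠ 0, then for each i in 1, …, q the vectors whose degree-one part annihilates L_i
form a proper subspace, since L_{i+1} is spanned by [L_1, L_i]. A complex vector space is not a
finite union of proper subspaces. -/
theorem exists_generic (h : IsGrading p N) {q : ℕ} (hq : p (q + 1) ≠ 0) :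
    ∃ x, p 1 x = x ∧ ∀ i : Fin q, ∃ u, p (i + 1) u = u ∧ ⁅x, u⁆ ≠ 0 := by
  classical
  let K : ℕ → Subspace ℂ L := fun i =>
    { carrier := {v | ∀ u, ⁅p 1 v, p i u⁆ = 0}
      add_mem' := fun {a b} ha hb u => by
        rw [map_add, add_lie, ha u, hb u, add_zero]
      zero_mem' := fun u => by simp
      smul_mem' := fun c a ha u => by rw [map_smul, smul_lie, ha u, smul_zero] }
  have hK : ⊤ ∉ (Finset.Icc 1 q).image K := by
    intro hm
    obtain ⟨i, hi, hi'⟩ := Finset.mem_image.1 hm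
    rw [Finset.mem_Icc] at hi
    refine hq (h.eq_zero_of_le (i := i + 1) (by omega) (by omega)
      (h.succ_eq_zero hi.1 fun a b ha hb => ?_))
    have : a ∈ K i := hi' ▸ Submodule.mem_top
    have := this b
    rwa [ha, hb] at this
  have := Subspace.biUnion_ne_univ_of_top_notMem hK
  obtain ⟨v, hv⟩ := (Set.ne_univ_iff_exists_notMem _).1 this
  refine ⟨p 1 v, h.idem _ _, fun i => ?_⟩
  have hv' : v ∉ K (i + 1) := fun hm => hv (by
    simp only [Set.mem_iUnion]
    exact ⟨K (i + 1), Finset.mem_image_of_mem _ (Finset.mem_Icc.2 ⟨by omega, i.2⟩), hm⟩)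
  have : ¬ ∀ u, ⁅p 1 v, p (i + 1) u⁆ = 0 := hv'
  push Not at this
  obtain ⟨u, hu⟩ := this
  exact ⟨p (i + 1) u, h.idem _ _, hu⟩

/-- The adjoint operators of a naturally graded Lie algebra with linear characteristic
sequence are as thin as possible: the components have rank at most one. -/
theorem thin [FiniteDimensional ℂ L] (h : IsGrading p N) {q : ℕ} (hq : 2 ≤ q)
    {X : L} (hX : (LieAlgebra.ad ℂ L X) ^ (q - 1) ≠ 0)
    (hr : ∀ Z : L, Z ∉ lcs L 1 → (LieAlgebra.ad ℂ L Z) ^ (q - 1) ≠ 0 →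
      Module.finrank ℂ (LinearMap.range (LieAlgebra.ad ℂ L Z)) ≤ q - 1) :
    p (q + 1) = 0 ∧ ∃ x y, p 1 x = x ∧ p 1 y = y ∧ ((LieAlgebra.ad ℂ L x) ^ (q - 1)) y ≠ 0 ∧
      ∀ z a b i, p 1 z = z → p i a = a → p i b = b →
        ¬ LinearIndependent ℂ ![⁅z, a⁆, ⁅z, b⁆] := by
  obtain ⟨u, hu⟩ : ∃ u, ((LieAlgebra.ad ℂ L X) ^ (q - 1)) u ≠ 0 := by
    by_contra! hc
    exact hX (LinearMap.ext hc)
  -- Otherwise a generic `x` in degree one has adjoint rank at least `q`. On the line joining `X` to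
  -- `x`, all but finitely many points have both this rank and a nonzero power `q - 1`, and lie
  -- outside C^1, against the rank bound.
  have htop : p (q + 1) = 0 := by
    by_contra hne
    obtain ⟨x, hx, hxu⟩ := h.exists_generic hne
    choose w hw hxw using hxu
    have hx0 : x ≠ 0 := by
      rintro rfl
      exact hxw ⟨0, by omega⟩ (by simp)
    have f1 := exists_finite_ne_zero (isPoly_ad_pow X (x - X) u (q - 1)) (t₀ := 0) (by simpa using hu)
    have f2 := exists_finite_linearIndependent (v := fun i t => ⁅X + t • (x - X), w i⁆)
      (fun i => by
        have := isPoly_line ⁅X, w i⁆ ⁅x - X, w i⁆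
        simpa only [add_lie, smul_lie] using this) (t₀ := 1)
      (by
        have : X + (1 : ℂ) • (x - X) = x := by module
        simp only [this]
        exact h.linearIndependent (d := fun i : Fin q => 1 + (i + 1 : ℕ))
          (fun i j hij => by simpa [Fin.ext_iff] using hij) (fun i => h.lie_mem hx (hw i)) hxw)
    have f3 := exists_finite_ne_zero (v := fun t => p 1 (X + t • (x - X)))
      ((isPoly_line X (x - X)).map (p 1)) (t₀ := 1) (by
        have : X + (1 : ℂ) • (x - X) = x := by module
        simp only [this, hx]
        exact hx0)
    obtain ⟨t, ht⟩ := ((f1.union f2).union f3).infinite_compl.nonempty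
    simp only [Set.mem_compl_iff, Set.mem_union, Set.mem_ofPred_eq, not_or, not_not] at ht
    obtain ⟨⟨h1, h2⟩, h3⟩ := ht
    have hb := hr (X + t • (x - X)) (fun hm => h3 (h.apply_one_of_mem_lcs hm))
      (fun h0 => h1 (by rw [h0]; rfl))
    have := card_le_finrank_range (LieAlgebra.ad ℂ L (X + t • (x - X))) h2 (fun i => ⟨w i, rfl⟩)
    rw [Fintype.card_fin] at this
    omega
  -- The components of (ad X)^(q-1) u below degree `q` vanish, and nothing lives above degree `q`;
  -- so this nonzero vector equals its lowest term.
  have hxy : ((LieAlgebra.ad ℂ L (p 1 X)) ^ (q - 1)) (p 1 u) ≠ 0 := by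
    intro h0
    apply hu
    obtain ⟨h1, h2⟩ := h.apply_ad_pow X u (q - 1)
    rw [h0] at h2
    rw [← h.sum (((LieAlgebra.ad ℂ L X) ^ (q - 1)) u)]
    refine Finset.sum_eq_zero fun i _ => ?_
    rcases lt_trichotomy i (q - 1 + 1) with hi | rfl | hi
    · exact h1 i hi
    · exact h2
    · rw [h.eq_zero_of_le (i := q + 1) (by omega) (by omega) htop, LinearMap.zero_apply]
  refine ⟨htop, p 1 X, p 1 u, h.idem _ _, h.idem _ _, hxy, ?_⟩
  set x := p 1 X
  set y := p 1 u
  have hx : p 1 x = x := h.idem _ _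
  have hy : p 1 y = y := h.idem _ _
  -- The vectors (ad Z)^k y, 1 ≤ k ≤ q - 1, are nonzero of distinct degrees, and their number is the
  -- maximal rank of ad Z, so they span its range. In degree i + 1 this leaves only the line of (ad
  -- Z)^i y.
  have key : ∀ Z, p 1 Z = Z → ((LieAlgebra.ad ℂ L Z) ^ (q - 1)) y ≠ 0 → ∀ i a, p i a = a →
      ∃ c : ℂ, ⁅Z, a⁆ = c • ((LieAlgebra.ad ℂ L Z) ^ i) y := by
    intro Z hZ hZy i a ha
    rcases Nat.eq_zero_or_pos i with rfl | hi
    · refine ⟨0, ?_⟩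
      rw [h.zero, LinearMap.zero_apply] at ha
      rw [← ha, lie_zero, zero_smul]
    by_cases hiq : q ≤ i
    · refine ⟨0, ?_⟩
      rw [zero_smul, ← h.lie_mem hZ ha,
        h.eq_zero_of_le (i := q + 1) (by omega) (by omega) htop, LinearMap.zero_apply]
    push Not at hiq
    let s : Fin (q - 1) → L := fun k => ((LieAlgebra.ad ℂ L Z) ^ (k + 1 : ℕ)) y
    have hsd : ∀ k : Fin (q - 1), p ((k : ℕ) + 1 + 1) (s k) = s k := fun k => h.ad_pow_mem hZ hy _
    have hs0 : ∀ k : Fin (q - 1), s k ≠ 0 := by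
      intro k h0
      apply hZy
      rw [show q - 1 = (q - 1 - (k + 1)) + (k + 1) by omega, pow_add, Module.End.mul_apply]
      exact (congrArg _ h0).trans (map_zero _)
    have hsl : LinearIndependent ℂ s := h.linearIndependent (d := fun k : Fin (q - 1) => (k : ℕ) + 1 + 1)
      (fun i j hij => by simpa [Fin.ext_iff] using hij) hsd hs0
    have hZ1 : Z ∉ lcs L 1 := by
      intro hm
      have := h.apply_one_of_mem_lcs hm
      rw [hZ] at this
      subst this
      apply hZy
      rw [map_zero, zero_pow (by omega), LinearMap.zero_apply]
    have hb := hr Z hZ1 (fun h0 => hZy (by rw [h0]; rfl))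
    have hspan : Submodule.span ℂ (Set.range s) = LinearMap.range (LieAlgebra.ad ℂ L Z) := by
      apply Submodule.eq_of_le_of_finrank_le
      · rw [Submodule.span_le]
        rintro _ ⟨k, rfl⟩
        refine ⟨((LieAlgebra.ad ℂ L Z) ^ (k : ℕ)) y, ?_⟩
        simp only [s]
        rw [pow_succ', Module.End.mul_apply]
      · rw [finrank_span_eq_card hsl, Fintype.card_fin]
        exact hb
    have hm : ⁅Z, a⁆ ∈ Submodule.span ℂ (Set.range s) := by
      rw [hspan]; exact ⟨a, rfl⟩
    obtain ⟨c, hc⟩ := (Submodule.mem_span_range_iff_exists_fun ℂ).1 hm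
    refine ⟨c ⟨i - 1, by omega⟩, ?_⟩
    have h3 := congrArg (p (1 + i)) hc
    rw [h.lie_mem hZ ha, map_sum, Finset.sum_eq_single ⟨i - 1, by omega⟩] at h3
    · rw [← h3, map_smul]
      have e1 : ((⟨i - 1, by omega⟩ : Fin (q - 1)) : ℕ) + 1 = i := by simp only; omega
      have := hsd ⟨i - 1, by omega⟩
      simp only [s] at this ⊢
      rw [e1] at this ⊢
      rw [add_comm 1 i, this]
    · intro j _ hj
      rw [map_smul, h.apply_of_ne _ (hsd j), smul_zero]
      intro h'
      apply hj
      ext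
      simp only
      omega
    · simp
  -- Independence at `z` would persist at almost every point of the line from `x` to `z`, in
  -- particular at one where (ad Z)^(q-1) y ≠ 0; there `key` forbids it.
  intro z a b i hz ha hb hli
  have f1 := exists_finite_ne_zero (isPoly_ad_pow x (z - x) y (q - 1)) (t₀ := 0) (by simpa using hxy)
  have f2 := exists_finite_linearIndependent
    (v := fun (i : Fin 2) t => ![⁅x + t • (z - x), a⁆, ⁅x + t • (z - x), b⁆] i)
    (fun i => by
      fin_cases i
      · have := isPoly_line ⁅x, a⁆ ⁅z - x, a⁆
        simp only [← smul_lie, ← add_lie] at this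
        exact this
      · have := isPoly_line ⁅x, b⁆ ⁅z - x, b⁆
        simp only [← smul_lie, ← add_lie] at this
        exact this) (t₀ := 1)
    (by
      have : x + (1 : ℂ) • (z - x) = z := by module
      simp only [this]
      exact hli)
  obtain ⟨t, ht⟩ := (f1.union f2).infinite_compl.nonempty
  simp only [Set.mem_compl_iff, Set.mem_union, Set.mem_ofPred_eq, not_or, not_not] at ht
  obtain ⟨h1, h2⟩ := ht
  have hZ : p 1 (x + t • (z - x)) = x + t • (z - x) := by simp [hx, hz]
  obtain ⟨c, hc⟩ := key _ hZ h1 i a ha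
  obtain ⟨d, hd⟩ := key _ hZ h1 i b hb
  set Z := x + t • (z - x)
  have h2' : LinearIndependent ℂ ![⁅Z, a⁆, ⁅Z, b⁆] := h2
  rw [LinearIndependent.pair_iff] at h2'
  have := h2' d (-c) (by rw [hc, hd]; module)
  have hc0 : c = 0 := by simpa using this.2
  have h2'' : LinearIndependent ℂ ![⁅Z, a⁆, ⁅Z, b⁆] := h2
  exact h2''.ne_zero 0 (by simp [hc, hc0])

end IsGrading

/-- The structure of the algebras with linear characteristic sequence that is used below. -/
theorem LinearAlg.exists_grading {n : ℕ} (A : LinearAlg.{u} n) :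
    ∃ (q : ℕ) (p : ℕ → A.carrier →ₗ[ℂ] A.carrier), 2 ≤ q ∧ IsGrading p q ∧
      ∃ x y, p 1 x = x ∧ p 1 y = y ∧ ((LieAlgebra.ad ℂ A.carrier x) ^ (q - 1)) y ≠ 0 ∧
      ∀ z a b i, p 1 z = z → p i a = a → p i b = b →
        ¬ LinearIndependent ℂ ![⁅z, a⁆, ⁅z, b⁆] := by
  have := A.nilpotent
  obtain ⟨q, r, hq, hc⟩ := A.linear
  obtain ⟨p, N, h⟩ := exists_isGrading A.naturallyGraded
  obtain ⟨X, hX, hJ⟩ := hc.1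
  obtain ⟨htop, hxy⟩ := h.thin hq (X := X) (hJ.exists_pow_ne_zero (by omega))
    (fun Z hZ hZ' => finrank_range_ad_le hq hc hZ
      (LieModule.isNilpotent_toEnd_of_isNilpotent ℂ A.carrier A.carrier Z) hZ')
  have hgt : ∀ i, q < i → p i = 0 := fun i hi => h.eq_zero_of_le (by omega) hi htop
  -- The bound `N` coming from nilpotency is replaced by the first block size `q`: both truncated
  -- sums contain all nonzero components.
  refine ⟨q, p, hq, ⟨h.zero, h.idem, h.orth, hgt, fun v => ?_, h.lie, h.gen⟩, hxy⟩
  conv_rhs => rw [← h.sum v]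
  rcases le_total q N with hqN | hqN
  · apply Finset.sum_subset (Finset.range_mono (by omega))
    intro i _ hi
    rw [hgt i (by simpa using hi), LinearMap.zero_apply]
  · symm
    apply Finset.sum_subset (Finset.range_mono (by omega))
    intro i _ hi
    rw [h.eq_zero i (by simpa using hi), LinearMap.zero_apply]

end NatGraded

end

noncomputable section

namespace NatGraded

/-! ### Brackets in degree one and the number of generators -/

section Dependent

variable {V : Type*} [AddCommGroup V] [Module ℂ V]

theorem exists_eq_smul {a b : V} (h : ¬ LinearIndependent ℂ ![a, b]) (ha : a ≠ 0) :
    ∃ c : ℂ, b = c • a := by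
  by_contra! hc
  exact h ((LinearIndependent.pair_iff' ha).2 fun c h' => hc c h'.symm)

end Dependent

namespace IsGrading

variable {L : Type u} [LieRing L] [LieAlgebra ℂ L] {p : ℕ → L →ₗ[ℂ] L} {N : ℕ}

theorem lieSpan_eq_top (h : IsGrading p N) :
    LieSubalgebra.lieSpan ℂ L {v | p 1 v = v} = ⊤ := by
  rw [eq_top_iff]
  set S := LieSubalgebra.lieSpan ℂ L {v | p 1 v = v}
  have key : ∀ i v, p i v ∈ S := by
    intro i
    induction i with
    | zero => intro v; rw [h.zero]; exact zero_mem _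
    | succ i ih =>
      intro v
      rcases Nat.eq_zero_or_pos i with rfl | hi
      · exact LieSubalgebra.subset_lieSpan (h.idem _ _)
      · have hle : Submodule.span ℂ {z : L | ∃ a b, p 1 a = a ∧ p i b = b ∧ ⁅a, b⁆ = z} ≤
            S.toSubmodule := by
          rw [Submodule.span_le]
          rintro _ ⟨a, b, ha, hb, rfl⟩
          refine S.lie_mem (LieSubalgebra.subset_lieSpan ha) ?_
          rw [← hb]
          exact ih b
        exact hle (h.gen i hi v)
  intro v _
  rw [← h.sum v]
  exact S.toSubmodule.sum_mem fun i _ => key i v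

theorem apply_one_lie (h : IsGrading p N) (u v : L) : p 1 ⁅u, v⁆ = 0 :=
  h.apply_lie_of_lt (k := 1) (fun i hi => by
    rw [Nat.lt_one_iff.1 hi, h.zero, LinearMap.zero_apply]) 1 (by omega)

/-- The centralizer of `v` is a subalgebra, and degree one generates. -/
theorem lie_eq_zero_of_forall (h : IsGrading p N) {v : L}
    (hv : ∀ z, p 1 z = z → ⁅v, z⁆ = 0) (u : L) : ⁅v, u⁆ = 0 := by
  have hu : u ∈ LieSubalgebra.lieSpan ℂ L {v | p 1 v = v} := by
    rw [h.lieSpan_eq_top]; trivial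
  let S : LieSubalgebra ℂ L :=
    { LinearMap.ker (LieAlgebra.ad ℂ L v) with
      lie_mem' := fun {a b} ha hb => by
        change ⁅v, ⁅a, b⁆⁆ = 0
        have ha' : ⁅v, a⁆ = 0 := ha
        have hb' : ⁅v, b⁆ = 0 := hb
        rw [leibniz_lie, ha', hb']
        simp }
  exact (LieSubalgebra.lieSpan_le (K := S)).2 (fun z hz => hv z hz) hu

/-- In a nonsplit algebra no nonzero element of degree one is central. -/
theorem eq_zero_of_central (h : IsGrading p N) (hL : IsNonsplit L) {v y₂ : L} (hv1 : p 1 v = v)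
    (hv : ∀ z, p 1 z = z → ⁅v, z⁆ = 0) (hy : p 1 y₂ = 0) (hy0 : y₂ ≠ 0) : v = 0 := by
  by_contra hv0
  have hc := h.lie_eq_zero_of_forall hv
  obtain ⟨l, hl⟩ := Module.Projective.exists_dual_eq_one ℂ hv0
  -- `f` vanishes on all brackets, so its kernel is an ideal; it is complementary to the ideal
  -- spanned by the central `v`, and it is nonzero because it contains `y₂`.
  let f : L →ₗ[ℂ] ℂ := l.comp (p 1)
  have hf : ∀ a b : L, f ⁅a, b⁆ = 0 := fun a b => by
    simp [f, h.apply_one_lie]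
  let I : LieIdeal ℂ L :=
    { Submodule.span ℂ {v} with
      lie_mem := fun {u m} hm => by
        obtain ⟨c, rfl⟩ := Submodule.mem_span_singleton.1 hm
        have : ⁅u, c • v⁆ = 0 := by rw [lie_smul, ← lie_skew, hc]; simp
        rw [this]
        exact Submodule.zero_mem _ }
  let J : LieIdeal ℂ L := { LinearMap.ker f with lie_mem := fun {u m} _ => hf u m }
  have hIJ : IsCompl I J := by
    rw [← LieSubmodule.isCompl_toSubmodule]
    constructor
    · rw [Submodule.disjoint_def]
      intro u hu hu'
      obtain ⟨c, rfl⟩ := Submodule.mem_span_singleton.1 hu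
      have h0 : f (c • v) = 0 := hu'
      have hfv : f v = 1 := by simp [f, hv1, hl]
      rw [map_smul, hfv] at h0
      have : c = 0 := by simpa using h0
      simp [this]
    · rw [codisjoint_iff, eq_top_iff]
      intro u _
      rw [Submodule.mem_sup]
      refine ⟨f u • v, Submodule.smul_mem _ _ (Submodule.mem_span_singleton_self v),
        u - f u • v, ?_, by module⟩
      change f (u - f u • v) = 0
      simp [f, hv1, hl]
  rcases hL I J hIJ with h' | h'
  · have : v ∈ I := Submodule.mem_span_singleton_self v
    rw [h'] at this
    exact hv0 this
  · have : y₂ ∈ J := by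
      change f y₂ = 0
      simp [f, hy]
    rw [h'] at this
    exact hy0 this

/-- A thin grading of class `q`: the components of the adjoint operators of elements of degree
one have rank at most one, and `(ad x) ^ (q - 1) y ≠ 0`. -/
structure IsThin (p : ℕ → L →ₗ[ℂ] L) (q : ℕ) (x y : L) : Prop extends IsGrading p q where
  two_le : 2 ≤ q
  x_mem : p 1 x = x
  y_mem : p 1 y = y
  pow_ne : ((LieAlgebra.ad ℂ L x) ^ (q - 1)) y ≠ 0
  thin : ∀ z a b i, p 1 z = z → p i a = a → p i b = b →
        ¬ LinearIndependent ℂ ![⁅z, a⁆, ⁅z, b⁆]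

namespace IsThin

variable {q : ℕ} {x y : L}

theorem pow_ne' (h : IsThin p q x y) {i : ℕ} (hi : i < q) :
    ((LieAlgebra.ad ℂ L x) ^ i) y ≠ 0 := by
  intro h0
  apply h.pow_ne
  rw [show q - 1 = (q - 1 - i) + i by omega, pow_add, Module.End.mul_apply, h0]
  exact map_zero _

theorem lie_ne (h : IsThin p q x y) : ⁅x, y⁆ ≠ 0 := by
  have := h.pow_ne' (i := 1) (by have := h.two_le; omega)
  rwa [pow_one] at this

theorem exists_lie_x (h : IsThin p q x y) {z : L} (hz : p 1 z = z) : ∃ c : ℂ, ⁅x, z⁆ = c • ⁅x, y⁆ :=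
  exists_eq_smul (h.thin x y z 1 h.x_mem h.y_mem hz) h.lie_ne

/-- Thinness is applied to x + y, whose brackets with `y` and `v` are [x, y] and [y, v]. -/
theorem exists_lie_y (h : IsThin p q x y) {v : L} (hv : p 1 v = v) (hxv : ⁅x, v⁆ = 0) :
    ∃ c : ℂ, ⁅y, v⁆ = c • ⁅x, y⁆ := by
  have := h.thin (x + y) y v 1 (by rw [map_add, h.x_mem, h.y_mem]) h.y_mem hv
  simp only [add_lie, lie_self, add_zero, hxv, zero_add] at this
  exact exists_eq_smul this h.lie_ne

theorem exists_lie_ker (h : IsThin p q x y) {v w : L} (hv : p 1 v = v) (hxv : ⁅x, v⁆ = 0)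
    (hw : p 1 w = w) (hxw : ⁅x, w⁆ = 0) : ∃ c : ℂ, ⁅v, w⁆ = c • ⁅x, y⁆ := by
  obtain ⟨a, ha⟩ := h.exists_lie_y hv hxv
  -- As [v, y] = -a [x, y], the shift by (a + 1) x makes the bracket with `y` equal to [x, y],
  -- without changing the bracket with `w`.
  have := h.thin (v + (a + 1) • x) y w 1 (by rw [map_add, map_smul, h.x_mem, hv]) h.y_mem hw
  have e : ⁅v + (a + 1) • x, y⁆ = ⁅x, y⁆ := by
    rw [add_lie, smul_lie, ← lie_skew, ha]; module
  rw [e, add_lie, smul_lie, hxw, smul_zero, add_zero] at this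
  exact exists_eq_smul this h.lie_ne

/-- The brackets of elements of degree one are multiples of `[x, y]`. -/
theorem exists_lie (h : IsThin p q x y) {z w : L} (hz : p 1 z = z) (hw : p 1 w = w) :
    ∃ c : ℂ, ⁅z, w⁆ = c • ⁅x, y⁆ := by
  obtain ⟨a, ha⟩ := h.exists_lie_x hz
  obtain ⟨b, hb⟩ := h.exists_lie_x hw
  have hz' : p 1 (z - a • y) = z - a • y := by rw [map_sub, map_smul, hz, h.y_mem]
  have hw' : p 1 (w - b • y) = w - b • y := by rw [map_sub, map_smul, hw, h.y_mem]
  have hxz : ⁅x, z - a • y⁆ = 0 := by rw [lie_sub, lie_smul, ha, sub_self]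
  have hxw : ⁅x, w - b • y⁆ = 0 := by rw [lie_sub, lie_smul, hb, sub_self]
  obtain ⟨c₁, h₁⟩ := h.exists_lie_y hz' hxz
  obtain ⟨c₂, h₂⟩ := h.exists_lie_y hw' hxw
  obtain ⟨c₃, h₃⟩ := h.exists_lie_ker hz' hxz hw' hxw
  refine ⟨a * c₂ - b * c₁ + c₃, ?_⟩
  have e : ⁅z, w⁆ = a • ⁅y, w - b • y⁆ - b • ⁅y, z - a • y⁆ + ⁅z - a • y, w - b • y⁆ := by
    simp only [lie_sub, sub_lie, lie_smul, smul_lie, lie_self]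
    rw [← lie_skew z y]
    module
  rw [e, h₁, h₂, h₃]
  module

/-- If the class is at least three, then the algebra has two generators. -/
theorem exists_eq_add (h : IsThin p q x y) (hL : IsNonsplit L) (hq : 3 ≤ q) {z : L}
    (hz : p 1 z = z) : ∃ a b : ℂ, z = a • x + b • y := by
  have h3 : ⁅x, ⁅x, y⁆⁆ ≠ 0 := by
    have := h.pow_ne' (i := 2) (by omega)
    rwa [pow_two, Module.End.mul_apply] at this
  -- Multiples of `y` and then of `x` are removed so that the remainder commutes with both.
  have key : ∀ z, p 1 z = z → ∃ (a b : ℂ) (v : L), p 1 v = v ∧ ⁅x, v⁆ = 0 ∧ ⁅y, v⁆ = 0 ∧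
      z = a • x + b • y + v := by
    intro z hz
    obtain ⟨a, ha⟩ := h.exists_lie_x hz
    have hz' : p 1 (z - a • y) = z - a • y := by rw [map_sub, map_smul, hz, h.y_mem]
    have hxz : ⁅x, z - a • y⁆ = 0 := by rw [lie_sub, lie_smul, ha, sub_self]
    obtain ⟨c, hc⟩ := h.exists_lie_y hz' hxz
    refine ⟨-c, a, z - a • y + c • x, ?_, ?_, ?_, by module⟩
    · rw [map_add, hz', map_smul, h.x_mem]
    · rw [lie_add, hxz, lie_smul, lie_self, smul_zero, add_zero]
    · rw [lie_add, hc, lie_smul, ← lie_skew x y]; module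
  obtain ⟨a, b, v, hv, hxv, hyv, rfl⟩ := key z hz
  refine ⟨a, b, ?_⟩
  -- A remainder is central: two remainders have bracket c [x, y], which ad x kills by the Jacobi
  -- identity, while [x, [x, y]] ≠ 0 because the class is at least three. Nonsplitness then gives
  -- zero.
  have hv0 : v = 0 := by
    refine h.toIsGrading.eq_zero_of_central hL hv ?_ (h.toIsGrading.apply_one_lie x y) h.lie_ne
    intro w hw
    obtain ⟨a', b', v', hv', hxv', hyv', rfl⟩ := key w hw
    obtain ⟨c, hc⟩ := h.exists_lie_ker hv hxv hv' hxv'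
    have hc0 : c • ⁅x, ⁅x, y⁆⁆ = 0 := by
      rw [← lie_smul, ← hc, leibniz_lie, hxv, hxv', zero_lie, lie_zero, add_zero]
    have hvv : ⁅v, v'⁆ = 0 := by
      rw [hc, (smul_eq_zero.1 hc0).resolve_right h3, zero_smul]
    have e1 : ⁅v, x⁆ = 0 := by rw [← lie_skew, hxv, neg_zero]
    have e2 : ⁅v, y⁆ = 0 := by rw [← lie_skew, hyv, neg_zero]
    rw [lie_add, lie_add, lie_smul, lie_smul, e1, e2, hvv]
    simp
  rw [hv0, add_zero]

end IsThin

end IsGrading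

/-! ### Uniqueness of nondegenerate alternating forms -/

section Isometry

variable {V V' : Type u} [AddCommGroup V] [Module ℂ V] [AddCommGroup V'] [Module ℂ V']

/-- The decomposition of a space with an alternating form along a hyperbolic pair. -/
def hyperbolicEquiv (B : V →ₗ[ℂ] V →ₗ[ℂ] ℂ) (hB : ∀ v, B v v = 0) {u v : V} (huv : B u v = 1) :
    V ≃ₗ[ℂ] (ℂ × ℂ) × ↥(LinearMap.ker (B u) ⊓ LinearMap.ker (B v)) where
  toFun t := ((B t v, B u t), ⟨t - B t v • u - B u t • v, by
    have hvu : B v u = -1 := by rw [← LinearMap.IsAlt.neg hB, huv]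
    have h1 : B v t = - B t v := by rw [← LinearMap.IsAlt.neg hB]
    simp [hB, huv, hvu, h1]⟩)
  map_add' s t := by
    ext
    · simp
    · simp
    · simp only [map_add, LinearMap.add_apply, Prod.snd_add, Submodule.coe_add]
      module
  map_smul' c t := by
    ext
    · simp
    · simp
    · simp only [map_smul, LinearMap.smul_apply, Prod.smul_snd, SetLike.val_smul, smul_eq_mul,
        RingHom.id_apply]
      module
  invFun x := x.1.1 • u + x.1.2 • v + x.2
  left_inv t := by simp only; module
  right_inv := by
    rintro ⟨⟨a, b⟩, ⟨w, hw⟩⟩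
    have hw1 : B u w = 0 := hw.1
    have hw2 : B v w = 0 := hw.2
    have hw3 : B w v = 0 := by rw [← LinearMap.IsAlt.neg hB, hw2, neg_zero]
    ext
    · simp [huv, hB, hw3]
    · simp [huv, hB, hw1]
    · simp only [map_add, map_smul, LinearMap.add_apply, LinearMap.smul_apply, hB, huv, hw1, hw3,
        smul_eq_mul, mul_zero, mul_one, add_zero, zero_add]
      module

theorem apply_hyperbolicEquiv_symm (B : V →ₗ[ℂ] V →ₗ[ℂ] ℂ) (hB : ∀ v, B v v = 0) {u v : V}
    (huv : B u v = 1) (s t : (ℂ × ℂ) × ↥(LinearMap.ker (B u) ⊓ LinearMap.ker (B v))) :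
    B ((hyperbolicEquiv B hB huv).symm s) ((hyperbolicEquiv B hB huv).symm t) =
      s.1.1 * t.1.2 - s.1.2 * t.1.1 + B s.2 t.2 := by
  obtain ⟨⟨a, b⟩, ⟨w, hw⟩⟩ := s
  obtain ⟨⟨a', b'⟩, ⟨w', hw'⟩⟩ := t
  have hvu : B v u = -1 := by rw [← LinearMap.IsAlt.neg hB, huv]
  have hw1 : B u w' = 0 := hw'.1
  have hw2 : B v w' = 0 := hw'.2
  have hw3 : B w v = 0 := by
    rw [← LinearMap.IsAlt.neg hB, show B v w = 0 from hw.2, neg_zero]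
  have hw4 : B w u = 0 := by
    rw [← LinearMap.IsAlt.neg hB, show B u w = 0 from hw.1, neg_zero]
  have e : ∀ x, (hyperbolicEquiv B hB huv).symm x = x.1.1 • u + x.1.2 • v + x.2 := fun _ => rfl
  simp only [e, map_add, map_smul, LinearMap.add_apply, LinearMap.smul_apply, smul_eq_mul, hB, huv,
    hvu, hw1, hw2, hw3, hw4]
  ring

/-- Two nondegenerate alternating forms on spaces of the same dimension are isometric. -/
theorem exists_isometry (n : ℕ) : ∀ (V V' : Type u) [AddCommGroup V] [Module ℂ V]
    [AddCommGroup V'] [Module ℂ V'] [FiniteDimensional ℂ V] [FiniteDimensional ℂ V']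
    (B : V →ₗ[ℂ] V →ₗ[ℂ] ℂ) (B' : V' →ₗ[ℂ] V' →ₗ[ℂ] ℂ), Module.finrank ℂ V = n →
    Module.finrank ℂ V' = n → (∀ v, B v v = 0) → (∀ v, B' v v = 0) →
    (∀ v, (∀ w, B v w = 0) → v = 0) → (∀ v, (∀ w, B' v w = 0) → v = 0) →
    ∃ e : V ≃ₗ[ℂ] V', ∀ v w, B' (e v) (e w) = B v w := by
  induction n using Nat.strong_induction_on with
  | _ n ih =>
    intro V V' _ _ _ _ _ _ B B' hV hV' hB hB' hn hn'
    rcases Nat.eq_zero_or_pos n with rfl | hpos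
    · have := Module.finrank_zero_iff.1 hV
      refine ⟨LinearEquiv.ofFinrankEq V V' (hV.trans hV'.symm), fun v w => ?_⟩
      rw [Subsingleton.elim v 0]
      simp
    · have pair : ∀ (W : Type u) [AddCommGroup W] [Module ℂ W] (C : W →ₗ[ℂ] W →ₗ[ℂ] ℂ),
          0 < Module.finrank ℂ W → (∀ v, (∀ w, C v w = 0) → v = 0) → ∃ u v, C u v = 1 := by
        intro W _ _ C hW hC
        have : Nontrivial W := Module.nontrivial_of_finrank_pos hW
        obtain ⟨u, hu⟩ := exists_ne (0 : W)
        obtain ⟨v, hv⟩ : ∃ v, C u v ≠ 0 := by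
          by_contra! hc
          exact hu (hC u hc)
        exact ⟨u, (C u v)⁻¹ • v, by simp [hv]⟩
      -- A hyperbolic plane is split off on each side. The orthogonal complements have dimension n -
      -- 2 and are again nondegenerate, so induction applies.
      obtain ⟨u, v, huv⟩ := pair V B (hV ▸ hpos) hn
      obtain ⟨u', v', huv'⟩ := pair V' B' (hV' ▸ hpos) hn'
      have nondeg : ∀ (W : Type u) [AddCommGroup W] [Module ℂ W] (C : W →ₗ[ℂ] W →ₗ[ℂ] ℂ)
          (hC : ∀ v, C v v = 0) (hCn : ∀ v, (∀ w, C v w = 0) → v = 0) (u v : W) (huv : C u v = 1)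
          (s : ↥(LinearMap.ker (C u) ⊓ LinearMap.ker (C v))),
          (∀ t : ↥(LinearMap.ker (C u) ⊓ LinearMap.ker (C v)), C s t = 0) → s = 0 := by
        intro W _ _ C hC hCn u v huv s hs
        apply Subtype.ext
        apply hCn
        intro w
        have := apply_hyperbolicEquiv_symm C hC huv ((0, 0), s) (hyperbolicEquiv C hC huv w)
        rw [LinearEquiv.symm_apply_apply, hs] at this
        simpa [hyperbolicEquiv] using this
      have E := hyperbolicEquiv B hB huv
      have hd : Module.finrank ℂ V = 1 + 1 + Module.finrank ℂ
          ↥(LinearMap.ker (B u) ⊓ LinearMap.ker (B v)) := by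
        rw [(hyperbolicEquiv B hB huv).finrank_eq, Module.finrank_prod, Module.finrank_prod,
          Module.finrank_self]
      have hd' : Module.finrank ℂ V' = 1 + 1 + Module.finrank ℂ
          ↥(LinearMap.ker (B' u') ⊓ LinearMap.ker (B' v')) := by
        rw [(hyperbolicEquiv B' hB' huv').finrank_eq, Module.finrank_prod, Module.finrank_prod,
          Module.finrank_self]
      obtain ⟨e, he⟩ := ih (n - 2) (by omega) _ _
        (B.domRestrict₁₂ (LinearMap.ker (B u) ⊓ LinearMap.ker (B v))
          (LinearMap.ker (B u) ⊓ LinearMap.ker (B v)))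
        (B'.domRestrict₁₂ (LinearMap.ker (B' u') ⊓ LinearMap.ker (B' v'))
          (LinearMap.ker (B' u') ⊓ LinearMap.ker (B' v')))
        (by omega) (by omega) (fun v => hB v) (fun v => hB' v)
        (nondeg V B hB hn u v huv) (nondeg V' B' hB' hn' u' v' huv')
      refine ⟨((hyperbolicEquiv B hB huv).trans
        ((LinearEquiv.refl ℂ (ℂ × ℂ)).prodCongr e)).trans (hyperbolicEquiv B' hB' huv').symm, ?_⟩
      intro s t
      obtain ⟨s, rfl⟩ := (hyperbolicEquiv B hB huv).symm.surjective s
      obtain ⟨t, rfl⟩ := (hyperbolicEquiv B hB huv).symm.surjective t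
      rw [apply_hyperbolicEquiv_symm]
      simp only [LinearEquiv.trans_apply, LinearEquiv.apply_symm_apply]
      rw [apply_hyperbolicEquiv_symm]
      have := he s.2 t.2
      simp only [LinearMap.domRestrict₁₂_apply] at this
      simp [this]

end Isometry

/-! ### Class two: Heisenberg algebras -/

section Heisenberg

/-- The algebras of class two. -/
theorem nonempty_equiv_of_class_two {L L' : Type u} [LieRing L] [LieAlgebra ℂ L] [LieRing L']
    [LieAlgebra ℂ L'] [FiniteDimensional ℂ L] [FiniteDimensional ℂ L'] {p : ℕ → L →ₗ[ℂ] L}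
    {p' : ℕ → L' →ₗ[ℂ] L'} {x y : L} {x' y' : L'} (h : IsGrading.IsThin p 2 x y)
    (h' : IsGrading.IsThin p' 2 x' y') (hL : IsNonsplit L) (hL' : IsNonsplit L')
    (hd : Module.finrank ℂ L = Module.finrank ℂ L') : Nonempty (L ≃ₗ⁅ℂ⁆ L') := by
  -- L is identified with L_1 × ℂ, the second factor being the line of [x, y] and the bracket a
  -- scalar form on L_1. A vector in the radical of the form would be central in degree one, so
  -- nonsplitness gives nondegeneracy.
  have model : ∀ (L : Type u) [LieRing L] [LieAlgebra ℂ L] [FiniteDimensional ℂ L]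
      (p : ℕ → L →ₗ[ℂ] L) (x y : L), IsGrading.IsThin p 2 x y → IsNonsplit L →
      ∃ (V : Type u) (_ : AddCommGroup V) (_ : Module ℂ V) (_ : FiniteDimensional ℂ V)
        (B : V →ₗ[ℂ] V →ₗ[ℂ] ℂ) (e : L ≃ₗ[ℂ] V × ℂ), (∀ v, B v v = 0) ∧
        (∀ v, (∀ w, B v w = 0) → v = 0) ∧ ∀ a b, e ⁅a, b⁆ = (0, B (e a).1 (e b).1) := by
    intro L _ _ _ p x y h hL
    have hg := h.toIsGrading
    obtain ⟨l, hl⟩ := Module.Projective.exists_dual_eq_one ℂ h.lie_ne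
    have hsum : ∀ v, p 1 v + p 2 v = v := by
      intro v
      have := hg.sum v
      simpa [Finset.sum_range_succ, hg.zero] using this
    have hlie : ∀ a b : L, ⁅a, b⁆ = ⁅p 1 a, p 1 b⁆ := by
      intro a b
      have h2 : p 2 ⁅a, b⁆ = ⁅p 1 a, p 1 b⁆ := hg.apply_lie_succ (k := 1) (fun i hi => by
        rw [Nat.lt_one_iff.1 hi, hg.zero, LinearMap.zero_apply])
      rw [← hsum ⁅a, b⁆, h2, hg.apply_one_lie, zero_add]
    have hmul : ∀ a b : L, ⁅a, b⁆ = l ⁅a, b⁆ • ⁅x, y⁆ := by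
      intro a b
      obtain ⟨c, hc⟩ := h.exists_lie (hg.idem 1 a) (hg.idem 1 b)
      rw [hlie, hc, map_smul, hl, smul_eq_mul, mul_one]
    have hp2 : ∀ v, p 2 v = l (p 2 v) • ⁅x, y⁆ := by
      intro v
      have hm := hg.gen 1 le_rfl v
      generalize p (1 + 1) v = u at hm
      change u = l u • ⁅x, y⁆
      induction hm using Submodule.span_induction with
      | mem z hz => obtain ⟨a, b, -, -, rfl⟩ := hz; exact hmul a b
      | zero => simp
      | add a b _ _ ha hb => rw [map_add, add_smul, ← ha, ← hb]
      | smul c a _ ha => rw [map_smul, smul_assoc, ← ha]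
    have h2xy : p 2 ⁅x, y⁆ = ⁅x, y⁆ := hg.lie_mem h.x_mem h.y_mem
    have hV : ∀ v : ↥(LinearMap.range (p 1)), p 1 (v : L) = v := by
      rintro ⟨_, v, rfl⟩
      exact hg.idem _ _
    let e : L ≃ₗ[ℂ] ↥(LinearMap.range (p 1)) × ℂ :=
      { (LinearMap.rangeRestrict (p 1)).prod (l.comp (p 2)) with
        invFun := fun t => (t.1 : L) + t.2 • ⁅x, y⁆
        left_inv := fun v => by
          change p 1 v + l (p 2 v) • ⁅x, y⁆ = v
          rw [← hp2, hsum]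
        right_inv := fun t => by
          ext
          · change p 1 ((t.1 : L) + t.2 • ⁅x, y⁆) = t.1
            rw [map_add, map_smul, hg.apply_one_lie, smul_zero, add_zero, hV]
          · change l (p 2 ((t.1 : L) + t.2 • ⁅x, y⁆)) = t.2
            rw [map_add, map_smul, h2xy, ← hV t.1, hg.orth 2 1 _ (by norm_num), zero_add,
              map_smul, hl, smul_eq_mul, mul_one] }
    let B : ↥(LinearMap.range (p 1)) →ₗ[ℂ] ↥(LinearMap.range (p 1)) →ₗ[ℂ] ℂ :=
      LinearMap.mk₂ ℂ (fun a b : ↥(LinearMap.range (p 1)) => l ⁅(a : L), (b : L)⁆) (fun a a' b => by simp)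
        (fun c a b => by simp) (fun a b b' => by simp) (fun c a b => by simp)
    refine ⟨↥(LinearMap.range (p 1)), inferInstance, inferInstance, inferInstance, B, e,
      fun v => ?_, fun v hv => ?_, fun a b => ?_⟩
    · change l ⁅(v : L), (v : L)⁆ = 0
      rw [lie_self, map_zero]
    · apply Subtype.ext
      refine hg.eq_zero_of_central hL (hV v) (fun z hz => ?_) (hg.apply_one_lie x y) h.lie_ne
      have : l ⁅(v : L), z⁆ = 0 := hv ⟨z, z, hz⟩
      rw [hmul, this, zero_smul]
    · have h2 : p 2 ⁅a, b⁆ = ⁅a, b⁆ := by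
        rw [hlie]; exact hg.lie_mem (i := 1) (j := 1) (hg.idem _ _) (hg.idem _ _)
      ext
      · change p 1 ⁅a, b⁆ = 0
        exact hg.apply_one_lie a b
      · change l (p 2 ⁅a, b⁆) = l ⁅p 1 a, p 1 b⁆
        rw [h2, hlie]
  obtain ⟨V, _, _, _, B, e, hB, hn, he⟩ := model L p x y h hL
  obtain ⟨V', _, _, _, B', e', hB', hn', he'⟩ := model L' p' x' y' h' hL'
  have hd₁ := e.finrank_eq
  have hd₂ := e'.finrank_eq
  rw [Module.finrank_prod, Module.finrank_self] at hd₁ hd₂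
  obtain ⟨g, hg⟩ := exists_isometry (Module.finrank ℂ V) V V' B B' rfl (by omega) hB hB' hn hn'
  let E : L ≃ₗ[ℂ] L' := (e.trans (g.prodCongr (LinearEquiv.refl ℂ ℂ))).trans e'.symm
  refine ⟨{ E with map_lie' := fun {a b} => ?_ }⟩
  apply e'.injective
  change e' (E ⁅a, b⁆) = e' ⁅E a, E b⁆
  rw [he']
  simp [E, he, hg]

end Heisenberg

end NatGraded

end

/-! ### Frames and the algebra they determine -/

noncomputable section

namespace NatGraded

/-- A presentation by two generators `w 1`, `y 1` of an algebra with the homogeneous basis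
`y i` (`1 ≤ i ≤ q`), `w r` (`r ∈ S`). -/
structure IsFrame {L : Type u} [LieRing L] [LieAlgebra ℂ L] (q : ℕ) (S : Finset ℕ) (c l : ℕ → ℂ)
    (y w : ℕ → L) : Prop where
  gen : LieSubalgebra.lieSpan ℂ L {w 1, y 1} = ⊤
  card : Module.finrank ℂ L = q + S.card
  one_mem : 1 ∈ S
  bounds : ∀ r ∈ S, 1 ≤ r ∧ r ≤ q
  y_eq_zero : ∀ i, q < i → y i = 0
  w_eq_zero : ∀ r, 1 ≤ r → r ∉ S → w r = 0
  xy : ∀ i, 1 ≤ i → ⁅w 1, y i⁆ = y (i + 1)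
  xw : ∀ r, 1 ≤ r → ⁅w 1, w r⁆ = 0
  yy : ∀ j, 1 ≤ j → ⁅y 1, y j⁆ = c j • y (j + 1) + w (j + 1)
  yw : ∀ r, 1 ≤ r → ⁅y 1, w r⁆ = -(l r • y (r + 1))

/-- The coefficient of `y (i + j)` in the bracket `[y i, y j]`. -/
def coef (c : ℕ → ℂ) : ℕ → ℕ → ℂ
  | 0, _ => 0
  | 1, j => c j
  | i + 2, j => coef c (i + 1) j - coef c (i + 1) (j + 1)

theorem coef_one (c : ℕ → ℂ) (j : ℕ) : coef c 1 j = c j := rfl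

theorem coef_succ (c : ℕ → ℂ) {i : ℕ} (hi : 1 ≤ i) (j : ℕ) :
    coef c (i + 1) j = coef c i j - coef c i (j + 1) := by
  obtain ⟨i, rfl⟩ := Nat.exists_eq_succ_of_ne_zero (by omega : i ≠ 0)
  rfl

theorem lieSpan_pair_eq_top {L : Type u} [LieRing L] [LieAlgebra ℂ L] {a b a' b' : L}
    (h : LieSubalgebra.lieSpan ℂ L {a, b} = ⊤) (ha : a ∈ LieSubalgebra.lieSpan ℂ L {a', b'})
    (hb : b ∈ LieSubalgebra.lieSpan ℂ L {a', b'}) :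
    LieSubalgebra.lieSpan ℂ L {a', b'} = ⊤ := by
  rw [eq_top_iff, ← h, LieSubalgebra.lieSpan_le]
  rintro z (rfl | rfl)
  · exact ha
  · exact hb

namespace IsFrame

variable {L : Type u} [LieRing L] [LieAlgebra ℂ L] {q : ℕ} {S : Finset ℕ} {c l : ℕ → ℂ}
  {y w : ℕ → L}

/-- The basis vectors of a frame. -/
def vec (q : ℕ) (S : Finset ℕ) (y w : ℕ → L) : ↥(Finset.Icc 1 q) ⊕ ↥S → L :=
  Sum.elim (fun i => y i) (fun r => w r)

/-- The span V is stable under ad of both generators. The elements whose adjoint operator preserves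
V form a subalgebra, hence are everything; so V is itself a subalgebra containing the generators.
With the dimension count `card` this makes the vectors a basis. -/
theorem span_vec (h : IsFrame q S c l y w) : Submodule.span ℂ (Set.range (vec q S y w)) = ⊤ := by
  set V := Submodule.span ℂ (Set.range (vec q S y w)) with hV
  have hy : ∀ i, 1 ≤ i → y i ∈ V := by
    intro i hi
    by_cases hq : i ≤ q
    · exact Submodule.subset_span ⟨Sum.inl ⟨i, Finset.mem_Icc.2 ⟨hi, hq⟩⟩, rfl⟩
    · rw [h.y_eq_zero i (by omega)]; exact zero_mem _
  have hw : ∀ r, 1 ≤ r → w r ∈ V := by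
    intro r hr
    by_cases hS : r ∈ S
    · exact Submodule.subset_span ⟨Sum.inr ⟨r, hS⟩, rfl⟩
    · rw [h.w_eq_zero r hr hS]; exact zero_mem _
  have stab : ∀ a : L, (∀ i, 1 ≤ i → ⁅a, y i⁆ ∈ V) → (∀ r, 1 ≤ r → ⁅a, w r⁆ ∈ V) →
      ∀ v ∈ V, ⁅a, v⁆ ∈ V := by
    intro a h1 h2 v hv
    have : V ≤ V.comap (LieAlgebra.ad ℂ L a) := by
      rw [hV, Submodule.span_le]
      rintro _ ⟨i | r, rfl⟩
      · exact h1 i (Finset.mem_Icc.1 i.2).1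
      · exact h2 r (h.bounds r r.2).1
    exact this hv
  let K : LieSubalgebra ℂ L :=
    { carrier := {a | ∀ v ∈ V, ⁅a, v⁆ ∈ V}
      add_mem' := fun {a b} ha hb v hv => by rw [add_lie]; exact add_mem (ha v hv) (hb v hv)
      zero_mem' := fun v _ => by rw [zero_lie]; exact zero_mem _
      smul_mem' := fun t a ha v hv => by rw [smul_lie]; exact V.smul_mem t (ha v hv)
      lie_mem' := fun {a b} ha hb v hv => by
        rw [lie_lie]
        exact sub_mem (ha _ (hb v hv)) (hb _ (ha v hv)) }
  have hK : ∀ a : L, a ∈ K := by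
    intro a
    have : LieSubalgebra.lieSpan ℂ L {w 1, y 1} ≤ K := by
      rw [LieSubalgebra.lieSpan_le]
      rintro z (rfl | rfl)
      · refine stab _ (fun i hi => ?_) (fun r hr => ?_)
        · rw [h.xy i hi]; exact hy _ (by omega)
        · rw [h.xw r hr]; exact zero_mem _
      · refine stab _ (fun i hi => ?_) (fun r hr => ?_)
        · rw [h.yy i hi]; exact add_mem (V.smul_mem _ (hy _ (by omega))) (hw _ (by omega))
        · rw [h.yw r hr]; exact V.neg_mem (V.smul_mem _ (hy _ (by omega)))
    exact this (h.gen ▸ LieSubalgebra.mem_top a)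
  let V' : LieSubalgebra ℂ L := { V with lie_mem' := fun {a b} _ hb => hK a b hb }
  rw [eq_top_iff]
  intro a _
  have : LieSubalgebra.lieSpan ℂ L {w 1, y 1} ≤ V' := by
    rw [LieSubalgebra.lieSpan_le]
    rintro z (rfl | rfl)
    · exact hw 1 le_rfl
    · exact hy 1 le_rfl
  exact this (h.gen ▸ LieSubalgebra.mem_top a)

theorem linearIndependent_vec (h : IsFrame q S c l y w) :
    LinearIndependent ℂ (vec q S y w) := by
  apply linearIndependent_of_top_le_span_of_card_eq_finrank h.span_vec.ge
  rw [h.card]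
  simp

/-- The basis of a frame. -/
def basis (h : IsFrame q S c l y w) : Module.Basis (↥(Finset.Icc 1 q) ⊕ ↥S) ℂ L :=
  Module.Basis.mk h.linearIndependent_vec h.span_vec.ge

theorem basis_inl (h : IsFrame q S c l y w) (i : ↥(Finset.Icc 1 q)) :
    h.basis (Sum.inl i) = y i := by simp [basis, vec]

theorem basis_inr (h : IsFrame q S c l y w) (r : ↥S) : h.basis (Sum.inr r) = w r := by
  simp [basis, vec]

theorem y_ne_zero (h : IsFrame q S c l y w) {i : ℕ} (h1 : 1 ≤ i) (hq : i ≤ q) : y i ≠ 0 := by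
  have : vec q S y w (Sum.inl ⟨i, Finset.mem_Icc.2 ⟨h1, hq⟩⟩) ≠ 0 :=
    h.linearIndependent_vec.ne_zero _
  exact this

theorem smul_y (h : IsFrame q S c l y w) {i : ℕ} (h1 : 1 ≤ i) (hq : i ≤ q) {a : ℂ}
    (ha : a • y i = 0) : a = 0 :=
  (smul_eq_zero.1 ha).resolve_right (h.y_ne_zero h1 hq)

theorem pair (h : IsFrame q S c l y w) {r : ℕ} (hr : r ∈ S) {a b : ℂ}
    (hab : a • y r + b • w r = 0) : a = 0 ∧ b = 0 := by
  have hli := h.linearIndependent_vec.comp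
    ![Sum.inl ⟨r, Finset.mem_Icc.2 (h.bounds r hr)⟩, Sum.inr ⟨r, hr⟩] (by
      intro i j hij
      fin_cases i <;> fin_cases j <;> simp at hij ⊢)
  have e : vec q S y w ∘ ![Sum.inl ⟨r, Finset.mem_Icc.2 (h.bounds r hr)⟩, Sum.inr ⟨r, hr⟩] =
      ![y r, w r] := by
    ext i
    fin_cases i <;> simp [vec]
  rw [e, LinearIndependent.pair_iff] at hli
  exact hli a b hab

/-- Algebras with the same structure constants are isomorphic. -/
theorem nonempty_equiv {L' : Type u} [LieRing L'] [LieAlgebra ℂ L'] {c' l' : ℕ → ℂ}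
    {y' w' : ℕ → L'} (h : IsFrame q S c l y w) (h' : IsFrame q S c' l' y' w')
    (hc : ∀ j, 1 ≤ j → j < q → c j = c' j) (hl : ∀ r, 1 ≤ r → r < q → l r = l' r) :
    Nonempty (L ≃ₗ⁅ℂ⁆ L') := by
  let f : L ≃ₗ[ℂ] L' := h.basis.equiv h'.basis (Equiv.refl _)
  have fy : ∀ i, 1 ≤ i → f (y i) = y' i := by
    intro i hi
    by_cases hq : i ≤ q
    · rw [← h.basis_inl ⟨i, Finset.mem_Icc.2 ⟨hi, hq⟩⟩, Module.Basis.equiv_apply,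
        Equiv.refl_apply, h'.basis_inl]
    · rw [h.y_eq_zero i (by omega), h'.y_eq_zero i (by omega), map_zero]
  have fw : ∀ r, 1 ≤ r → f (w r) = w' r := by
    intro r hr
    by_cases hS : r ∈ S
    · rw [← h.basis_inr ⟨r, hS⟩, Module.Basis.equiv_apply, Equiv.refl_apply, h'.basis_inr]
    · rw [h.w_eq_zero r hr hS, h'.w_eq_zero r hr hS, map_zero]
  have comm : ∀ (a : L) (a' : L'), (∀ i, 1 ≤ i → f ⁅a, y i⁆ = ⁅a', y' i⁆) →
      (∀ r, 1 ≤ r → f ⁅a, w r⁆ = ⁅a', w' r⁆) → ∀ v, f ⁅a, v⁆ = ⁅a', f v⁆ := by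
    intro a a' h1 h2 v
    have : (f : L →ₗ[ℂ] L').comp (LieAlgebra.ad ℂ L a) =
        (LieAlgebra.ad ℂ L' a' : L' →ₗ[ℂ] L').comp (f : L →ₗ[ℂ] L') := by
      apply h.basis.ext
      rintro (i | r)
      · rw [h.basis_inl]
        have hi := (Finset.mem_Icc.1 i.2).1
        simpa [fy i hi] using h1 i hi
      · rw [h.basis_inr]
        have hr := (h.bounds r r.2).1
        simpa [fw r hr] using h2 r hr
    exact LinearMap.congr_fun this v
  -- The elements `a` for which `f` intertwines ad a and ad (f a) form a subalgebra, so it suffices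
  -- to check the two generators on the basis.
  let K : LieSubalgebra ℂ L :=
    { carrier := {a | ∀ v, f ⁅a, v⁆ = ⁅f a, f v⁆}
      add_mem' := fun {a b} ha hb v => by rw [add_lie, map_add, ha v, hb v, map_add, add_lie]
      zero_mem' := fun v => by simp
      smul_mem' := fun t a ha v => by rw [smul_lie, map_smul, ha v, map_smul, smul_lie]
      lie_mem' := fun {a b} ha hb v => by
        rw [lie_lie, map_sub, ha, hb, hb, ha, ha, lie_lie] }
  have hK : ∀ a, a ∈ K := by
    intro a
    have : LieSubalgebra.lieSpan ℂ L {w 1, y 1} ≤ K := by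
      rw [LieSubalgebra.lieSpan_le]
      rintro z (rfl | rfl)
      · change ∀ v, _ = ⁅f (w 1), _⁆
        rw [fw 1 le_rfl]
        refine comm _ _ (fun i hi => ?_) (fun r hr => ?_)
        · rw [h.xy i hi, h'.xy i hi, fy _ (by omega)]
        · rw [h.xw r hr, h'.xw r hr, map_zero]
      · change ∀ v, _ = ⁅f (y 1), _⁆
        rw [fy 1 le_rfl]
        refine comm _ _ (fun i hi => ?_) (fun r hr => ?_)
        · rw [h.yy i hi, h'.yy i hi, map_add, map_smul, fy _ (by omega), fw _ (by omega)]
          by_cases hi' : i < q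
          · rw [hc i hi hi']
          · rw [h'.y_eq_zero _ (by omega), smul_zero, smul_zero]
        · rw [h.yw r hr, h'.yw r hr, map_neg, map_smul, fy _ (by omega)]
          by_cases hr' : r < q
          · rw [hl r hr hr']
          · rw [h'.y_eq_zero _ (by omega), smul_zero, smul_zero]
    exact this (h.gen ▸ LieSubalgebra.mem_top a)
  exact ⟨{ f with map_lie' := fun {a b} => hK a b }⟩

/-! ### The identities imposed by antisymmetry and Jacobi -/

section Brackets

/-- Since ad (w 1) is a derivation, [y_{i+1}, y_j] = [w_1, [y_i, y_j]] - [y_i, y_{j+1}]. This is the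
recursion of `coef`; as w_1 commutes with every w_r, the coefficient of `w` merely alternates in
sign. -/
theorem lie_y_y (h : IsFrame q S c l y w) {i : ℕ} (hi : 1 ≤ i) : ∀ {j : ℕ}, 1 ≤ j →
    ⁅y i, y j⁆ = coef c i j • y (i + j) + (-1 : ℂ) ^ (i + 1) • w (i + j) := by
  induction i, hi using Nat.le_induction with
  | base =>
    intro j hj
    rw [h.yy j hj, coef_one, add_comm 1 j]
    simp
  | succ i hi ih =>
    intro j hj
    rw [← h.xy i hi, lie_lie, ih hj, h.xy j hj, ih (j := j + 1) (by omega), coef_succ c hi, lie_add,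
      lie_smul, lie_smul, h.xy _ (by omega), h.xw _ (by omega),
      show i + 1 + j = i + j + 1 by ring, show i + (j + 1) = i + j + 1 by ring, pow_succ]
    module

/-- Because w_r commutes with w_1, its action commutes with the shift ad (w 1) and is governed by
one scalar. -/
theorem lie_w_y (h : IsFrame q S c l y w) {r : ℕ} (hr : 1 ≤ r) {i : ℕ} (hi : 1 ≤ i) :
    ⁅w r, y i⁆ = l r • y (r + i) := by
  induction i, hi using Nat.le_induction with
  | base => rw [← lie_skew, h.yw r hr, neg_neg]
  | succ i hi ih =>
    have : ⁅w r, w 1⁆ = 0 := by rw [← lie_skew, h.xw r hr, neg_zero]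
    rw [← h.xy i hi, leibniz_lie, this, ih, lie_smul, h.xy _ (by omega), zero_lie, zero_add,
      add_assoc]

/-- In [y_k, y_k] = 0 the vector w_{2k} occurs with coefficient ±1. Hence `S` contains only odd
degrees. -/
theorem w_even (h : IsFrame q S c l y w) {k : ℕ} (hk : 1 ≤ k) : w (k + k) = 0 := by
  by_cases hS : k + k ∈ S
  · have h0 := h.lie_y_y hk hk
    rw [lie_self] at h0
    have := (h.pair hS h0.symm).2
    exact absurd this (pow_ne_zero _ (by norm_num))
  · exact h.w_eq_zero _ (by omega) hS

theorem w_eq_zero_of_even (h : IsFrame q S c l y w) {r : ℕ} (hr : 1 ≤ r) (he : Even r) :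
    w r = 0 := by
  obtain ⟨k, rfl⟩ := he
  exact h.w_even (by omega)

/-- The `w` parts of [y_i, y_j] and [y_j, y_i] cancel: if i + j is even, w_{i+j} is zero, and if it
is odd, the two signs are opposite. -/
theorem coef_antisymm (h : IsFrame q S c l y w) {i j : ℕ} (hi : 1 ≤ i) (hj : 1 ≤ j)
    (hq : i + j ≤ q) : coef c i j = -coef c j i := by
  have h1 := h.lie_y_y hi hj
  have h2 := h.lie_y_y hj hi
  rw [← lie_skew, h2, add_comm j i] at h1
  have h3 : ((-1 : ℂ) ^ (i + 1) + (-1) ^ (j + 1)) • w (i + j) = 0 := by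
    rcases Nat.even_or_odd (i + j) with he | ho
    · rw [h.w_eq_zero_of_even (by omega) he, smul_zero]
    · have : (-1 : ℂ) ^ (i + 1) + (-1) ^ (j + 1) = 0 := by
        obtain ⟨k, hk⟩ := ho
        rcases Nat.even_or_odd i with h' | h'
        · have h'' : Odd j := by
            rcases Nat.even_or_odd j with h'' | h''
            · exact absurd (h'.add h'') (by rw [hk]; simp)
            · exact h''
          rw [(h'.add_one).neg_one_pow, (h''.add_one).neg_one_pow]; norm_num
        · have h'' : Even j := by
            rcases Nat.even_or_odd j with h'' | h''
            · exact h''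
            · exact absurd (h'.add_odd h'') (by rw [hk]; simp)
          rw [(h'.add_one).neg_one_pow, (h''.add_one).neg_one_pow]; norm_num
      rw [this, zero_smul]
  have h4 : (coef c i j + coef c j i) • y (i + j) = 0 := by
    have : (coef c i j + coef c j i) • y (i + j) +
        ((-1 : ℂ) ^ (i + 1) + (-1) ^ (j + 1)) • w (i + j) = 0 := by
      have h5 := sub_eq_zero.2 h1
      rw [← neg_eq_zero, ← h5]
      module
    rwa [h3, add_zero] at this
  exact eq_neg_of_add_eq_zero_left (h.smul_y (by omega) hq h4)

/-- The coefficients of the Jacobi identity for three of the `y i`. -/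
theorem jacobi (h : IsFrame q S c l y w) {i j k : ℕ} (hi : 1 ≤ i) (hj : 1 ≤ j) (hk : 1 ≤ k) :
    ((coef c i j * coef c (i + j) k + (-1) ^ (i + 1) * l (i + j)) +
      (coef c j k * coef c (j + k) i + (-1) ^ (j + 1) * l (j + k)) +
      (coef c k i * coef c (k + i) j + (-1) ^ (k + 1) * l (k + i))) • y (i + j + k) +
    (coef c i j * (-1) ^ (i + j + 1) + coef c j k * (-1) ^ (j + k + 1) +
      coef c k i * (-1) ^ (k + i + 1)) • w (i + j + k) = 0 := by
  have key : ∀ {i j k : ℕ}, 1 ≤ i → 1 ≤ j → 1 ≤ k → ⁅⁅y i, y j⁆, y k⁆ =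
      (coef c i j * coef c (i + j) k + (-1) ^ (i + 1) * l (i + j)) • y (i + j + k) +
      (coef c i j * (-1) ^ (i + j + 1)) • w (i + j + k) := by
    intro i j k hi hj hk
    rw [h.lie_y_y hi hj, add_lie, smul_lie, smul_lie, h.lie_y_y (by omega) hk,
      h.lie_w_y (by omega) hk]
    module
  have h1 := key hi hj hk
  have h2 := key hj hk hi
  have h3 := key hk hi hj
  rw [show j + k + i = i + j + k by ring] at h2
  rw [show k + i + j = i + j + k by ring] at h3
  have h0 : ⁅⁅y i, y j⁆, y k⁆ + ⁅⁅y j, y k⁆, y i⁆ + ⁅⁅y k, y i⁆, y j⁆ = 0 := by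
    rw [lie_lie (y i), ← lie_skew (⁅y j, y k⁆) (y i), ← lie_skew (⁅y k, y i⁆) (y j),
      ← lie_skew (y k) (y i), lie_neg]
    abel
  rw [h1, h2, h3] at h0
  rw [← h0]
  module

theorem jacobi_y (h : IsFrame q S c l y w) {i j k : ℕ} (hi : 1 ≤ i) (hj : 1 ≤ j) (hk : 1 ≤ k)
    (hq : i + j + k ≤ q) :
    (coef c i j * coef c (i + j) k + (-1) ^ (i + 1) * l (i + j)) +
      (coef c j k * coef c (j + k) i + (-1) ^ (j + 1) * l (j + k)) +
      (coef c k i * coef c (k + i) j + (-1) ^ (k + 1) * l (k + i)) = 0 := by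
  have h0 := h.jacobi hi hj hk
  by_cases hS : i + j + k ∈ S
  · exact (h.pair hS h0).1
  · rw [h.w_eq_zero _ (by omega) hS, smul_zero, add_zero] at h0
    exact h.smul_y (by omega) hq h0

theorem l_eq_zero_of_w (h : IsFrame q S c l y w) {r : ℕ} (hr : 1 ≤ r) (hq : r < q)
    (hw : w r = 0) : l r = 0 := by
  have := h.lie_w_y hr le_rfl
  rw [hw, zero_lie] at this
  exact h.smul_y (by omega) (by omega) this.symm

theorem l_even (h : IsFrame q S c l y w) {r : ℕ} (hr : 1 ≤ r) (hq : r < q) (he : Even r) :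
    l r = 0 := h.l_eq_zero_of_w hr hq (h.w_eq_zero_of_even hr he)

theorem lie_w_w (h : IsFrame q S c l y w) {r j : ℕ} (hr : Odd r) (hj : 1 ≤ j) :
    ⁅w r, w (j + 1)⁆ = (l r * (coef c (r + 1) j + c (r + j) - c j)) • y (r + (j + 1)) := by
  have hr1 : 1 ≤ r := hr.pos
  have h1 : w (j + 1) = ⁅y 1, y j⁆ - c j • y (j + 1) := by rw [h.yy j hj]; module
  have h2 := h.lie_y_y (i := r + 1) (by omega) hj
  have h3 := h.yy (r + j) (by omega)
  have hs : (-1 : ℂ) ^ (r + 1 + 1) = -1 := by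
    rw [pow_succ, (hr.add_one).neg_one_pow, one_mul]
  rw [hs, show r + 1 + j = r + (j + 1) by ring] at h2
  rw [show r + j + 1 = r + (j + 1) by ring] at h3
  rw [h1, lie_sub, lie_smul, leibniz_lie, h.lie_w_y hr1 le_rfl, h.lie_w_y hr1 hj,
    h.lie_w_y hr1 (by omega), smul_lie, lie_smul, h2, h3]
  module

theorem lie_w_w_antisymm (h : IsFrame q S c l y w) {i j : ℕ} (hi : Even i) (hj : Even j)
    (hi1 : 1 ≤ i) (hj1 : 1 ≤ j) (hq : i + j + 2 ≤ q) :
    l (i + 1) * (coef c (i + 1 + 1) j + c (i + 1 + j) - c j) =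
      -(l (j + 1) * (coef c (j + 1 + 1) i + c (j + 1 + i) - c i)) := by
  have h1 := h.lie_w_w hi.add_one hj1
  have h2 := h.lie_w_w hj.add_one hi1
  rw [← lie_skew, h2, show j + 1 + (i + 1) = i + 1 + (j + 1) by ring, ← neg_smul] at h1
  have h3 := sub_eq_zero.2 h1
  rw [← sub_smul] at h3
  have := h.smul_y (by omega) (by omega) h3
  exact (sub_eq_zero.1 this).symm

end Brackets

/-! ### Elementary changes of frame -/

section Moves

/-- c_j and l_r multiply y_{j+1} and y_{r+1}, which vanish for indices j, r at least `q`; only the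
values below `q` matter. -/
theorem congr (h : IsFrame q S c l y w) {c' l' : ℕ → ℂ} (hc : ∀ j, 1 ≤ j → j < q → c j = c' j)
    (hl : ∀ r, 1 ≤ r → r < q → l r = l' r) : IsFrame q S c' l' y w :=
  { h with
    yy := fun j hj => by
      rw [h.yy j hj]
      by_cases hq : j < q
      · rw [hc j hj hq]
      · rw [h.y_eq_zero _ (by omega), smul_zero, smul_zero]
    yw := fun r hr => by
      rw [h.yw r hr]
      by_cases hq : r < q
      · rw [hl r hr hq]
      · rw [h.y_eq_zero _ (by omega), smul_zero, smul_zero] }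

/-- Adding a multiple of the first generator to the second one. -/
theorem shift (h : IsFrame q S c l y w) (a : ℂ) :
    IsFrame q S (fun j => if j = 1 then c 1 else c j + a) l
      (fun i => if i = 1 then y 1 + a • w 1 else y i) w where
  gen := by
    refine lieSpan_pair_eq_top h.gen (LieSubalgebra.subset_lieSpan (by simp)) ?_
    have : y 1 = (if (1 : ℕ) = 1 then y 1 + a • w 1 else y 1) - a • w 1 := by
      rw [if_pos rfl]; module
    rw [this]
    exact sub_mem (LieSubalgebra.subset_lieSpan (by simp))
      (LieSubalgebra.smul_mem _ _ (LieSubalgebra.subset_lieSpan (by simp)))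
  card := h.card
  one_mem := h.one_mem
  bounds := h.bounds
  y_eq_zero i hi := by
    have := h.bounds 1 h.one_mem
    rw [if_neg (by omega), h.y_eq_zero i hi]
  w_eq_zero := h.w_eq_zero
  xy i hi := by
    rw [if_neg (by omega : i + 1 ≠ 1)]
    split_ifs with h1
    · subst h1
      rw [lie_add, lie_smul, lie_self, smul_zero, add_zero, h.xy 1 le_rfl]
    · exact h.xy i hi
  xw := h.xw
  yy j hj := by
    rw [if_pos rfl, if_neg (by omega : j + 1 ≠ 1)]
    split_ifs with h1
    · subst h1
      rw [lie_self, ← h.yy 1 le_rfl, lie_self]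
    · rw [add_lie, smul_lie, h.xy j hj, h.yy j hj]
      module
  yw r hr := by
    rw [if_pos rfl, if_neg (by omega : r + 1 ≠ 1), add_lie, smul_lie, h.xw r hr, h.yw r hr]
    simp

/-- Multiplying the second generator by a nonzero scalar. -/
theorem scale (h : IsFrame q S c l y w) {a : ℂ} (ha : a ≠ 0) :
    IsFrame q S (fun j => a * c j) (fun r => if r = 1 then l 1 else a ^ 2 * l r)
      (fun i => a • y i) (fun r => if r = 1 then w 1 else a ^ 2 • w r) where
  gen := by
    refine lieSpan_pair_eq_top h.gen (LieSubalgebra.subset_lieSpan (by simp)) ?_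
    have hm : a • y 1 ∈ LieSubalgebra.lieSpan ℂ L {if (1 : ℕ) = 1 then w 1 else a ^ 2 • w 1, a • y 1} :=
      LieSubalgebra.subset_lieSpan (by simp)
    have := LieSubalgebra.smul_mem _ a⁻¹ hm
    rwa [smul_smul, inv_mul_cancel₀ ha, one_smul] at this
  card := h.card
  one_mem := h.one_mem
  bounds := h.bounds
  y_eq_zero i hi := by rw [h.y_eq_zero i hi, smul_zero]
  w_eq_zero r hr hS := by
    have : r ≠ 1 := fun h' => hS (h' ▸ h.one_mem)
    rw [if_neg this, h.w_eq_zero r hr hS, smul_zero]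
  xy i hi := by rw [if_pos rfl, lie_smul, h.xy i hi]
  xw r hr := by
    rw [if_pos rfl]
    split_ifs with h1
    · rw [lie_self]
    · rw [lie_smul, h.xw r hr, smul_zero]
  yy j hj := by
    rw [if_neg (by omega), smul_lie, lie_smul, h.yy j hj]
    module
  yw r hr := by
    split_ifs with h1
    · subst h1
      rw [smul_lie, h.yw 1 le_rfl]
      module
    · rw [smul_lie, lie_smul, h.yw r hr]
      module

/-- Changing the complement of `y q` in the top component. -/
theorem absorb (h : IsFrame q S c l y w) (hS : q ∈ S) (h2 : 2 ≤ q) (a : ℂ) :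
    IsFrame q S (fun j => if j + 1 = q then c j - a else c j) l y
      (fun r => if r = q then w q + a • y q else w r) where
  gen := by rw [if_neg (by omega)]; exact h.gen
  card := h.card
  one_mem := h.one_mem
  bounds := h.bounds
  y_eq_zero := h.y_eq_zero
  w_eq_zero r hr hS' := by
    have : r ≠ q := fun h' => hS' (h' ▸ hS)
    rw [if_neg this, h.w_eq_zero r hr hS']
  xy i hi := by rw [if_neg (by omega), h.xy i hi]
  xw r hr := by
    rw [if_neg (by omega)]
    split_ifs with h1
    · subst h1
      rw [lie_add, lie_smul, h.xw r hr, h.xy r hr, h.y_eq_zero _ (by omega)]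
      simp
    · exact h.xw r hr
  yy j hj := by
    split_ifs with h1
    · rw [h.yy j hj, ← h1]
      module
    · exact h.yy j hj
  yw r hr := by
    split_ifs with h1
    · subst h1
      rw [lie_add, lie_smul, h.yw r hr, h.yy r hr, h.y_eq_zero (r + 1) (by omega),
        h.w_eq_zero (r + 1) (by omega) (fun h' => by have := (h.bounds _ h').2; omega)]
      simp
    · exact h.yw r hr

end Moves

end IsFrame

end NatGraded

end

/-! ### Construction of a frame from a thin grading -/

noncomputable section

namespace NatGraded

namespace IsGrading.IsThin

variable {L : Type u} [LieRing L] [LieAlgebra ℂ L] {p : ℕ → L →ₗ[ℂ] L} {q : ℕ} {x y : L}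

/-- An algebra of class at least three with a thin grading has a frame. -/
theorem exists_frame [FiniteDimensional ℂ L] (h : IsThin p q x y) (hL : IsNonsplit L)
    (hq : 3 ≤ q) : ∃ (S : Finset ℕ) (c l : ℕ → ℂ) (Y W : ℕ → L), IsFrame q S c l Y W := by
  classical
  have hg := h.toIsGrading
  let Y : ℕ → L := fun i => ((LieAlgebra.ad ℂ L x) ^ (i - 1)) y
  have Y1 : Y 1 = y := rfl
  have Ysucc : ∀ i, 1 ≤ i → ⁅x, Y i⁆ = Y (i + 1) := by
    intro i hi
    simp only [Y]
    rw [show i + 1 - 1 = (i - 1) + 1 by omega, pow_succ', Module.End.mul_apply,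
      LieAlgebra.ad_apply]
  have Ymem : ∀ i, 1 ≤ i → p i (Y i) = Y i := by
    intro i hi
    have := hg.ad_pow_mem h.x_mem h.y_mem (i - 1)
    rwa [show i - 1 + 1 = i by omega] at this
  have Yne : ∀ i, 1 ≤ i → i ≤ q → Y i ≠ 0 := fun i hi hi' => h.pow_ne' (by omega)
  have top : ∀ i v, q < i → p i v = v → v = 0 := by
    intro i v hi hv
    rw [← hv, hg.eq_zero i hi, LinearMap.zero_apply]
  have Yzero : ∀ i, q < i → Y i = 0 := fun i hi => top i _ hi (Ymem i (by omega))
  -- `C` must make the remainder lie in the kernel of ad x and be zero or independent of Y_{j+1}.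
  -- Below degree `q` thinness of ad x supplies it. In degree `q` every vector is killed by ad x, so
  -- `C` is chosen to make the remainder zero whenever possible.
  have hC : ∀ j, 1 ≤ j → ∃ C : ℂ, ⁅x, ⁅y, Y j⁆ - C • Y (j + 1)⁆ = 0 ∧
      (⁅y, Y j⁆ - C • Y (j + 1) = 0 ∨ ∀ a b : ℂ,
        a • Y (j + 1) + b • (⁅y, Y j⁆ - C • Y (j + 1)) = 0 → a = 0 ∧ b = 0) := by
    intro j hj
    have hm : p (j + 1) ⁅y, Y j⁆ = ⁅y, Y j⁆ := by
      rw [add_comm]; exact hg.lie_mem h.y_mem (Ymem j hj)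
    rcases lt_trichotomy (j + 1) q with hjq | hjq | hjq
    · have hn : ⁅x, Y (j + 1)⁆ ≠ 0 := by
        rw [Ysucc _ (by omega)]; exact Yne _ (by omega) (by omega)
      obtain ⟨C, hC⟩ := exists_eq_smul (h.thin x (Y (j + 1)) ⁅y, Y j⁆ (j + 1) h.x_mem
        (Ymem _ (by omega)) hm) hn
      have hx : ⁅x, ⁅y, Y j⁆ - C • Y (j + 1)⁆ = 0 := by rw [lie_sub, lie_smul, hC, sub_self]
      refine ⟨C, hx, ?_⟩
      by_cases h0 : ⁅y, Y j⁆ - C • Y (j + 1) = 0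
      · exact Or.inl h0
      · refine Or.inr fun a b hab => ?_
        have h1 := congrArg (fun v => ⁅x, v⁆) hab
        simp only [lie_add, lie_smul, hx, smul_zero, add_zero, lie_zero] at h1
        have ha := (smul_eq_zero.1 h1).resolve_right hn
        subst ha
        rw [zero_smul, zero_add] at hab
        exact ⟨rfl, (smul_eq_zero.1 hab).resolve_right h0⟩
    · have hx : ∀ C : ℂ, ⁅x, ⁅y, Y j⁆ - C • Y (j + 1)⁆ = 0 := by
        intro C
        refine top (1 + (j + 1)) _ (by omega) (hg.lie_mem h.x_mem ?_)
        rw [map_sub, map_smul, hm, Ymem _ (by omega)]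
      by_cases hs : ∃ C : ℂ, ⁅y, Y j⁆ = C • Y (j + 1)
      · obtain ⟨C, hC⟩ := hs
        exact ⟨C, hx C, Or.inl (by rw [hC, sub_self])⟩
      · refine ⟨0, hx 0, Or.inr fun a b hab => ?_⟩
        rw [zero_smul, sub_zero] at hab
        have hb : b = 0 := by
          by_contra hb
          refine hs ⟨-(b⁻¹ * a), ?_⟩
          have : ⁅y, Y j⁆ = b⁻¹ • (b • ⁅y, Y j⁆) := by rw [smul_smul, inv_mul_cancel₀ hb, one_smul]
          rw [this, eq_neg_of_add_eq_zero_right hab]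
          module
        subst hb
        rw [zero_smul, add_zero] at hab
        exact ⟨(smul_eq_zero.1 hab).resolve_right (Yne _ (by omega) (by omega)), rfl⟩
    · have h0 : ⁅y, Y j⁆ - (0 : ℂ) • Y (j + 1) = 0 := by
        rw [zero_smul, sub_zero]; exact top _ _ hjq hm
      exact ⟨0, by rw [h0, lie_zero], Or.inl h0⟩
  choose! C hCx hCi using hC
  let W : ℕ → L := fun r => if r = 1 then x else ⁅y, Y (r - 1)⁆ - C (r - 1) • Y r
  have W1 : W 1 = x := rfl
  have Wsucc : ∀ j, 1 ≤ j → W (j + 1) = ⁅y, Y j⁆ - C j • Y (j + 1) := by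
    intro j hj
    simp only [W]
    rw [if_neg (by omega), Nat.add_sub_cancel]
  have yY : ∀ j, 1 ≤ j → ⁅y, Y j⁆ = C j • Y (j + 1) + W (j + 1) := by
    intro j hj
    rw [Wsucc j hj]; module
  have xW : ∀ r, 1 ≤ r → ⁅x, W r⁆ = 0 := by
    intro r hr
    rcases Nat.lt_or_ge 1 r with h1 | h1
    · obtain ⟨j, rfl⟩ : ∃ j, r = j + 1 := ⟨r - 1, by omega⟩
      rw [Wsucc j (by omega), hCx j (by omega)]
    · rw [show r = 1 by omega, W1, lie_self]
  have Wmem : ∀ r, 1 ≤ r → p r (W r) = W r := by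
    intro r hr
    rcases Nat.lt_or_ge 1 r with h1 | h1
    · obtain ⟨j, rfl⟩ : ∃ j, r = j + 1 := ⟨r - 1, by omega⟩
      have hm : p (j + 1) ⁅y, Y j⁆ = ⁅y, Y j⁆ := by
        rw [add_comm]; exact hg.lie_mem h.y_mem (Ymem j (by omega))
      rw [Wsucc j (by omega), map_sub, map_smul, hm, Ymem _ (by omega)]
    · rw [show r = 1 by omega]; exact h.x_mem
  -- Thinness for x + y and x - y makes Y_{r+1} + [y, Y_r] and Y_{r+1} - [y, Y_r] multiples of [y,
  -- W_r] when the latter is nonzero; their sum 2 Y_{r+1} is then parallel to it.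
  have yW : ∀ r, 1 ≤ r → ∃ l : ℂ, ⁅y, W r⁆ = -(l • Y (r + 1)) := by
    intro r hr
    by_cases hv : ⁅y, W r⁆ = 0
    · exact ⟨0, by rw [hv]; simp⟩
    have hrq : r < q := by
      by_contra hrq
      exact hv (top (1 + r) _ (by omega) (hg.lie_mem h.y_mem (Wmem r hr)))
    have hp := h.thin (x + y) (W r) (Y r) r (by rw [map_add, h.x_mem, h.y_mem]) (Wmem r hr)
      (Ymem r hr)
    have hm := h.thin (x - y) (W r) (Y r) r (by rw [map_sub, h.x_mem, h.y_mem]) (Wmem r hr)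
      (Ymem r hr)
    rw [add_lie, add_lie, xW r hr, zero_add, Ysucc r hr] at hp
    rw [sub_lie, sub_lie, xW r hr, zero_sub, Ysucc r hr] at hm
    obtain ⟨a, ha⟩ := exists_eq_smul hp hv
    obtain ⟨b, hb⟩ := exists_eq_smul hm (neg_ne_zero.2 hv)
    have hsum : (2 : ℂ) • Y (r + 1) = (a - b) • ⁅y, W r⁆ := by
      have : (2 : ℂ) • Y (r + 1) = (Y (r + 1) + ⁅y, Y r⁆) + (Y (r + 1) - ⁅y, Y r⁆) := by module
      rw [this, ha, hb]; module
    have hab : a - b ≠ 0 := by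
      intro h0
      rw [h0, zero_smul] at hsum
      exact Yne (r + 1) (by omega) (by omega)
        ((smul_eq_zero.1 hsum).resolve_left (by norm_num))
    refine ⟨-((a - b)⁻¹ * 2), ?_⟩
    have : ⁅y, W r⁆ = (a - b)⁻¹ • ((a - b) • ⁅y, W r⁆) := by
      rw [smul_smul, inv_mul_cancel₀ hab, one_smul]
    rw [this, ← hsum]; module
  choose! l hl using yW
  -- Two generators suffice in degree one, and brackets of `x` and `y` with Y_r and W_r stay in the
  -- span of Y_{r+1} and W_{r+1}.
  have span : ∀ r, 1 ≤ r → ∀ v, ∃ a b : ℂ, p r v = a • Y r + b • W r := by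
    intro r hr
    induction r, hr using Nat.le_induction with
    | base =>
      intro v
      obtain ⟨a, b, hab⟩ := h.exists_eq_add hL hq (hg.idem 1 v)
      exact ⟨b, a, by rw [hab, W1, Y1]; module⟩
    | succ r hr ih =>
      intro v
      have hm := hg.gen r hr v
      generalize p (r + 1) v = u at hm
      induction hm using Submodule.span_induction with
      | mem z hz =>
        obtain ⟨a, b, ha, hb, rfl⟩ := hz
        obtain ⟨a₁, a₂, rfl⟩ := h.exists_eq_add hL hq ha
        obtain ⟨b₁, b₂, hb'⟩ := ih b
        rw [hb] at hb'
        subst hb'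
        refine ⟨a₁ * b₁ + a₂ * b₁ * C r - a₂ * b₂ * l r, a₂ * b₁, ?_⟩
        simp only [add_lie, lie_add, smul_lie, lie_smul, Ysucc r hr, yY r hr, xW r hr, hl r hr]
        module
      | zero => exact ⟨0, 0, by simp⟩
      | add a b _ _ ha hb =>
        obtain ⟨a₁, a₂, rfl⟩ := ha
        obtain ⟨b₁, b₂, rfl⟩ := hb
        exact ⟨a₁ + b₁, a₂ + b₂, by module⟩
      | smul t a _ ha =>
        obtain ⟨a₁, a₂, rfl⟩ := ha
        exact ⟨t * a₁, t * a₂, by module⟩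
  let S : Finset ℕ := (Finset.Icc 1 q).filter fun r => W r ≠ 0
  have hS : ∀ r, r ∈ S ↔ (1 ≤ r ∧ r ≤ q) ∧ W r ≠ 0 := fun r => by simp [S]
  have hx0 : x ≠ 0 := by
    intro h0
    exact h.lie_ne (by rw [h0, zero_lie])
  have hWtop : ∀ r, q < r → W r = 0 := fun r hr => top r _ hr (Wmem r (by omega))
  have hW0 : ∀ r, 1 ≤ r → r ∉ S → W r = 0 := by
    intro r hr hrS
    by_contra hW
    exact hrS ((hS r).2 ⟨⟨hr, by_contra fun h' => hW (hWtop r (by omega))⟩, hW⟩)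
  have pair : ∀ r ∈ S, ∀ a b : ℂ, a • Y r + b • W r = 0 → a = 0 ∧ b = 0 := by
    intro r hr a b hab
    obtain ⟨⟨h1, h2⟩, h3⟩ := (hS r).1 hr
    rcases Nat.lt_or_ge 1 r with hr1 | hr1
    · obtain ⟨j, rfl⟩ : ∃ j, r = j + 1 := ⟨r - 1, by omega⟩
      have := hCi j (by omega)
      rw [← Wsucc j (by omega)] at this
      exact this.resolve_left h3 a b hab
    · obtain rfl : r = 1 := by omega
      rw [W1, Y1] at hab
      have h4 := congrArg (fun v => ⁅x, v⁆) hab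
      simp only [lie_add, lie_smul, lie_self, smul_zero, add_zero, lie_zero] at h4
      have ha := (smul_eq_zero.1 h4).resolve_right h.lie_ne
      subst ha
      rw [zero_smul, zero_add] at hab
      exact ⟨rfl, (smul_eq_zero.1 hab).resolve_right hx0⟩
  have hli : LinearIndependent ℂ (IsFrame.vec q S Y W) := by
    rw [Fintype.linearIndependent_iff]
    intro g hsum
    rw [Fintype.sum_sum_type] at hsum
    simp only [IsFrame.vec, Sum.elim_inl, Sum.elim_inr] at hsum
    -- Projecting a relation to degree `r` leaves at most the two vectors Y_r and W_r.
    have comp : ∀ r (hr : r ∈ Finset.Icc 1 q), g (Sum.inl ⟨r, hr⟩) • Y r +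
        (if hrS : r ∈ S then g (Sum.inr ⟨r, hrS⟩) else 0) • W r = 0 := by
      intro r hr
      have h1 := congrArg (p r) hsum
      rw [map_add, map_sum, map_sum, map_zero] at h1
      rw [Finset.sum_eq_single ⟨r, hr⟩] at h1
      · rw [map_smul, Ymem r (Finset.mem_Icc.1 hr).1] at h1
        by_cases hrS : r ∈ S
        · rw [Finset.sum_eq_single ⟨r, hrS⟩] at h1
          · rw [map_smul, Wmem r (Finset.mem_Icc.1 hr).1] at h1
            rw [dif_pos hrS]
            exact h1
          · intro s _ hs
            rw [map_smul, hg.apply_of_ne (fun h' => hs (Subtype.ext h'.symm))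
              (Wmem s ((hS s).1 s.2).1.1), smul_zero]
          · simp
        · rw [dif_neg hrS, zero_smul]
          rw [Finset.sum_eq_zero] at h1
          · exact h1
          · intro s _
            rw [map_smul, hg.apply_of_ne (fun h' : r = (s : ℕ) => hrS (by rw [h']; exact s.2))
              (Wmem s ((hS s).1 s.2).1.1), smul_zero]
      · intro s _ hs
        rw [map_smul, hg.apply_of_ne (fun h' => hs (Subtype.ext h'.symm))
          (Ymem s (Finset.mem_Icc.1 s.2).1), smul_zero]
      · simp
    rintro (⟨r, hr⟩ | ⟨r, hr⟩)
    · have h1 := comp r hr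
      by_cases hrS : r ∈ S
      · exact (pair r hrS _ _ h1).1
      · rw [dif_neg hrS, zero_smul, add_zero] at h1
        exact (smul_eq_zero.1 h1).resolve_right
          (Yne r (Finset.mem_Icc.1 hr).1 (Finset.mem_Icc.1 hr).2)
    · have h1 := comp r (Finset.mem_Icc.2 ((hS r).1 hr).1)
      rw [dif_pos hr] at h1
      exact (pair r hr _ _ h1).2
  have hspan : ⊤ ≤ Submodule.span ℂ (Set.range (IsFrame.vec q S Y W)) := by
    intro v _
    rw [← hg.sum v]
    refine Submodule.sum_mem _ fun i hi => ?_
    rcases Nat.eq_zero_or_pos i with rfl | hi1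
    · rw [hg.zero]; exact zero_mem _
    · obtain ⟨a, b, hab⟩ := span i hi1 v
      rw [hab]
      refine add_mem (Submodule.smul_mem _ _ (Submodule.subset_span
        ⟨Sum.inl ⟨i, Finset.mem_Icc.2 ⟨hi1, by have := Finset.mem_range.1 hi; omega⟩⟩, rfl⟩))
        (Submodule.smul_mem _ _ ?_)
      by_cases hiS : i ∈ S
      · exact Submodule.subset_span ⟨Sum.inr ⟨i, hiS⟩, rfl⟩
      · rw [hW0 i hi1 hiS]; exact zero_mem _
  refine ⟨S, C, l, Y, W, ?_, ?_, ?_, fun r hr => ((hS r).1 hr).1, Yzero, hW0, Ysucc, xW, yY, hl⟩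
  · rw [eq_top_iff, ← hg.lieSpan_eq_top, LieSubalgebra.lieSpan_le]
    intro v hv
    obtain ⟨a, b, rfl⟩ := h.exists_eq_add hL hq hv
    exact add_mem (LieSubalgebra.smul_mem _ _ (LieSubalgebra.subset_lieSpan (by simp [W1])))
      (LieSubalgebra.smul_mem _ _ (LieSubalgebra.subset_lieSpan (by simp [Y1])))
  · rw [Module.finrank_eq_card_basis (Module.Basis.mk hli hspan)]
    simp
  · exact (hS 1).2 ⟨⟨le_rfl, by omega⟩, hx0⟩

end IsGrading.IsThin

end NatGraded

end

/-! ### The first deviation of the coefficients and its consequences -/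

noncomputable section

namespace NatGraded

/-- If `c` agrees with a reference solution `g` of the recursion in degrees less than `D`, then the
coefficients in the next four degrees differ from `g` by explicit polynomials. -/
theorem coef_expand {c : ℕ → ℂ} {g : ℕ → ℕ → ℂ} {D : ℕ} {a₀ a₁ a₂ a₃ : ℂ}
    (hg : ∀ i j, 1 ≤ i → 1 ≤ j → g (i + 1) j = g i j - g i (j + 1))
    (hc : ∀ j, 1 ≤ j → j + 1 < D → c j = g 1 j)
    (h₀ : ∀ j, j + 1 = D → c j = g 1 j + a₀) (h₁ : ∀ j, j = D → c j = g 1 j + a₁)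
    (h₂ : ∀ j, j = D + 1 → c j = g 1 j + a₂) (h₃ : ∀ j, j = D + 2 → c j = g 1 j + a₃)
    {i : ℕ} (hi : 1 ≤ i) : ∀ j, 1 ≤ j →
      (i + j < D → coef c i j = g i j) ∧
      (i + j = D → coef c i j = g i j + (-1) ^ (i + 1) * a₀) ∧
      (i + j = D + 1 → coef c i j = g i j + (-1) ^ (i + 1) * (a₁ - (i - 1) * a₀)) ∧
      (i + j = D + 2 → coef c i j = g i j +
        (-1) ^ (i + 1) * (a₂ - (i - 1) * a₁ + (i - 1) * (i - 2) / 2 * a₀)) ∧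
      (i + j = D + 3 → coef c i j = g i j +
        (-1) ^ (i + 1) * (a₃ - (i - 1) * a₂ + (i - 1) * (i - 2) / 2 * a₁ -
          (i - 1) * (i - 2) * (i - 3) / 6 * a₀)) := by
  -- The deviation from `g` obeys the same recursion, a repeated difference in `j`; this produces
  -- alternating sums with binomial coefficients of i - 1.
  induction i, hi using Nat.le_induction with
  | base =>
    intro j hj
    simp only [coef_one]
    refine ⟨fun h => hc j hj (by omega), fun h => ?_, fun h => ?_, fun h => ?_, fun h => ?_⟩
    · rw [h₀ j (by omega)]; norm_num
    · rw [h₁ j (by omega)]; norm_num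
    · rw [h₂ j (by omega)]; norm_num
    · rw [h₃ j (by omega)]; norm_num
  | succ i hi ih =>
    intro j hj
    obtain ⟨p1, p2, p3, p4, p5⟩ := ih j hj
    obtain ⟨n1, n2, n3, n4, n5⟩ := ih (j + 1) (by omega)
    rw [coef_succ c hi, hg i j hi hj]
    refine ⟨fun h => ?_, fun h => ?_, fun h => ?_, fun h => ?_, fun h => ?_⟩
    · rw [p1 (by omega), n1 (by omega)]
    · rw [p1 (by omega), n2 (by omega), pow_succ]; ring
    · rw [p2 (by omega), n3 (by omega), pow_succ]; push_cast; ring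
    · rw [p3 (by omega), n4 (by omega), pow_succ]; push_cast; ring
    · rw [p4 (by omega), n5 (by omega), pow_succ]; push_cast; ring

theorem coef_eq_of_le {c : ℕ → ℂ} {g : ℕ → ℕ → ℂ} {D : ℕ}
    (hg : ∀ i j, 1 ≤ i → 1 ≤ j → g (i + 1) j = g i j - g i (j + 1))
    (hc : ∀ j, 1 ≤ j → j + 1 ≤ D → c j = g 1 j) {i j : ℕ} (hi : 1 ≤ i) (hj : 1 ≤ j)
    (h : i + j ≤ D) : coef c i j = g i j :=
  (coef_expand (D := D + 1) (a₀ := c D - g 1 D) (a₁ := c (D + 1) - g 1 (D + 1))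
    (a₂ := c (D + 2) - g 1 (D + 2)) (a₃ := c (D + 3) - g 1 (D + 3)) hg
    (fun j hj h => hc j hj (by omega)) (fun j h => by rw [show j = D by omega]; ring)
    (fun j h => by rw [h]; ring) (fun j h => by rw [h]; ring) (fun j h => by rw [h]; ring)
    hi j hj).1 (by omega)

namespace IsFrame

variable {L : Type u} [LieRing L] [LieAlgebra ℂ L] {q : ℕ} {S : Finset ℕ} {c l : ℕ → ℂ}
  {y w : ℕ → L}

theorem l_one (h : IsFrame q S c l y w) (hq : 2 ≤ q) : l 1 = 1 := by
  have h1 := h.yw 1 le_rfl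
  rw [← lie_skew, h.xy 1 le_rfl, neg_inj] at h1
  have h2 : (l 1 - 1) • y 2 = 0 := by rw [sub_smul, ← h1, one_smul, sub_self]
  exact sub_eq_zero.1 (h.smul_y (by omega) hq h2)

theorem c_one (h : IsFrame q S c l y w) (hq : 2 ≤ q) : c 1 = 0 := by
  have := h.coef_antisymm (i := 1) (j := 1) le_rfl le_rfl hq
  rw [coef_one] at this
  linear_combination (1 / 2 : ℂ) * this

theorem coef_self (h : IsFrame q S c l y w) {i : ℕ} (hi : 1 ≤ i) (hq : i + i ≤ q) :
    coef c i i = 0 := by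
  have := h.coef_antisymm hi hi hq
  linear_combination (1 / 2 : ℂ) * this

/-- The first coefficient is determined in even degrees. -/
theorem c_even (h : IsFrame q S c l y w) {g : ℕ → ℕ → ℂ} {i : ℕ} (hi : 1 ≤ i) (hq : i + i ≤ q)
    (hg : ∀ i j, 1 ≤ i → 1 ≤ j → g (i + 1) j = g i j - g i (j + 1)) (hgi : g i i = 0)
    (hc : ∀ j, 1 ≤ j → j + 1 < i + i → c j = g 1 j) :
    c (i + i - 1) = g 1 (i + i - 1) := by
  have h1 := (coef_expand (D := i + i) (a₀ := c (i + i - 1) - g 1 (i + i - 1))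
    (a₁ := c (i + i) - g 1 (i + i))
    (a₂ := c (i + i + 1) - g 1 (i + i + 1)) (a₃ := c (i + i + 2) - g 1 (i + i + 2)) hg
    hc (fun j h => by rw [show j = i + i - 1 by omega]; ring)
    (fun j h => by rw [h]; ring) (fun j h => by rw [h]; ring) (fun j h => by rw [h]; ring)
    hi i hi).2.1 rfl
  -- On the diagonal both solutions vanish, so the deviation does.
  rw [h.coef_self hi hq, hgi, zero_add] at h1
  have := (mul_eq_zero.1 h1.symm).resolve_left (pow_ne_zero _ (by norm_num))
  exact sub_eq_zero.1 this

/-- The deviation from a reference solution in an odd degree determines the deviation in the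
next degree. -/
theorem c_odd_succ (h : IsFrame q S c l y w) {g : ℕ → ℕ → ℂ} {m : ℕ} (hm : 1 ≤ m)
    (hq : 2 * m + 2 ≤ q)
    (hg : ∀ i j, 1 ≤ i → 1 ≤ j → g (i + 1) j = g i j - g i (j + 1)) (hgi : g (m + 1) (m + 1) = 0)
    (hc : ∀ j, 1 ≤ j → j < 2 * m → c j = g 1 j) :
    c (2 * m + 1) = g 1 (2 * m + 1) + m * (c (2 * m) - g 1 (2 * m)) := by
  have h1 := (coef_expand (D := 2 * m + 1) (a₀ := c (2 * m) - g 1 (2 * m))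
    (a₁ := c (2 * m + 1) - g 1 (2 * m + 1))
    (a₂ := c (2 * m + 1 + 1) - g 1 (2 * m + 1 + 1)) (a₃ := c (2 * m + 1 + 2) - g 1 (2 * m + 1 + 2)) hg
    (fun j hj h => hc j hj (by omega)) (fun j h => by rw [show j = 2 * m by omega]; ring)
    (fun j h => by rw [h]; ring) (fun j h => by rw [h]; ring) (fun j h => by rw [h]; ring)
    (i := m + 1) (by omega) (m + 1) (by omega)).2.2.1 (by omega)
  -- The diagonal coefficient of degree 2m + 2 has deviation ±(a₁ - m a₀), where a₀, a₁ are the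
  -- deviations of c_{2m}, c_{2m+1}.
  rw [h.coef_self (by omega) (by omega), hgi, zero_add] at h1
  have := (mul_eq_zero.1 h1.symm).resolve_left (pow_ne_zero _ (by norm_num))
  push_cast at this
  linear_combination this

/-- The zero solution of the recursion. -/
theorem coef_expand_zero {c : ℕ → ℂ} {m : ℕ} (hc : ∀ j, 1 ≤ j → j < 2 * m → c j = 0)
    {i j : ℕ} (hi : 1 ≤ i) (hj : 1 ≤ j) :
      (i + j < 2 * m + 1 → coef c i j = 0) ∧
      (i + j = 2 * m + 1 → coef c i j = (-1) ^ (i + 1) * c (2 * m)) ∧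
      (i + j = 2 * m + 2 → coef c i j = (-1) ^ (i + 1) * (c (2 * m + 1) - (i - 1) * c (2 * m))) ∧
      (i + j = 2 * m + 3 → coef c i j =
        (-1) ^ (i + 1) * (c (2 * m + 2) - (i - 1) * c (2 * m + 1) + (i - 1) * (i - 2) / 2 * c (2 * m))) ∧
      (i + j = 2 * m + 4 → coef c i j =
        (-1) ^ (i + 1) * (c (2 * m + 3) - (i - 1) * c (2 * m + 2) + (i - 1) * (i - 2) / 2 * c (2 * m + 1) -
          (i - 1) * (i - 2) * (i - 3) / 6 * c (2 * m))) := by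
  have := coef_expand (g := fun _ _ => 0) (D := 2 * m + 1) (a₀ := c (2 * m))
    (a₁ := c (2 * m + 1)) (a₂ := c (2 * m + 2)) (a₃ := c (2 * m + 3)) (fun _ _ _ _ => by ring)
    (fun j hj h => hc j hj (by omega)) (fun j h => by rw [show j = 2 * m by omega]; ring)
    (fun j h => by rw [h]; ring) (fun j h => by rw [h]; ring) (fun j h => by rw [h]; ring)
    hi j hj
  simpa only [zero_add, add_assoc, Nat.reduceAdd] using this

/-- The first nonzero coefficient determines the action of the corresponding `w r`. -/
theorem l_eq_of_first (h : IsFrame q S c l y w) {m : ℕ} (hm : 2 ≤ m) (hq : 2 * m + 2 ≤ q)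
    (h3 : l 3 = 0) (hc : ∀ j, 1 ≤ j → j < 2 * m → c j = 0) :
    c (2 * m + 1) = m * c (2 * m) ∧ l (2 * m + 1) = m * c (2 * m) ^ 2 := by
  have hd : c (2 * m + 1) = m * c (2 * m) := by
    have := h.c_odd_succ (g := fun _ _ => 0) (by omega) hq (fun _ _ _ _ => by ring) rfl hc
    simpa using this
  refine ⟨hd, ?_⟩
  obtain ⟨k, rfl⟩ : ∃ k, m = k + 2 := ⟨m - 2, by omega⟩
  -- In the Jacobi identity for y_1, y_2, y_{2m-1} only c_{2m} c_{2m+1} and l_{2m+1} survive.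
  have hJ := h.jacobi_y (i := 1) (j := 2) (k := 2 * k + 3) le_rfl (by omega) (by omega) (by omega)
  have e1 : coef c 1 2 = 0 := hc 2 (by omega) (by omega)
  have e2 := (coef_expand_zero hc (i := 2) (j := 2 * k + 3) (by omega) (by omega)).2.1 (by omega)
  have e3 : coef c (2 + (2 * k + 3)) 1 = -c (2 * (k + 2) + 1) := by
    rw [h.coef_antisymm (by omega) le_rfl (by omega), coef_one]
    congr 2; omega
  have e4 := (coef_expand_zero hc (i := 2 * k + 3) (j := 1) (by omega) (by omega)).1 (by omega)
  have e5 : l (2 * k + 3 + 1) = 0 := h.l_even (by omega) (by omega) ⟨k + 2, by ring⟩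
  rw [show 1 + 2 = 3 from rfl, e1, e2, e3, e4, e5, h3, hd, show 2 + (2 * k + 3) = 2 * (k + 2) + 1 by ring] at hJ
  push_cast at hJ ⊢
  linear_combination -hJ

/-- If the `w s` with `3 ≤ s < R` are central, then the coefficients vanish in degrees less
than `R`. -/
theorem c_eq_zero (h : IsFrame q S c l y w) (h2 : c 2 = 0) {R : ℕ} (hR : R ≤ q)
    (hl : ∀ s, 3 ≤ s → s < R → l s = 0) : ∀ j, 1 ≤ j → j + 1 < R → c j = 0 := by
  intro j
  induction j using Nat.strong_induction_on with
  | _ j ih =>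
    intro hj hjR
    rcases Nat.even_or_odd j with ⟨m, hm⟩ | ⟨m, hm⟩
    · rcases Nat.lt_or_ge m 2 with hm2 | hm2
      · rwa [show j = 2 by omega]
      · have := (h.l_eq_of_first hm2 (by omega) (hl 3 le_rfl (by omega))
          (fun j' hj' h' => ih j' (by omega) hj' (by omega))).2
        have e : 2 * m = j := by omega
        rw [hl (2 * m + 1) (by omega) (by omega), e] at this
        have hm0 : (m : ℂ) ≠ 0 := by
          have : m ≠ 0 := by omega
          exact_mod_cast this
        simpa [hm0] using this.symm
    · have := h.c_even (g := fun _ _ => 0) (i := m + 1) (by omega) (by omega)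
        (fun _ _ _ _ => by ring) rfl (fun j' hj' h' => ih j' (by omega) hj' (by omega))
      rwa [show m + 1 + (m + 1) - 1 = j by omega] at this

/-- The coefficient following the first nonzero ones. -/
theorem c_eq_zero_after (h : IsFrame q S c l y w) {m : ℕ} (hm : 3 ≤ m) (hq : 2 * m + 3 ≤ q)
    (h3 : l 3 = 0) (hc : ∀ j, 1 ≤ j → j < 2 * m → c j = 0) (h1 : c (2 * m) = 1) :
    c (2 * m + 2) = 0 := by
  obtain ⟨hd, hl⟩ := h.l_eq_of_first (by omega) (by omega) h3 hc
  -- This identity in degree 2m + 3 reduces to (m - 2) c_{2m+2} = 0. The factor explains why m = 2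
  -- is a separate, periodic case.
  have hJ := h.jacobi_y (i := 1) (j := 2) (k := 2 * m) le_rfl (by omega) (by omega) (by omega)
  have e1 : coef c 1 2 = 0 := hc 2 (by omega) (by omega)
  have e2 := (coef_expand_zero hc (i := 2) (j := 2 * m) (by omega) (by omega)).2.2.1 (by omega)
  have e3 : coef c (2 + 2 * m) 1 = -c (2 * m + 2) := by
    rw [h.coef_antisymm (by omega) le_rfl (by omega), coef_one, add_comm]
  have e4 : coef c (2 * m) 1 = -c (2 * m) := by
    rw [h.coef_antisymm (by omega) le_rfl (by omega), coef_one]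
  have e5 : l (2 + 2 * m) = 0 := h.l_even (by omega) (by omega) ⟨m + 1, by ring⟩
  have e6 : coef c (2 * m + 1) 2 = -(c (2 * m + 1) - c (2 * m + 2)) := by
    rw [h.coef_antisymm (by omega) (by omega) (by omega), coef_succ c le_rfl, coef_one, coef_one]
  have e7 : (-1 : ℂ) ^ (2 * m + 1) = -1 := by rw [pow_succ, pow_mul]; norm_num
  rw [show 1 + 2 = 3 from rfl, e1, e2, e3, e4, e5, e6, e7, h3, hl, hd, h1] at hJ
  have hm2 : ((m : ℂ) - 2) ≠ 0 := by
    rw [sub_ne_zero]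
    have : m ≠ 2 := by omega
    exact_mod_cast this
  have : ((m : ℂ) - 2) * c (2 * m + 2) = 0 := by
    push_cast at hJ
    linear_combination hJ
  exact (mul_eq_zero.1 this).resolve_left hm2

/-- A noncentral `w r` with `r ≥ 7` and central `w s` for `3 ≤ s < r` bounds the class. -/
theorem class_le (h : IsFrame q S c l y w) {m : ℕ} (hm : 3 ≤ m) (h3 : l 3 = 0)
    (hc : ∀ j, 1 ≤ j → j < 2 * m → c j = 0) (h1 : c (2 * m) = 1) : q ≤ 2 * m + 3 := by
  by_contra hq
  push Not at hq
  obtain ⟨hd, hl⟩ := h.l_eq_of_first (by omega) (by omega) h3 hc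
  have hc2 := h.c_eq_zero_after hm (by omega) h3 hc h1
  -- As l_3 = 0, comparing the two orders of w_3 and w_{2m+1} gives c_{2m+3} = 0.
  have hK := h.lie_w_w_antisymm (i := 2) (j := 2 * m) (by simp) (by simp) (by omega) (by omega)
    (by omega)
  have e1 : coef c (2 * m + 1 + 1) 2 = c (2 * m + 3) := by
    rw [h.coef_antisymm (by omega) (by omega) (by omega), coef_succ c le_rfl, coef_one, coef_one,
      hc2]
    ring
  have hm0 : (m : ℂ) ≠ 0 := by
    have : m ≠ 0 := by omega
    exact_mod_cast this
  rw [show 2 + 1 = 3 from rfl, h3, zero_mul, e1, hl, hc 2 (by omega) (by omega), h1] at hK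
  have e2 : c (2 * m + 3) = 0 := by
    have : (m : ℂ) * c (2 * m + 3) = 0 := by
      rw [show 2 * m + 1 + 2 = 2 * m + 3 from rfl] at hK
      linear_combination (1 / 2 : ℂ) * hK
    exact (mul_eq_zero.1 this).resolve_left hm0
  -- The diagonal coefficient of degree 2m + 4 now equals ±m(m + 1)(2m + 1)/6, which cannot vanish.
  have e3 := (coef_expand_zero hc (i := m + 2) (j := m + 2) (by omega) (by omega)).2.2.2.2 (by omega)
  rw [h.coef_self (by omega) (by omega), e2, hc2, hd, h1] at e3
  have e4 := (mul_eq_zero.1 e3.symm).resolve_left (pow_ne_zero _ (by norm_num))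
  have e5 : (m : ℂ) * (m + 1) * (2 * m + 1) = 0 := by
    push_cast at e4
    linear_combination 6 * e4
  have : m * (m + 1) * (2 * m + 1) = 0 := by exact_mod_cast e5
  have : m = 0 := by
    rcases Nat.mul_eq_zero.1 this with h' | h'
    · rcases Nat.mul_eq_zero.1 h' with h'' | h''
      · exact h''
      · omega
    · omega
  omega

end IsFrame

end NatGraded

end

/-! ### The constant and the periodic solutions -/

noncomputable section

namespace NatGraded

/-- The sequence of period six `0, 1, 1, 0, -1, -1`. -/
def hex : ℕ → ℂ
  | 0 => 0
  | 1 => 1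
  | k + 2 => hex (k + 1) - hex k

theorem hex_add_two (k : ℕ) : hex (k + 2) = hex (k + 1) - hex k := rfl

theorem hex_add_three (k : ℕ) : hex (k + 3) = -hex k := by
  rw [show k + 3 = k + 1 + 2 from rfl, hex_add_two, show k + 1 + 1 = k + 2 from rfl, hex_add_two]
  ring

theorem hex_add_six (k : ℕ) : hex (k + 6) = hex k := by
  rw [show k + 6 = k + 3 + 3 from rfl, hex_add_three, hex_add_three, neg_neg]

theorem hex_mod (k : ℕ) : hex k = hex (k % 6) := by
  induction k using Nat.strong_induction_on with
  | _ k ih =>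
    rcases Nat.lt_or_ge k 6 with h | h
    · rw [Nat.mod_eq_of_lt h]
    · obtain ⟨j, rfl⟩ := Nat.exists_eq_add_of_le' h
      rw [hex_add_six, ih j (by omega), Nat.add_mod_right]

theorem hex_eq {k r : ℕ} (h : k % 6 = r % 6) : hex k = hex r := by
  rw [hex_mod k, h, ← hex_mod]

theorem hex_zero : hex 0 = 0 := rfl
theorem hex_one : hex 1 = 1 := rfl
theorem hex_two : hex 2 = 1 := by norm_num [hex]
theorem hex_three : hex 3 = 0 := by norm_num [hex]
theorem hex_four : hex 4 = -1 := by norm_num [hex]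
theorem hex_five : hex 5 = -1 := by norm_num [hex]

/-- The coefficients `c i j`, depending on `i - j` modulo six. -/
def hexCoef (i j : ℕ) : ℂ := hex (i + 5 * j)

/-- With k = i - j modulo six this is hex(k+1) = hex(k) - hex(k-1); so `hexCoef` is a reference
solution of the recursion of `coef`. The factor 5 replaces -1 to stay in ℕ. -/
theorem hexCoef_succ (i j : ℕ) : hexCoef (i + 1) j = hexCoef i j - hexCoef i (j + 1) := by
  unfold hexCoef
  have h := hex_add_two (i + 5 * j + 5)
  rw [hex_eq (k := i + 5 * j + 5 + 2) (r := i + 1 + 5 * j) (by omega),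
    hex_eq (k := i + 5 * j + 5 + 1) (r := i + 5 * j) (by omega)] at h
  rw [h, show i + 5 * (j + 1) = i + 5 * j + 5 by ring]

theorem hexCoef_self (i : ℕ) : hexCoef i i = 0 := by
  rw [hexCoef, hex_eq (r := 0) (by omega), hex_zero]

theorem hexCoef_eq {i j r : ℕ} (h : (i + 5 * j) % 6 = r % 6) : hexCoef i j = hex r := hex_eq h

namespace IsFrame

variable {L : Type u} [LieRing L] [LieAlgebra ℂ L] {q : ℕ} {S : Finset ℕ} {c l : ℕ → ℂ}
  {y w : ℕ → L}

/-- With all relevant coefficients zero, the Jacobi identity for y_1, y_2, y_{s-2} reduces to l_3 =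
l_s. -/
theorem l_eq_l_three (h : IsFrame q S c l y w) {s : ℕ} (hs : Odd s) (h3 : 3 ≤ s) (hq : s < q)
    (hc : ∀ j, 1 ≤ j → j < s → c j = 0) : l s = l 3 := by
  rcases h3.eq_or_lt with rfl | h3
  · rfl
  obtain ⟨t, rfl⟩ := hs
  obtain ⟨m, rfl⟩ : ∃ m, t = m + 2 := ⟨t - 2, by omega⟩
  have hJ := h.jacobi_y (i := 1) (j := 2) (k := 2 * m + 3) le_rfl (by omega) (by omega) (by omega)
  have e1 : coef c 1 2 = 0 := hc 2 (by omega) (by omega)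
  have e2 : coef c 2 (2 * m + 3) = 0 := by
    rw [coef_succ c le_rfl, coef_one, coef_one, hc _ (by omega) (by omega),
      hc _ (by omega) (by omega), sub_zero]
  have e3 : coef c (2 * m + 3) 1 = 0 := by
    rw [h.coef_antisymm (by omega) le_rfl (by omega), coef_one, hc _ (by omega) (by omega), neg_zero]
  have e5 : l (2 * m + 3 + 1) = 0 := h.l_even (by omega) (by omega) ⟨m + 2, by ring⟩
  rw [show 1 + 2 = 3 from rfl, e1, e2, e3, e5, show 2 + (2 * m + 3) = 2 * (m + 2) + 1 by ring] at hJ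
  linear_combination -hJ

/-- If `w 3` is not central then the coefficients vanish below the top degree. -/
theorem c_eq_zero_of_l_three (h : IsFrame q S c l y w) (h3 : l 3 ≠ 0) (h2 : c 2 = 0) :
    ∀ j, 1 ≤ j → j + 1 < q → c j = 0 := by
  intro j
  induction j using Nat.strong_induction_on with
  | _ j ih =>
    intro hj hjq
    rcases Nat.even_or_odd j with ⟨m, hm⟩ | ⟨m, hm⟩
    · obtain rfl : j = 2 * m := by omega
      rcases Nat.lt_or_ge m 2 with hm2 | hm2
      · rwa [show 2 * m = 2 by omega]
      have hc : ∀ j, 1 ≤ j → j < 2 * m → c j = 0 := fun j' hj' h' => ih j' h' hj' (by omega)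
      have hd : c (2 * m + 1) = m * c (2 * m) := by
        have := h.c_odd_succ (g := fun _ _ => 0) (by omega) (by omega)
          (fun _ _ _ _ => by ring) rfl hc
        simpa using this
      obtain ⟨k, rfl⟩ : ∃ k, m = k + 2 := ⟨m - 2, by omega⟩
      have hl := h.l_eq_l_three (s := 2 * k + 3) ⟨k + 1, by ring⟩ (by omega) (by omega)
        (fun j hj h' => hc j hj (by omega))
      -- The two orders of w_3 and w_{2m-1}, where m = k + 2, give (2m + 2) l_3 c_{2m} = 0. This
      -- needs degree 2m + 2 ≤ q, hence the exclusion of the top coefficient.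
      have hK := h.lie_w_w_antisymm (i := 2) (j := 2 * k + 2) (by simp) ⟨k + 1, by ring⟩
        (by omega) (by omega) (by omega)
      have e1 := (coef_expand_zero hc (i := 4) (j := 2 * k + 2) (by omega) (by omega)).2.2.1
        (by omega)
      have e2 := (coef_expand_zero hc (i := 2 * k + 4) (j := 2) (by omega) (by omega)).2.2.1
        (by omega)
      have e7 : (-1 : ℂ) ^ (2 * k + 4 + 1) = -1 :=
        Odd.neg_one_pow ⟨k + 2, by ring⟩
      rw [show 2 + 1 + 1 = 4 from rfl, show 2 + 1 = 3 from rfl,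
        show 2 * k + 2 + 1 + 1 = 2 * k + 4 by ring, show 2 * k + 2 + 1 = 2 * k + 3 by ring,
        e1, e2, hl, e7, show 3 + (2 * k + 2) = 2 * (k + 2) + 1 by ring,
        show 2 * k + 3 + 2 = 2 * (k + 2) + 1 by ring, hd, hc 2 (by omega) (by omega),
        hc (2 * k + 2) (by omega) (by omega)] at hK
      have hz : (l 3 * (2 * k + 6)) * c (2 * (k + 2)) = 0 := by
        push_cast at hK
        linear_combination hK
      refine (mul_eq_zero.1 hz).resolve_left (mul_ne_zero h3 ?_)
      have : 2 * k + 6 ≠ 0 := by omega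
      exact_mod_cast this
    · have := h.c_even (g := fun _ _ => 0) (i := m + 1) (by omega) (by omega)
        (fun _ _ _ _ => by ring) rfl (fun j' hj' h' => ih j' (by omega) hj' (by omega))
      rwa [show m + 1 + (m + 1) - 1 = j by omega] at this

/-- The Jacobi identity for y_1, y_2, y_{s-2} expresses l_s through l_3 = 0 and the periodic
coefficients; the three odd residues of `s` modulo six are evaluated separately. -/
theorem l_eq_hex (h : IsFrame q S c l y w) {s : ℕ} (hs : Odd s) (h3 : 3 ≤ s) (hq : s < q)
    (hl3 : l 3 = 0) (hc : ∀ j, 1 ≤ j → j ≤ s → c j = hexCoef 1 j) :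
    l s = if s % 6 = 3 then 0 else 2 := by
  obtain ⟨t, rfl⟩ := hs
  obtain ⟨m, rfl⟩ : ∃ m, t = m + 1 := ⟨t - 1, by omega⟩
  have hJ := h.jacobi_y (i := 1) (j := 2) (k := 2 * m + 1) le_rfl (by omega) (by omega) (by omega)
  have hg : ∀ {i j}, 1 ≤ i → 1 ≤ j → i + j ≤ 2 * (m + 1) + 2 → coef c i j = hexCoef i j :=
    fun hi hj hij => coef_eq_of_le (fun i j _ _ => hexCoef_succ i j)
      (fun j hj h' => hc j hj (by omega)) hi hj hij
  have e5 : l (2 * m + 1 + 1) = 0 := h.l_even (by omega) (by omega) ⟨m + 1, by ring⟩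
  rw [show 1 + 2 = 3 from rfl, e5, hl3, hg (by omega) (by omega) (by omega),
    hg (by omega) (by omega) (by omega), hg (by omega) (by omega) (by omega),
    hg (by omega) (by omega) (by omega), hg (by omega) (by omega) (by omega),
    hg (by omega) (by omega) (by omega), show 2 + (2 * m + 1) = 2 * (m + 1) + 1 by ring] at hJ
  have hm : m % 3 = 0 ∨ m % 3 = 1 ∨ m % 3 = 2 := by omega
  rw [hexCoef_eq (r := 5) (by omega)] at hJ
  rcases hm with hm | hm | hm
  · rw [if_pos (by omega)]
    rw [hexCoef_eq (i := 3) (r := 2) (by omega), hexCoef_eq (i := 2) (r := 1) (by omega),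
      hexCoef_eq (i := 2 * (m + 1) + 1) (r := 2) (by omega),
      hexCoef_eq (i := 2 * m + 1) (r := 0) (by omega), hex_zero, hex_one, hex_two, hex_five] at hJ
    linear_combination -hJ
  · rw [if_neg (by omega)]
    rw [hexCoef_eq (i := 3) (r := 0) (by omega), hexCoef_eq (i := 2) (r := 5) (by omega),
      hexCoef_eq (i := 2 * (m + 1) + 1) (r := 4) (by omega),
      hexCoef_eq (i := 2 * m + 1) (r := 2) (by omega),
      hexCoef_eq (i := 2 * m + 1 + 1) (r := 2) (by omega), hex_zero, hex_two, hex_four,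
      hex_five] at hJ
    linear_combination -hJ
  · rw [if_neg (by omega)]
    rw [hexCoef_eq (i := 3) (r := 4) (by omega), hexCoef_eq (i := 2) (r := 3) (by omega),
      hexCoef_eq (i := 2 * (m + 1) + 1) (r := 0) (by omega),
      hexCoef_eq (i := 2 * m + 1) (r := 4) (by omega),
      hexCoef_eq (i := 2 * m + 1 + 1) (r := 4) (by omega), hex_zero, hex_three, hex_four,
      hex_five] at hJ
    linear_combination -hJ

/-- If `w 3` is central and `w 5` is not then the coefficients are periodic below the top
degree. -/
theorem c_eq_hex (h : IsFrame q S c l y w) (hl3 : l 3 = 0)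
    (hc5 : ∀ j, 1 ≤ j → j ≤ 5 → c j = hexCoef 1 j) :
    ∀ j, 1 ≤ j → j < q → (j + 1 < q ∨ Odd j) → c j = hexCoef 1 j := by
  intro j
  induction j using Nat.strong_induction_on with
  | _ j ih =>
    intro hj hjq ho
    rcases Nat.lt_or_ge 5 j with h5 | h5
    swap
    · exact hc5 j hj h5
    rcases Nat.even_or_odd j with he | ⟨m, hm⟩
    · have hjq' : j + 1 < q := ho.resolve_right (Nat.not_odd_iff_even.2 he)
      obtain ⟨m, hm⟩ := he
      obtain rfl : j = 2 * m := by omega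
      have hc : ∀ j, 1 ≤ j → j < 2 * m → c j = hexCoef 1 j :=
        fun j' hj' h' => ih j' h' hj' (by omega) (by omega)
      have hg := fun i j (_ : 1 ≤ i) (_ : 1 ≤ j) => hexCoef_succ i j
      have hd := h.c_odd_succ (g := hexCoef) (by omega) (by omega) hg (hexCoef_self _) hc
      set a := c (2 * m) - hexCoef 1 (2 * m) with ha
      have he := fun (i j : ℕ) (hi : 1 ≤ i) (hj : 1 ≤ j) (hij : i + j = 2 * m + 2) =>
        (coef_expand (D := 2 * m + 1) (a₀ := a) (a₁ := m * a)
          (a₂ := c (2 * m + 1 + 1) - hexCoef 1 (2 * m + 1 + 1))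
          (a₃ := c (2 * m + 1 + 2) - hexCoef 1 (2 * m + 1 + 2)) hg
          (fun j hj h => hc j hj (by omega))
          (fun j h => by rw [show j = 2 * m by omega, ha]; ring)
          (fun j h => by rw [h, hd]) (fun j h => by rw [h]; ring) (fun j h => by rw [h]; ring)
          hi j hj).2.2.1 hij
      obtain ⟨k, rfl⟩ : ∃ k, m = k + 3 := ⟨m - 3, by omega⟩
      have hl := h.l_eq_hex (s := 2 * k + 3) ⟨k + 1, by ring⟩ (by omega) (by omega) hl3
        (fun j hj h' => hc j hj (by omega))
      have hl5 := h.l_eq_hex (s := 5) ⟨2, by ring⟩ (by omega) (by omega) hl3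
        (fun j hj h' => hc j hj (by omega))
      -- The two orders of w_5 and w_{2k+3} give a linear equation for the deviation `a` of c_{2m},
      -- m = k + 3. The periodic terms cancel by `i1` and `i2`, and `a` keeps the nonzero factor 10
      -- or 4k + 16.
      have hK := h.lie_w_w_antisymm (i := 4) (j := 2 * k + 2) ⟨2, by ring⟩ ⟨k + 1, by ring⟩
        (by omega) (by omega) (by omega)
      have e1 := he 6 (2 * k + 2) (by omega) (by omega) (by omega)
      have e2 := he (2 * k + 4) 4 (by omega) (by omega) (by omega)
      have e7 : (-1 : ℂ) ^ (2 * k + 4 + 1) = -1 :=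
        Odd.neg_one_pow ⟨k + 2, by ring⟩
      rw [if_neg (by norm_num)] at hl5
      rw [show 4 + 1 + 1 = 6 from rfl, show 4 + 1 = 5 from rfl, hl5,
        show 2 * k + 2 + 1 + 1 = 2 * k + 4 by ring, show 2 * k + 2 + 1 = 2 * k + 3 by ring,
        e1, e2, hl, e7, show 5 + (2 * k + 2) = 2 * (k + 3) + 1 by ring,
        show 2 * k + 3 + 4 = 2 * (k + 3) + 1 by ring, hd, hc 4 (by omega) (by omega),
        hc (2 * k + 2) (by omega) (by omega)] at hK
      have i1 : hexCoef 6 (2 * k + 2) + hexCoef 1 (2 * (k + 3) + 1) - hexCoef 1 (2 * k + 2) = 0 := by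
        have f1 := hex_add_two (10 * k)
        have f2 := hex_add_three (10 * k + 1)
        have f3 := hex_add_three (10 * k + 2)
        rw [hexCoef_eq (r := 10 * k + 1 + 3) (by omega), hexCoef_eq (r := 10 * k) (by omega),
          hexCoef_eq (r := 10 * k + 2 + 3) (by omega)]
        linear_combination f2 - f3 + f1
      have i2 : hexCoef (2 * k + 4) 4 + hexCoef 1 (2 * (k + 3) + 1) - hexCoef 1 4 = 0 := by
        rw [hexCoef_eq (i := 1) (j := 4) (r := 3) (by omega), hex_three]
        rcases (by omega : k % 3 = 0 ∨ k % 3 = 1 ∨ k % 3 = 2) with hk | hk | hk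
        · rw [hexCoef_eq (r := 0) (by omega), hexCoef_eq (r := 0) (by omega), hex_zero]; norm_num
        · rw [hexCoef_eq (r := 2) (by omega), hexCoef_eq (r := 4) (by omega), hex_two, hex_four]
          norm_num
        · rw [hexCoef_eq (r := 4) (by omega), hexCoef_eq (r := 2) (by omega), hex_two, hex_four]
          norm_num
      have hz : a = 0 := by
        split_ifs at hK
        · push_cast at hK
          linear_combination (1 / 10 : ℂ) * hK - (1 / 5 : ℂ) * i1
        · have hz : (4 * k + 16 : ℂ) * a = 0 := by
            push_cast at hK
            linear_combination hK - 2 * i1 - 2 * i2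
          refine (mul_eq_zero.1 hz).resolve_left ?_
          have : 4 * k + 16 ≠ 0 := by omega
          exact_mod_cast this
      exact sub_eq_zero.1 hz
    -- For odd `j` the diagonal argument needs only degree j + 1 ≤ q, so j = q - 1 is included.
    · have := h.c_even (g := hexCoef) (i := m + 1) (by omega) (by omega)
        (fun i j _ _ => hexCoef_succ i j) (hexCoef_self _)
        (fun j' hj' h' => ih j' (by omega) hj' (by omega) (Or.inl (by omega)))
      rwa [show m + 1 + (m + 1) - 1 = j by omega] at this

/-- In the periodic case the coefficient in the top degree is determined if this degree is
congruent to three modulo six. -/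
theorem c_top_eq_hex (h : IsFrame q S c l y w) (h9 : 9 ≤ q) (hq : q % 6 = 3) (hl3 : l 3 = 0)
    (hc : ∀ j, 1 ≤ j → j + 1 < q → c j = hexCoef 1 j) : c (q - 1) = hexCoef 1 (q - 1) := by
  obtain ⟨m, rfl⟩ : ∃ m, q = 6 * m + 9 := ⟨q / 6 - 1, by omega⟩
  have hg : ∀ {i j}, 1 ≤ i → 1 ≤ j → i + j < 6 * m + 9 → coef c i j = hexCoef i j :=
    fun hi hj hij => coef_eq_of_le (D := 6 * m + 8) (fun i j _ _ => hexCoef_succ i j)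
      (fun j hj h' => hc j hj (by omega)) hi hj (by omega)
  have hg' : c (6 * m + 7) = hexCoef 1 (6 * m + 7) := hc _ (by omega) (by omega)
  -- In the top degree each of the three products contributes -c_{q-1} when q is 3 modulo six, so
  -- the identity determines c_{q-1}.
  have hJ := h.jacobi_y (i := 1) (j := 2) (k := 6 * m + 6) le_rfl (by omega) (by omega) (by omega)
  have e1 : coef c (2 + (6 * m + 6)) 1 = -c (6 * m + 8) := by
    rw [h.coef_antisymm (by omega) le_rfl (by omega), coef_one, add_comm]
  have e2 : coef c (6 * m + 6 + 1) 2 = -(c (6 * m + 7) - c (6 * m + 8)) := by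
    rw [h.coef_antisymm (by omega) (by omega) (by omega), coef_succ c le_rfl, coef_one, coef_one]
  have e3 : coef c (1 + 2) (6 * m + 6) = c (6 * m + 6) - 2 * c (6 * m + 7) + c (6 * m + 8) := by
    rw [coef_succ c (by omega), coef_succ c le_rfl, coef_succ c le_rfl]
    simp only [coef_one]
    ring
  have l1 : l (2 + (6 * m + 6)) = 0 := h.l_even (by omega) (by omega) ⟨3 * m + 4, by ring⟩
  have l2 : l (6 * m + 6 + 1) = 2 := by
    have := h.l_eq_hex (s := 6 * m + 7) ⟨3 * m + 3, by ring⟩ (by omega) (by omega) hl3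
      (fun j hj h' => hc j hj (by omega))
    rwa [if_neg (by omega)] at this
  rw [e1, e2, e3, l1, l2, show 1 + 2 = 3 from rfl, hl3, hg (by omega) (by omega) (by omega),
    hg (by omega) (by omega) (by omega), hg (by omega) (by omega) (by omega), hg',
    hc (6 * m + 6) (by omega) (by omega), hexCoef_eq (i := 1) (j := 2) (r := 5) (by omega),
    hexCoef_eq (i := 2) (r := 2) (by omega), hexCoef_eq (i := 6 * m + 6) (r := 5) (by omega),
    hexCoef_eq (j := 6 * m + 6) (r := 1) (by omega), hexCoef_eq (r := 0) (by omega), hex_zero,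
    hex_two, hex_five, hex_one, Odd.neg_one_pow (n := 6 * m + 6 + 1) ⟨3 * m + 3, by ring⟩] at hJ
  rw [show 6 * m + 9 - 1 = 6 * m + 8 from rfl, hexCoef_eq (r := 5) (by omega), hex_five]
  linear_combination (-1 / 3 : ℂ) * hJ

end IsFrame

end NatGraded

end

/-! ### Changes of generators that remove the top parameter -/

noncomputable section

namespace NatGraded

/-- The scalars by which the `w r` act in the periodic case. -/
def hexL (r : ℕ) : ℂ := if r = 1 then 1 else if r % 6 = 1 ∨ r % 6 = 5 then 2 else 0

namespace IsFrame

variable {L : Type u} [LieRing L] [LieAlgebra ℂ L] {q : ℕ} {S : Finset ℕ} {c l : ℕ → ℂ}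
  {y w : ℕ → L}

/-- A two-generator algebra is generated by any invertible combination of the generators. -/
theorem lieSpan_eq_top_of_det (h : IsFrame q S c l y w) {x' y' : L} {a b c' d e : ℂ}
    (hx : x' = a • w 1 + b • y 1) (hy : y' = c' • w 1 + d • y 1) (he : e * (a * d - b * c') = 1) :
    LieSubalgebra.lieSpan ℂ L {x', y'} = ⊤ := by
  have mx : x' ∈ LieSubalgebra.lieSpan ℂ L {x', y'} := LieSubalgebra.subset_lieSpan (by simp)
  have my : y' ∈ LieSubalgebra.lieSpan ℂ L {x', y'} := LieSubalgebra.subset_lieSpan (by simp)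
  have e1 : w 1 = (e * d) • x' - (e * b) • y' := by
    rw [hx, hy]
    match_scalars
    · linear_combination -he
    · ring
  have e2 : y 1 = (e * a) • y' - (e * c') • x' := by
    rw [hx, hy]
    match_scalars
    · linear_combination -he
    · ring
  refine lieSpan_pair_eq_top h.gen ?_ ?_
  · rw [e1]
    exact sub_mem (LieSubalgebra.smul_mem _ _ mx) (LieSubalgebra.smul_mem _ _ my)
  · rw [e2]
    exact sub_mem (LieSubalgebra.smul_mem _ _ my) (LieSubalgebra.smul_mem _ _ mx)

/-- A hyperbolic rotation of the generators removes a generic coefficient in the top degree. -/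
theorem exists_frame_hyperbolic (h : IsFrame q S c l y w) (hq : 3 ≤ q) (ho : Odd q) (hS : q ∉ S)
    (hc : ∀ j, 1 ≤ j → j + 1 < q → c j = 0) (hl : ∀ r, Odd r → r < q → l r = 1)
    (hγ : c (q - 1) ^ 2 ≠ 1) :
    ∃ y' w' : ℕ → L, IsFrame q S (fun _ => 0) (fun r => if Odd r then 1 else 0) y' w' := by
  set t := c (q - 1) with ht
  -- The conditions are a² - b² = 1, so that the rotation preserves the brackets, and b = -a t, so
  -- that the new `w' q` = (a t + b) y_q vanishes as q ∉ S requires. They are solvable when t² ≠ 1.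
  obtain ⟨a, ha⟩ := IsAlgClosed.exists_pow_nat_eq (1 / (1 - t ^ 2)) (n := 2) (by norm_num)
  have ht0 : 1 - t ^ 2 ≠ 0 := fun h0 => hγ (sub_eq_zero.1 h0).symm
  have hab : a ^ 2 - (-(a * t)) ^ 2 = 1 := by
    have : a ^ 2 * (1 - t ^ 2) = 1 := by rw [ha]; field_simp
    linear_combination this
  set b := -(a * t) with hb
  -- Storing the top coefficient in `W q` makes the relations uniform: [y_1, y_j] = W_{j+1}
  -- throughout. The rotation mixes `y` and `W` in odd degrees and fixes `y` in even ones.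
  let W : ℕ → L := fun r => if r = q then t • y q else w r
  have W1 : W 1 = w 1 := if_neg (by omega)
  have Wq : W q = t • y q := if_pos rfl
  have We : ∀ r, 1 ≤ r → Even r → W r = 0 := by
    intro r hr he
    have : r ≠ q := fun h' => Nat.not_even_iff_odd.2 ho (h' ▸ he)
    exact (if_neg this).trans (h.w_eq_zero_of_even hr he)
  have xy := h.xy
  have xW : ∀ r, 1 ≤ r → ⁅w 1, W r⁆ = 0 := by
    intro r hr
    rcases eq_or_ne r q with rfl | hrq
    · rw [Wq, lie_smul, h.xy r hr, h.y_eq_zero _ (by omega), smul_zero]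
    · rw [show W r = w r from if_neg hrq, h.xw r hr]
  have yy : ∀ j, 1 ≤ j → ⁅y 1, y j⁆ = W (j + 1) := by
    intro j hj
    rw [h.yy j hj]
    rcases lt_trichotomy (j + 1) q with hjq | hjq | hjq
    · rw [hc j hj hjq, zero_smul, zero_add, show W (j + 1) = w (j + 1) from if_neg hjq.ne]
    · rw [hjq, h.w_eq_zero q (by omega) hS, add_zero, Wq, ht, show j = q - 1 by omega]
    · rw [h.y_eq_zero _ hjq, smul_zero, zero_add, show W (j + 1) = w (j + 1) from if_neg hjq.ne']
  have yW : ∀ r, Odd r → ⁅y 1, W r⁆ = -y (r + 1) := by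
    intro r hr
    have hr1 : 1 ≤ r := hr.pos
    rcases lt_trichotomy r q with hrq | rfl | hrq
    · rw [show W r = w r from if_neg hrq.ne, h.yw r hr1, hl r hr hrq, one_smul]
    · rw [Wq, lie_smul, yy r hr1, We _ (by omega) hr.add_one, h.y_eq_zero _ (by omega), smul_zero,
        neg_zero]
    · rw [show W r = w r from if_neg hrq.ne', h.yw r hr1, h.y_eq_zero _ (by omega), smul_zero]
  let y' : ℕ → L := fun j => if Odd j then a • y j + b • W j else y j
  let w' : ℕ → L := fun j => if Odd j then a • W j + b • y j else 0
  have y'o : ∀ {j}, Odd j → y' j = a • y j + b • W j := fun hj => if_pos hj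
  have y'e : ∀ {j}, Even j → y' j = y j := fun hj => if_neg (Nat.not_odd_iff_even.2 hj)
  have w'o : ∀ {j}, Odd j → w' j = a • W j + b • y j := fun hj => if_pos hj
  have w'e : ∀ {j}, Even j → w' j = 0 := fun hj => if_neg (Nat.not_odd_iff_even.2 hj)
  have wtop : w' q = 0 := by
    rw [w'o ho, Wq, hb]
    module
  have wz : ∀ r, q < r → W r = 0 := by
    intro r hr
    rw [show W r = w r from if_neg hr.ne', h.w_eq_zero r (by omega)
      (fun h' => by have := (h.bounds _ h').2; omega)]
  refine ⟨y', w', ?_, h.card, h.one_mem, h.bounds, ?_, ?_, ?_, ?_, ?_, ?_⟩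
  · refine h.lieSpan_eq_top_of_det (a := a) (b := b) (c' := b) (d := a) (e := 1) ?_ ?_ ?_
    · rw [w'o odd_one, W1]
    · rw [y'o odd_one, W1, add_comm]
    · linear_combination hab
  · intro i hi
    rcases Nat.even_or_odd i with he | ho'
    · rw [y'e he, h.y_eq_zero i hi]
    · rw [y'o ho', h.y_eq_zero i hi, wz i hi]; simp
  · intro r hr hrS
    rcases Nat.even_or_odd r with he | ho'
    · exact w'e he
    · rcases lt_trichotomy r q with hrq | rfl | hrq
      · have := h.l_eq_zero_of_w hr hrq (h.w_eq_zero r hr hrS)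
        rw [hl r ho' hrq] at this
        exact absurd this one_ne_zero
      · exact wtop
      · rw [w'o ho', h.y_eq_zero r hrq, wz r hrq]; simp
  · intro j hj
    rw [w'o odd_one, W1]
    rcases Nat.even_or_odd j with he | ho'
    · rw [y'e he, y'o he.add_one, add_lie, smul_lie, smul_lie, xy j hj, yy j hj]
    · rw [y'o ho', y'e ho'.add_one, add_lie, smul_lie, smul_lie, lie_add, lie_add, lie_smul,
        lie_smul, lie_smul, lie_smul, xy j hj, yy j hj, xW j hj, yW j ho',
        We _ (by omega) ho'.add_one]
      match_scalars
      linear_combination hab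
  · intro j hj
    rw [w'o odd_one, W1]
    rcases Nat.even_or_odd j with he | ho'
    · rw [w'e he, lie_zero]
    · rw [w'o ho', add_lie, smul_lie, smul_lie, lie_add, lie_add, lie_smul,
        lie_smul, lie_smul, lie_smul, xy j hj, yy j hj, xW j hj, yW j ho',
        We _ (by omega) ho'.add_one]
      module
  · intro j hj
    rw [y'o odd_one, W1, zero_smul, zero_add]
    rcases Nat.even_or_odd j with he | ho'
    · rw [y'e he, w'o he.add_one, add_lie, smul_lie, smul_lie, xy j hj, yy j hj]
    · rw [y'o ho', w'e ho'.add_one, add_lie, smul_lie, smul_lie, lie_add, lie_add, lie_smul,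
        lie_smul, lie_smul, lie_smul, xy j hj, yy j hj, xW j hj, yW j ho',
        We _ (by omega) ho'.add_one]
      module
  · intro j hj
    rw [y'o odd_one, W1]
    rcases Nat.even_or_odd j with he | ho'
    · rw [w'e he, lie_zero, if_neg (Nat.not_odd_iff_even.2 he), zero_smul, neg_zero]
    · rw [w'o ho', y'e ho'.add_one, if_pos ho', add_lie, smul_lie, smul_lie, lie_add, lie_add,
        lie_smul, lie_smul, lie_smul, lie_smul, xy j hj, yy j hj, xW j hj, yW j ho',
        We _ (by omega) ho'.add_one]
      match_scalars
      linear_combination -hab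

/-- A change of the generators that rescales the top degree in the periodic case. -/
theorem exists_frame_torus (h : IsFrame q S c l y w) (hq : 7 ≤ q) (hS : q ∉ S)
    (hc : ∀ j, 1 ≤ j → j + 1 < q → c j = hexCoef 1 j) (hl : ∀ r, 1 ≤ r → r < q → l r = hexL r)
    {s v t : ℂ} (hsv : s * v = 1) (ht : c (q - 1) = hexCoef 1 (q - 1) + t)
    (htop : (q % 6 = 1 ∧ 2 * (v ^ 2 - s) + (v ^ 2 + 2 * s) * t = 0) ∨
      (q % 6 = 5 ∧ 2 * (v - s ^ 2) + (2 * v + s ^ 2) * t = 0)) :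
    ∃ y' w' : ℕ → L, IsFrame q S (hexCoef 1) hexL y' w' := by
  -- Doubling w_1 makes the action of y_1 on V_r the same for all r congruent to ±1 modulo six; the
  -- top deviation is stored in `V q`.
  let V : ℕ → L := fun r => if r = 1 then (2 : ℂ) • w 1 else if r = q then t • y q else w r
  have V1 : V 1 = (2 : ℂ) • w 1 := if_pos rfl
  have Vq : V q = t • y q := (if_neg (by omega)).trans (if_pos rfl)
  have Vw : ∀ r, r ≠ 1 → r ≠ q → V r = w r := fun r h1 h2 => (if_neg h1).trans (if_neg h2)
  have ho : Odd q := by rw [Nat.odd_iff]; omega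
  have Ve : ∀ r, 1 ≤ r → Even r → V r = 0 := by
    intro r hr he
    rw [Vw r (by rintro rfl; simp at he) (fun h' => Nat.not_even_iff_odd.2 ho (h' ▸ he)),
      h.w_eq_zero_of_even hr he]
  have xy := h.xy
  have xV : ∀ r, 1 ≤ r → ⁅w 1, V r⁆ = 0 := by
    intro r hr
    rcases eq_or_ne r 1 with rfl | h1
    · rw [V1, lie_smul, lie_self, smul_zero]
    rcases eq_or_ne r q with rfl | hrq
    · rw [Vq, lie_smul, h.xy r hr, h.y_eq_zero _ (by omega), smul_zero]
    · rw [Vw r h1 hrq, h.xw r hr]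
  have yy : ∀ j, 1 ≤ j → ⁅y 1, y j⁆ = hexCoef 1 j • y (j + 1) + V (j + 1) := by
    intro j hj
    rw [h.yy j hj]
    rcases lt_trichotomy (j + 1) q with hjq | hjq | hjq
    · rw [hc j hj hjq, Vw (j + 1) (by omega) hjq.ne]
    · rw [hjq, h.w_eq_zero q (by omega) hS, Vq, show j = q - 1 by omega, ht]
      module
    · rw [h.y_eq_zero _ hjq, Vw (j + 1) (by omega) hjq.ne', smul_zero, smul_zero]
  have yV1 : ∀ r, 1 ≤ r → r % 6 = 1 ∨ r % 6 = 5 → ⁅y 1, V r⁆ = (-2 : ℂ) • y (r + 1) := by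
    intro r hr hr6
    rcases eq_or_ne r 1 with rfl | h1
    · rw [V1, lie_smul, ← lie_skew, h.xy 1 le_rfl]
      module
    rcases lt_trichotomy r q with hrq | rfl | hrq
    · rw [Vw r h1 hrq.ne, h.yw r hr, hl r hr hrq, hexL, if_neg h1, if_pos hr6]
      module
    · rw [Vq, lie_smul, yy r hr, Ve _ (by omega) ho.add_one, h.y_eq_zero _ (by omega)]
      simp
    · rw [Vw r h1 hrq.ne', h.yw r hr, h.y_eq_zero _ (by omega)]
      simp
  have yV3 : ∀ r, r % 6 = 3 → ⁅y 1, V r⁆ = 0 := by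
    intro r hr6
    rw [Vw r (by omega) (by omega), h.yw r (by omega)]
    rcases lt_or_ge r q with hrq | hrq
    · rw [hl r (by omega) hrq, hexL, if_neg (by omega), if_neg (by omega)]
      simp
    · rw [h.y_eq_zero _ (by omega)]
      simp
  have Vz : ∀ r, q < r → V r = 0 := by
    intro r hr
    rw [Vw r (by omega) hr.ne', h.w_eq_zero r (by omega)
      (fun h' => by have := (h.bounds _ h').2; omega)]
  -- the periodic coefficients of the transformation
  obtain ⟨A, hA⟩ : ∃ z : ℂ, z = (s + 2 * v ^ 2) / 3 := ⟨_, rfl⟩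
  obtain ⟨A', hA'⟩ : ∃ z : ℂ, z = (v ^ 2 + 2 * s) / 3 := ⟨_, rfl⟩
  obtain ⟨B, hB⟩ : ∃ z : ℂ, z = (v ^ 2 - s) / 3 := ⟨_, rfl⟩
  obtain ⟨P, hP⟩ : ∃ z : ℂ, z = (2 * s ^ 2 + v) / 3 := ⟨_, rfl⟩
  obtain ⟨R, hR⟩ : ∃ z : ℂ, z = (2 * v + s ^ 2) / 3 := ⟨_, rfl⟩
  obtain ⟨Q, hQ⟩ : ∃ z : ℂ, z = (v - s ^ 2) / 3 := ⟨_, rfl⟩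
  obtain ⟨K, hK⟩ : ∃ z : ℂ, z = (v ^ 3 - 1) / 3 := ⟨_, rfl⟩
  let y' : ℕ → L := fun j => if j % 6 = 1 then A • y j + B • V j else
    if j % 6 = 2 then v • y j else if j % 6 = 3 then y j + K • V j else
    if j % 6 = 4 then s • y j else if j % 6 = 5 then P • y j + Q • V j else y j
  let w' : ℕ → L := fun j => if j = 1 then A' • w 1 + B • y 1 else
    if j % 6 = 1 then A' • V j + (2 * B) • y j else
    if j % 6 = 3 then v ^ 3 • V j else
    if j % 6 = 5 then R • V j + (2 * Q) • y j else 0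
  have y'1 : ∀ {j}, j % 6 = 1 → y' j = A • y j + B • V j := fun {j} hj => if_pos hj
  have y'2 : ∀ {j}, j % 6 = 2 → y' j = v • y j := fun {j} hj => by simp [y', hj]
  have y'3 : ∀ {j}, j % 6 = 3 → y' j = y j + K • V j := fun {j} hj => by simp [y', hj]
  have y'4 : ∀ {j}, j % 6 = 4 → y' j = s • y j := fun {j} hj => by simp [y', hj]
  have y'5 : ∀ {j}, j % 6 = 5 → y' j = P • y j + Q • V j := fun {j} hj => by simp [y', hj]
  have y'0 : ∀ {j}, j % 6 = 0 → y' j = y j := fun {j} hj => by simp [y', hj]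
  have w'x : w' 1 = A' • w 1 + B • y 1 := if_pos rfl
  have w'1 : ∀ {j}, j ≠ 1 → j % 6 = 1 → w' j = A' • V j + (2 * B) • y j :=
    fun {j} h1 hj => by simp [w', hj, h1]
  have w'3 : ∀ {j}, j % 6 = 3 → w' j = v ^ 3 • V j :=
    fun {j} hj => by simp [w', hj, show j ≠ 1 by omega]
  have w'5 : ∀ {j}, j % 6 = 5 → w' j = R • V j + (2 * Q) • y j :=
    fun {j} hj => by simp [w', hj, show j ≠ 1 by omega]
  have w'e : ∀ {j}, j % 2 = 0 → w' j = 0 := fun {j} hj => by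
    simp [w', show j ≠ 1 by omega, show j % 6 ≠ 1 by omega, show j % 6 ≠ 3 by omega,
      show j % 6 ≠ 5 by omega]
  have yx : y' 1 = (2 * B) • w 1 + A • y 1 := by
    rw [y'1 (by norm_num), V1]
    module
  have lx : ∀ z : L, ⁅w' 1, z⁆ = A' • ⁅w 1, z⁆ + B • ⁅y 1, z⁆ := fun z => by
    rw [w'x, add_lie, smul_lie, smul_lie]
  have ly : ∀ z : L, ⁅y' 1, z⁆ = (2 * B) • ⁅w 1, z⁆ + A • ⁅y 1, z⁆ := fun z => by
    rw [yx, add_lie, smul_lie, smul_lie]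
  have g1 : ∀ {j}, j % 6 = 1 → hexCoef 1 j = 0 := fun {j} hj => by
    rw [hexCoef_eq (r := 0) (by omega), hex_zero]
  have g2 : ∀ {j}, j % 6 = 2 → hexCoef 1 j = -1 := fun {j} hj => by
    rw [hexCoef_eq (r := 5) (by omega), hex_five]
  have g3 : ∀ {j}, j % 6 = 3 → hexCoef 1 j = -1 := fun {j} hj => by
    rw [hexCoef_eq (r := 4) (by omega), hex_four]
  have g4 : ∀ {j}, j % 6 = 4 → hexCoef 1 j = 0 := fun {j} hj => by
    rw [hexCoef_eq (r := 3) (by omega), hex_three]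
  have g5 : ∀ {j}, j % 6 = 5 → hexCoef 1 j = 1 := fun {j} hj => by
    rw [hexCoef_eq (r := 2) (by omega), hex_two]
  have g0 : ∀ {j}, j % 6 = 0 → hexCoef 1 j = 1 := fun {j} hj => by
    rw [hexCoef_eq (r := 1) (by omega), hex_one]
  have V0 : ∀ {j}, 1 ≤ j → j % 2 = 0 → V j = 0 := fun hj he => Ve _ hj (Nat.even_iff.2 he)
  have i0 : s * (A * A' - 2 * B * B) = 1 := by subst hA hA' hB; grind
  have i1 : A * A' - 2 * B * B = v := by subst hA hA' hB; grind
  have i2 : v * (A' - B) = 1 := by subst hA' hB; grind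
  have i3 : v * B = K := by subst hB hK; grind
  have i4 : A' - B = s := by subst hA' hB; ring
  have i5 : s * A' = P := by subst hA' hP; grind
  have i6 : s * B = Q := by subst hB hQ; grind
  have i7 : (A' + B) * P - 2 * B * Q = 1 := by subst hA' hB hP hQ; grind
  have i8 : A' + B = A := by subst hA' hB hA; ring
  have i9 : (A' + B) * Q - B * R = 0 := by subst hA' hB hQ hR; grind
  have j1 : v * (2 * B - A) = -1 := by subst hA hB; grind
  have j2 : v * A = v ^ 3 - K := by subst hA hK; grind
  have j3 : 2 * B - A = -s := by subst hA hB; ring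
  have j4 : s * A = R := by subst hA hR; grind
  have j5 : (A + 2 * B) * P - 2 * A * Q = 1 := by subst hA hB hP hQ; grind
  have j6 : Q * (A + 2 * B) - A * R = -1 := by subst hA hB hQ hR; grind
  have six : ∀ j, j % 6 = 0 ∨ j % 6 = 1 ∨ j % 6 = 2 ∨ j % 6 = 3 ∨ j % 6 = 4 ∨ j % 6 = 5 := by
    intro j; omega
  -- The hypothesis `htop` is exactly the vanishing of the new `w` in the top degree, which q ∉ S
  -- demands.
  have wtop : w' q = 0 := by
    rcases htop with ⟨h6, ht⟩ | ⟨h6, ht⟩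
    · rw [w'1 (by omega) h6, Vq, smul_smul, ← add_smul,
        show A' * t + 2 * B = 0 by subst hA' hB; linear_combination ht / 3, zero_smul]
    · rw [w'5 h6, Vq, smul_smul, ← add_smul,
        show R * t + 2 * Q = 0 by subst hR hQ; linear_combination ht / 3, zero_smul]
  refine ⟨y', w', ?_, h.card, h.one_mem, h.bounds, ?_, ?_, ?_, ?_, ?_, ?_⟩
  · refine h.lieSpan_eq_top_of_det (e := s) w'x yx ?_
    linear_combination i0
  · intro j hj
    rcases six j with hm | hm | hm | hm | hm | hm
    · rw [y'0 hm, h.y_eq_zero j hj]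
    · rw [y'1 hm, h.y_eq_zero j hj, Vz j hj]; simp
    · rw [y'2 hm, h.y_eq_zero j hj]; simp
    · rw [y'3 hm, h.y_eq_zero j hj, Vz j hj]; simp
    · rw [y'4 hm, h.y_eq_zero j hj]; simp
    · rw [y'5 hm, h.y_eq_zero j hj, Vz j hj]; simp
  · intro r hr hrS
    have r1 : r ≠ 1 := fun h' => hrS (h' ▸ h.one_mem)
    have key : ¬r < q ∨ ¬(r % 6 = 1 ∨ r % 6 = 5) := by
      by_contra hcon
      push Not at hcon
      have := h.l_eq_zero_of_w hr hcon.1 (h.w_eq_zero r hr hrS)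
      rw [hl r hr hcon.1, hexL, if_neg r1, if_pos hcon.2] at this
      norm_num at this
    rcases eq_or_ne r q with rfl | hrq
    · exact wtop
    have hz : ¬r < q → w' r = 0 := fun hlt => by
      have hlt : q < r := by omega
      rcases six r with hm | hm | hm | hm | hm | hm
      · exact w'e (by omega)
      · rw [w'1 r1 hm, h.y_eq_zero r hlt, Vz r hlt]; simp
      · exact w'e (by omega)
      · rw [w'3 hm, Vz r hlt]; simp
      · exact w'e (by omega)
      · rw [w'5 hm, h.y_eq_zero r hlt, Vz r hlt]; simp
    rcases key with hlt | hm
    · exact hz hlt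
    · rcases Nat.even_or_odd r with he | ho'
      · exact w'e (Nat.even_iff.1 he)
      · rw [w'3 (by rw [Nat.odd_iff] at ho'; omega), Vw r r1 hrq, h.w_eq_zero r hr hrS, smul_zero]
  · intro j hj
    rw [lx]
    rcases six j with hm | hm | hm | hm | hm | hm
    · rw [y'0 hm, y'1 (by omega), xy j hj, yy j hj, g0 hm]
      match_scalars
      · linear_combination i8
      · ring
    · rw [y'1 hm, y'2 (by omega), lie_add, lie_add, lie_smul, lie_smul, lie_smul, lie_smul, xy j hj,
        xV j hj, yy j hj, yV1 j hj (Or.inl hm), V0 (j := j + 1) (by omega) (by omega), g1 hm]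
      match_scalars
      linear_combination i1
    · rw [y'2 hm, y'3 (by omega), lie_smul, lie_smul, xy j hj, yy j hj, g2 hm]
      match_scalars
      · linear_combination i2
      · linear_combination i3
    · rw [y'3 hm, y'4 (by omega), lie_add, lie_add, lie_smul, lie_smul, xy j hj, xV j hj, yy j hj,
        yV3 j hm, V0 (j := j + 1) (by omega) (by omega), g3 hm]
      match_scalars
      linear_combination i4
    · rw [y'4 hm, y'5 (by omega), lie_smul, lie_smul, xy j hj, yy j hj, g4 hm]
      match_scalars
      · linear_combination i5
      · linear_combination i6
    · rw [y'5 hm, y'0 (by omega), lie_add, lie_add, lie_smul, lie_smul, lie_smul, lie_smul, xy j hj,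
        xV j hj, yy j hj, yV1 j hj (Or.inr hm), V0 (j := j + 1) (by omega) (by omega), g5 hm]
      match_scalars
      linear_combination i7
  · intro j hj
    rw [lx]
    rcases eq_or_ne j 1 with rfl | h1
    · rw [← lx, lie_self]
    rcases six j with hm | hm | hm | hm | hm | hm
    · rw [w'e (by omega)]; simp
    · rw [w'1 h1 hm, lie_add, lie_add, lie_smul, lie_smul, lie_smul, lie_smul, xy j hj,
        xV j hj, yy j hj, yV1 j hj (Or.inl hm), V0 (j := j + 1) (by omega) (by omega), g1 hm]
      module
    · rw [w'e (by omega)]; simp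
    · rw [w'3 hm, lie_smul, lie_smul, xV j hj, yV3 j hm]; simp
    · rw [w'e (by omega)]; simp
    · rw [w'5 hm, lie_add, lie_add, lie_smul, lie_smul, lie_smul, lie_smul, xy j hj,
        xV j hj, yy j hj, yV1 j hj (Or.inr hm), V0 (j := j + 1) (by omega) (by omega), g5 hm]
      match_scalars
      linear_combination 2 * i9
  · intro j hj
    rw [ly]
    rcases six j with hm | hm | hm | hm | hm | hm
    · rw [y'0 hm, y'1 (by omega), w'1 (by omega) (by omega), xy j hj, yy j hj, g0 hm]
      match_scalars
      · ring
      · linear_combination -i8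
    · rw [y'1 hm, y'2 (by omega), w'e (j := j + 1) (by omega), lie_add, lie_add, lie_smul, lie_smul,
        lie_smul, lie_smul, xy j hj,
        xV j hj, yy j hj, yV1 j hj (Or.inl hm), V0 (j := j + 1) (by omega) (by omega), g1 hm]
      module
    · rw [y'2 hm, y'3 (by omega), w'3 (by omega), lie_smul, lie_smul, xy j hj, yy j hj, g2 hm]
      match_scalars
      · linear_combination j1
      · linear_combination j2
    · rw [y'3 hm, y'4 (by omega), w'e (j := j + 1) (by omega), lie_add, lie_add, lie_smul, lie_smul,
        xy j hj, xV j hj, yy j hj,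
        yV3 j hm, V0 (j := j + 1) (by omega) (by omega), g3 hm]
      match_scalars
      linear_combination j3
    · rw [y'4 hm, y'5 (by omega), w'5 (by omega), lie_smul, lie_smul, xy j hj, yy j hj, g4 hm]
      match_scalars
      · linear_combination 2 * i6
      · linear_combination j4
    · rw [y'5 hm, y'0 (by omega), w'e (j := j + 1) (by omega), lie_add, lie_add, lie_smul, lie_smul,
        lie_smul, lie_smul, xy j hj,
        xV j hj, yy j hj, yV1 j hj (Or.inr hm), V0 (j := j + 1) (by omega) (by omega), g5 hm]
      match_scalars
      linear_combination j5
  · intro j hj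
    rcases eq_or_ne j 1 with rfl | h1
    · rw [yx, w'x, y'2 (by norm_num), hexL, if_pos rfl, add_lie, smul_lie, smul_lie, lie_add,
        lie_add, lie_smul, lie_smul, lie_smul, lie_smul, lie_self, lie_self, xy 1 le_rfl,
        ← lie_skew (y 1) (w 1), xy 1 le_rfl]
      match_scalars
      linear_combination -i1
    rw [ly]
    rcases six j with hm | hm | hm | hm | hm | hm
    · rw [w'e (by omega), hexL, if_neg h1, if_neg (by omega)]; simp
    · rw [w'1 h1 hm, y'2 (by omega), hexL, if_neg h1, if_pos (Or.inl hm), lie_add, lie_add,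
        lie_smul, lie_smul, lie_smul, lie_smul, xy j hj,
        xV j hj, yy j hj, yV1 j hj (Or.inl hm), V0 (j := j + 1) (by omega) (by omega), g1 hm]
      match_scalars
      linear_combination -2 * i1
    · rw [w'e (by omega), hexL, if_neg h1, if_neg (by omega)]; simp
    · rw [w'3 hm, hexL, if_neg h1, if_neg (by omega), lie_smul, lie_smul, xV j hj, yV3 j hm]; simp
    · rw [w'e (by omega), hexL, if_neg h1, if_neg (by omega)]; simp
    · rw [w'5 hm, y'0 (by omega), hexL, if_neg h1, if_pos (Or.inr hm), lie_add, lie_add,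
        lie_smul, lie_smul, lie_smul, lie_smul, xy j hj,
        xV j hj, yy j hj, yV1 j hj (Or.inr hm), V0 (j := j + 1) (by omega) (by omega), g5 hm]
      match_scalars
      linear_combination 2 * j6

end IsFrame

end NatGraded

end

/-! ### Normal forms and the finite list of codes -/

noncomputable section

namespace NatGraded

/-- The sequence with the single entry `a` that concerns the degree `q`. -/
def topSeq (q : ℕ) (a : ℂ) (j : ℕ) : ℂ := if j + 1 = q then a else 0

/-- The normal forms of the structure constants of a frame. -/
def normalForms (q : ℕ) : Set ((ℕ → ℂ) × (ℕ → ℂ)) :=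
  ((fun a => (topSeq q a, fun r => if r = 1 then 1 else 0)) '' {0, 1}) ∪
  ((fun m : ℕ => (fun j => if j = 2 * m then 1 else if j = 2 * m + 1 then (m : ℂ) else 0,
    fun r => if r = 1 then 1 else if r = 2 * m + 1 then (m : ℂ) else 0)) '' Set.Iio q) ∪
  ((fun a => (topSeq q a, fun r => if Odd r then 1 else 0)) '' {0, 1, -1}) ∪
  ((fun a => (fun j => hexCoef 1 j + topSeq q a j, hexL)) '' {0, 1, -1, 2, -2})

theorem finite_normalForms (q : ℕ) : (normalForms q).Finite := by
  refine ((Set.Finite.union ?_ ?_).union ?_).union ?_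
  · exact Set.Finite.image _ (Set.toFinite _)
  · exact Set.Finite.image _ (Set.finite_Iio q)
  · exact Set.Finite.image _ (Set.toFinite _)
  · exact Set.Finite.image _ (Set.toFinite _)

namespace IsFrame

variable {L : Type u} [LieRing L] [LieAlgebra ℂ L] {q : ℕ} {S : Finset ℕ} {c l : ℕ → ℂ}
  {y w : ℕ → L}

/-- The normal form if all `w s` with `3 ≤ s < q` are central. -/
theorem exists_normalForm_of_central (h : IsFrame q S c l y w) (hq : 3 ≤ q) (h2 : c 2 = 0)
    (hl : ∀ s, 3 ≤ s → s < q → l s = 0) :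
    ∃ y' w' : ℕ → L, ∃ p ∈ normalForms q, IsFrame q S p.1 p.2 y' w' := by
  have hc := h.c_eq_zero h2 le_rfl hl
  have hl' : ∀ r, 1 ≤ r → r < q → l r = if r = 1 then 1 else 0 := by
    intro r hr hrq
    split_ifs with h1
    · rw [h1, h.l_one (by omega)]
    · rcases Nat.lt_or_ge r 3 with h3 | h3
      · exact h.l_even hr hrq ⟨1, by omega⟩
      · exact hl r h3 hrq
  -- Only this coefficient can be nonzero, and scaling the second generator makes it 1.
  by_cases h0 : c (q - 1) = 0
  · refine ⟨y, w, _, Or.inl (Or.inl (Or.inl ⟨0, by simp, rfl⟩)), h.congr (fun j hj hjq => ?_) hl'⟩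
    dsimp only [topSeq]
    split_ifs with h1
    · rw [← h0, ← h1, Nat.add_sub_cancel]
    · exact hc j hj (by omega)
  · refine ⟨_, _, _, Or.inl (Or.inl (Or.inl ⟨1, by simp, rfl⟩)),
      (h.scale (inv_ne_zero h0)).congr (fun j hj hjq => ?_) (fun r hr hrq => ?_)⟩
    · dsimp only [topSeq]
      split_ifs with h1
      · rw [show j = q - 1 by omega, inv_mul_cancel₀ h0]
      · rw [hc j hj (by omega), mul_zero]
    · rw [hl' r hr hrq, hl' 1 le_rfl (by omega)]
      split_ifs <;> simp_all

/-- The normal form if `w r` is not central for some `r = 2 * m + 1 ≥ 7` and `w s` is central for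
`3 ≤ s < r`. -/
theorem exists_normalForm_of_seven_le (h : IsFrame q S c l y w) (h2 : c 2 = 0) {m : ℕ}
    (hm : 3 ≤ m) (hq : 2 * m + 1 < q) (hl : ∀ s, 3 ≤ s → s < 2 * m + 1 → l s = 0)
    (hr : l (2 * m + 1) ≠ 0) :
    ∃ y' w' : ℕ → L, ∃ p ∈ normalForms q, IsFrame q S p.1 p.2 y' w' := by
  have hc : ∀ j, 1 ≤ j → j < 2 * m → c j = 0 :=
    fun j hj hjm => h.c_eq_zero h2 hq.le hl j hj (by omega)
  have h0 : c (2 * m) ≠ 0 := by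
    intro h0
    rw [(h.l_eq_of_first (by omega) (by omega) (hl 3 le_rfl (by omega)) hc).2, h0] at hr
    simp at hr
  have h' := h.scale (inv_ne_zero h0)
  have h3 : (if 3 = 1 then l 1 else (c (2 * m))⁻¹ ^ 2 * l 3) = 0 := by
    rw [if_neg (by norm_num), hl 3 le_rfl (by omega), mul_zero]
  have hc' : ∀ j, 1 ≤ j → j < 2 * m → (c (2 * m))⁻¹ * c j = 0 :=
    fun j hj hjm => by rw [hc j hj hjm, mul_zero]
  have h1 : (c (2 * m))⁻¹ * c (2 * m) = 1 := inv_mul_cancel₀ h0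
  -- Since q ≤ 2m + 3, the only coefficients from c_{2m} on are c_{2m} = 1, c_{2m+1} = m and
  -- c_{2m+2} = 0, so `m` determines the form.
  have hq' := h'.class_le hm h3 hc' h1
  obtain ⟨hd, hlr⟩ := h'.l_eq_of_first (by omega) (by omega) h3 hc'
  refine ⟨_, _, _, Or.inl (Or.inl (Or.inr ⟨m, Set.mem_Iio.2 (by omega), rfl⟩)),
    h'.congr (fun j hj hjq => ?_) (fun r hr hrq => ?_)⟩
  · dsimp only
    split_ifs with e1 e2
    · rw [e1, h1]
    · rw [e2, hd, h1, mul_one]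
    · rcases Nat.lt_or_ge j (2 * m) with e3 | e3
      · exact hc' j hj e3
      · rw [show j = 2 * m + 2 by omega]
        exact h'.c_eq_zero_after hm (by omega) h3 hc' h1
  · have := h.l_one (by omega)
    by_cases e1 : r = 1
    · simp [e1, this]
    by_cases e2 : r = 2 * m + 1
    · have e3 : 2 * m + 1 ≠ 1 := by omega
      rw [if_neg e3, h1] at hlr
      subst e2
      simp only [if_neg e3, hlr, if_true, one_pow, mul_one]
    · dsimp only
      rw [if_neg e1, if_neg e1, if_neg e2]
      rcases Nat.even_or_odd r with he | ho
      · rw [h.l_even hr hrq he, mul_zero]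
      · obtain ⟨k, hk⟩ := ho
        rw [hl r (by omega) (by omega), mul_zero]

/-- The normal form if `w 3` is not central. -/
theorem exists_normalForm_of_three (h : IsFrame q S c l y w) (h2 : c 2 = 0) (hq : 3 < q)
    (hl : l 3 = 1) : ∃ y' w' : ℕ → L, ∃ p ∈ normalForms q, IsFrame q S p.1 p.2 y' w' := by
  have hc := h.c_eq_zero_of_l_three (by rw [hl]; exact one_ne_zero) h2
  have hl' : ∀ r, 1 ≤ r → r < q → l r = if Odd r then 1 else 0 := by
    intro r hr hrq
    split_ifs with ho
    · rcases Nat.lt_or_ge r 3 with h3 | h3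
      · obtain ⟨k, hk⟩ := ho
        rw [show r = 1 by omega, h.l_one (by omega)]
      · rw [h.l_eq_l_three ho h3 hrq (fun j hj hjr => hc j hj (by omega)), hl]
    · exact h.l_even hr hrq (Nat.not_odd_iff_even.1 ho)
  have hmem : ∀ a ∈ ({0, 1, -1} : Set ℂ), (topSeq q a, fun r => if Odd r then 1 else 0) ∈
      normalForms q := fun a ha => Or.inl (Or.inr ⟨a, ha, rfl⟩)
  have htop : ∀ j, 1 ≤ j → j < q → c j = topSeq q (c (q - 1)) j := by
    intro j hj hjq
    unfold topSeq
    split_ifs with h1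
    · rw [show j = q - 1 by omega]
    · exact hc j hj (by omega)
  -- The remaining c_{q-1} vanishes for even `q`, is absorbed into `w q` if q ∈ S, and is otherwise
  -- rotated away unless its square is 1.
  rcases Nat.even_or_odd q with he | ho
  · refine ⟨y, w, _, hmem 0 (by simp), h.congr (fun j hj hjq => ?_) hl'⟩
    obtain ⟨m, rfl⟩ := he
    have := h.c_even (g := fun _ _ => 0) (i := m) (by omega) le_rfl (fun _ _ _ _ => by ring) rfl hc
    rw [htop j hj hjq, this]
  · by_cases hS : q ∈ S
    · refine ⟨_, _, _, hmem 0 (by simp),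
        (h.absorb hS (by omega) (c (q - 1))).congr (fun j hj hjq => ?_) hl'⟩
      dsimp only
      rw [htop j hj hjq]
      unfold topSeq
      split_ifs <;> ring
    · by_cases hγ : c (q - 1) ^ 2 = 1
      · exact ⟨y, w, _, hmem (c (q - 1)) (by
          rcases sq_eq_sq_iff_eq_or_eq_neg.1 (hγ.trans (one_pow 2).symm) with h' | h' <;> simp [h']), h.congr htop hl'⟩
      · obtain ⟨y', w', h'⟩ := h.exists_frame_hyperbolic hq.le ho hS hc
          (fun r hr hrq => by rw [hl' r hr.pos hrq, if_pos hr]) hγ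
        refine ⟨y', w', _, hmem 0 (by simp), ?_⟩
        have : topSeq q 0 = fun _ => 0 := by
          funext j
          unfold topSeq
          split_ifs <;> rfl
        rwa [this]

/-- The normal form in the periodic case. -/
theorem exists_normalForm_of_hex (h : IsFrame q S c l y w) (hq : 6 ≤ q) (hl3 : l 3 = 0)
    (hc5 : ∀ j, 1 ≤ j → j ≤ 5 → c j = hexCoef 1 j) :
    ∃ y' w' : ℕ → L, ∃ p ∈ normalForms q, IsFrame q S p.1 p.2 y' w' := by
  have hc' := h.c_eq_hex hl3 hc5
  have hc : ∀ j, 1 ≤ j → j + 1 < q → c j = hexCoef 1 j :=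
    fun j hj hjq => hc' j hj (by omega) (Or.inl hjq)
  have hcr : ∀ r, Odd r → r < q → ∀ j, 1 ≤ j → j ≤ r → c j = hexCoef 1 j := by
    intro r hr hrq j hj hjr
    rcases hjr.eq_or_lt with rfl | hjr
    · exact hc' j hj hrq (Or.inr hr)
    · exact hc j hj (by omega)
  have hl' : ∀ r, 1 ≤ r → r < q → l r = hexL r := by
    intro r hr hrq
    unfold hexL
    rcases Nat.even_or_odd r with he | ho
    · rw [Nat.even_iff] at he
      rw [h.l_even hr hrq (Nat.even_iff.2 he), if_neg (by omega), if_neg (by omega)]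
    · split_ifs with h1 h6
      · rw [h1, h.l_one (by omega)]
      · rw [h.l_eq_hex ho (by omega) hrq hl3 (hcr r ho hrq),
          if_neg (by omega)]
      · rw [Nat.odd_iff] at ho
        rw [h.l_eq_hex (Nat.odd_iff.2 ho) (by omega) hrq hl3 (hcr r (Nat.odd_iff.2 ho) hrq),
          if_pos (by omega)]
  have hmem : ∀ a ∈ ({0, 1, -1, 2, -2} : Set ℂ),
      (fun j => hexCoef 1 j + topSeq q a j, hexL) ∈ normalForms q := fun a ha => Or.inr ⟨a, ha, rfl⟩
  set a := c (q - 1) - hexCoef 1 (q - 1) with ha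
  have htop : ∀ j, 1 ≤ j → j < q → c j = hexCoef 1 j + topSeq q a j := by
    intro j hj hjq
    unfold topSeq
    split_ifs with h1
    · rw [show j = q - 1 by omega, ha]; ring
    · rw [add_zero]; exact hc j hj (by omega)
  have h0 : a ∈ ({0, 1, -1, 2, -2} : Set ℂ) →
      ∃ y' w' : ℕ → L, ∃ p ∈ normalForms q, IsFrame q S p.1 p.2 y' w' :=
    fun hm => ⟨y, w, _, hmem a hm, h.congr htop hl'⟩
  rcases Nat.even_or_odd q with he | ho
  · refine h0 (Or.inl ?_)
    rw [ha, hc' (q - 1) (by omega) (by omega) (Or.inr ?_), sub_self]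
    rw [Nat.even_iff] at he
    rw [Nat.odd_iff]; omega
  · have ho' := Nat.odd_iff.1 ho
    by_cases hS : q ∈ S
    · refine ⟨_, _, _, hmem 0 (by simp),
        (h.absorb hS (by omega) a).congr (fun j hj hjq => ?_) hl'⟩
      dsimp only
      rw [htop j hj hjq]
      unfold topSeq
      split_ifs <;> ring
    · have key : (∃ s v : ℂ, s * v = 1 ∧ ((q % 6 = 1 ∧ 2 * (v ^ 2 - s) + (v ^ 2 + 2 * s) * a = 0) ∨
          (q % 6 = 5 ∧ 2 * (v - s ^ 2) + (2 * v + s ^ 2) * a = 0))) →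
          ∃ y' w' : ℕ → L, ∃ p ∈ normalForms q, IsFrame q S p.1 p.2 y' w' := by
        rintro ⟨s, v, hsv, htop'⟩
        obtain ⟨y', w', h'⟩ := h.exists_frame_torus (t := a) (by omega) hS hc hl' hsv
          (by rw [ha]; ring) htop'
        refine ⟨y', w', _, hmem 0 (by simp), h'.congr (fun j _ _ => ?_) (fun _ _ _ => rfl)⟩
        simp [topSeq]
      rcases (by omega : q % 6 = 3 ∨ q % 6 = 1 ∨ q % 6 = 5) with h6 | h6 | h6
      · refine h0 (Or.inl ?_)
        rw [ha, h.c_top_eq_hex (by omega) h6 hl3 hc, sub_self]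
      · by_cases h1 : a = 1
        · exact h0 (by simp [h1])
        by_cases h2 : a = -2
        · exact h0 (by simp [h2])
        have n1 : 1 - a ≠ 0 := fun h' => h1 (sub_eq_zero.1 h').symm
        have n2 : 2 + a ≠ 0 := fun h' => h2 (by linear_combination h')
        -- With v = s⁻¹ the top condition, multiplied by s², reads 2(1 - a) s³ = 2 + a. It has a
        -- nonzero root unless a is 1 or -2.
        obtain ⟨s, hs⟩ := IsAlgClosed.exists_pow_nat_eq ((2 + a) / (2 * (1 - a))) (n := 3)
          (by norm_num)
        have hs0 : s ≠ 0 := by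
          rintro rfl
          have : (2 + a) / (2 * (1 - a)) ≠ 0 := div_ne_zero n2 (mul_ne_zero two_ne_zero n1)
          exact this (by rw [← hs]; norm_num)
        rw [eq_div_iff (mul_ne_zero two_ne_zero n1)] at hs
        refine key ⟨s, s⁻¹, mul_inv_cancel₀ hs0, Or.inl ⟨h6, ?_⟩⟩
        field_simp
        linear_combination -hs
      · by_cases h1 : a = -1
        · exact h0 (by simp [h1])
        by_cases h2 : a = 2
        · exact h0 (by simp [h2])
        have n1 : 2 - a ≠ 0 := fun h' => h2 (sub_eq_zero.1 h').symm
        have n2 : 2 + 2 * a ≠ 0 := fun h' => h1 (by linear_combination (1 / 2 : ℂ) * h')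
        -- Here the condition, multiplied by `s`, reads (2 - a) s³ = 2 + 2a; the exceptional values
        -- are -1 and 2.
        obtain ⟨s, hs⟩ := IsAlgClosed.exists_pow_nat_eq ((2 + 2 * a) / (2 - a)) (n := 3)
          (by norm_num)
        have hs0 : s ≠ 0 := by
          rintro rfl
          exact div_ne_zero n2 n1 (by rw [← hs]; norm_num)
        rw [eq_div_iff n1] at hs
        refine key ⟨s, s⁻¹, mul_inv_cancel₀ hs0, Or.inr ⟨h6, ?_⟩⟩
        field_simp
        linear_combination -hs

theorem exists_normalForm (h : IsFrame q S c l y w) (hq : 3 ≤ q) :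
    ∃ y' w' : ℕ → L, ∃ p ∈ normalForms q, IsFrame q S p.1 p.2 y' w' := by
  wlog h2 : c 2 = 0 generalizing c l y w
  · exact this (h.shift (-c 2)) (by simp)
  by_cases hl : ∀ s, 3 ≤ s → s < q → l s = 0
  · exact h.exists_normalForm_of_central hq h2 hl
  push Not at hl
  classical
  -- The first r ≥ 3 with l_r ≠ 0 is odd; the values 3, 5 and at least 7 give the remaining
  -- families.
  obtain ⟨r, ⟨h3, hrq, hr⟩, hmin⟩ : ∃ r, (3 ≤ r ∧ r < q ∧ l r ≠ 0) ∧
      ∀ s, s < r → ¬(3 ≤ s ∧ s < q ∧ l s ≠ 0) :=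
    ⟨Nat.find hl, Nat.find_spec hl, fun s hs => Nat.find_min hl hs⟩
  have hlr : ∀ s, 3 ≤ s → s < r → l s = 0 := fun s hs hsr => by
    by_contra h0
    exact hmin s hsr ⟨hs, by omega, h0⟩
  have ho : Odd r := by
    by_contra h0
    exact hr (h.l_even (by omega) hrq (Nat.not_odd_iff_even.1 h0))
  obtain ⟨m, rfl⟩ := ho
  rcases (by omega : m = 1 ∨ m = 2 ∨ 3 ≤ m) with rfl | rfl | hm
  · obtain ⟨a, ha⟩ := IsAlgClosed.exists_pow_nat_eq (l 3)⁻¹ (n := 2) (by norm_num)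
    have ha0 : a ≠ 0 := by
      rintro rfl
      exact inv_ne_zero hr (by rw [show 2 * 1 + 1 = 3 from rfl, ← ha]; norm_num)
    refine (h.scale ha0).exists_normalForm_of_three ?_ hrq ?_
    · rw [h2, mul_zero]
    · rw [if_neg (by norm_num), ha]
      exact inv_mul_cancel₀ hr
  · have hc3 : c 3 = 0 := h.c_even (g := fun _ _ => 0) (i := 2) (by omega) (by omega)
      (fun _ _ _ _ => by ring) rfl (fun j hj hj4 => by
        rcases (by omega : j = 1 ∨ j = 2) with rfl | rfl
        · exact h.c_one (by omega)
        · exact h2)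
    have hc : ∀ j, 1 ≤ j → j < 2 * 2 → c j = 0 := by
      intro j hj hj4
      rcases (by omega : j = 1 ∨ j = 2 ∨ j = 3) with rfl | rfl | rfl
      · exact h.c_one (by omega)
      · exact h2
      · exact hc3
    obtain ⟨hd, hl5⟩ := h.l_eq_of_first le_rfl (by omega) (hlr 3 le_rfl (by omega)) hc
    have h0 : c 4 ≠ 0 := by
      intro h0
      rw [hl5, show 2 * 2 = 4 from rfl, h0] at hr
      simp at hr
    have hd' : c 5 = 2 * c 4 := by exact_mod_cast hd
    -- Scaling turns c_1, …, c_5 into 0, 0, 0, 1, 2. The shift by -1 leaves c_1 unchanged and yields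
    -- 0, -1, -1, 0, 1, the beginning of the periodic sequence.
    refine ((h.scale (inv_ne_zero h0)).shift (-1)).exists_normalForm_of_hex (by omega) ?_ ?_
    · rw [if_neg (by norm_num), hlr 3 le_rfl (by omega), mul_zero]
    · intro j hj hj5
      rcases (by omega : j = 1 ∨ j = 2 ∨ j = 3 ∨ j = 4 ∨ j = 5) with rfl | rfl | rfl | rfl | rfl
      · rw [if_pos rfl, h.c_one (by omega), hexCoef_eq (r := 0) (by norm_num), hex_zero, mul_zero]
      · rw [if_neg (by norm_num), h2, hexCoef_eq (r := 5) (by norm_num), hex_five]; ring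
      · rw [if_neg (by norm_num), hc3, hexCoef_eq (r := 4) (by norm_num), hex_four]; ring
      · rw [if_neg (by norm_num), inv_mul_cancel₀ h0, hexCoef_eq (r := 3) (by norm_num), hex_three]
        ring
      · rw [if_neg (by norm_num), hd', hexCoef_eq (r := 2) (by norm_num), hex_two]
        field_simp
        norm_num
  · exact h.exists_normalForm_of_seven_le h2 hm hrq hlr hr

end IsFrame

/-- The algebra `A` has the structure constants given by the code `d`. -/
def HasCode {n : ℕ} (A : LinearAlg.{u} n) : Option (ℕ × Finset ℕ × (ℕ → ℂ) × (ℕ → ℂ)) → Prop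
  | none => ∃ (p : ℕ → A.carrier →ₗ[ℂ] A.carrier) (x y : A.carrier), IsGrading.IsThin p 2 x y
  | some d => ∃ y w : ℕ → A.carrier, IsFrame d.1 d.2.1 d.2.2.1 d.2.2.2 y w

/-- Finitely many codes suffice for the algebras of dimension `n`. -/
def codes (n : ℕ) : Set (Option (ℕ × Finset ℕ × (ℕ → ℂ) × (ℕ → ℂ))) :=
  insert none (some '' ⋃ q ∈ Set.Iic n,
    {q} ×ˢ ((Finset.range (n + 1)).powerset : Set (Finset ℕ)) ×ˢ normalForms q)

theorem finite_codes (n : ℕ) : (codes n).Finite :=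
  (Set.Finite.image _ ((Set.finite_Iic n).biUnion fun q _ =>
    (Set.finite_singleton q).prod ((Finset.finite_toSet _).prod (finite_normalForms q)))).insert _

theorem exists_hasCode {n : ℕ} (A : LinearAlg.{u} n) : ∃ d ∈ codes n, HasCode A d := by
  obtain ⟨q, p, hq, hp, x, y, hx, hy, hpow, hthin⟩ := A.exists_grading
  have h : IsGrading.IsThin p q x y := ⟨hp, hq, hx, hy, hpow, hthin⟩
  rcases hq.eq_or_lt with rfl | hq
  · exact ⟨none, Set.mem_insert _ _, p, x, y, h⟩
  · obtain ⟨S, c, l, Y, W, hF⟩ := h.exists_frame A.nonsplit hq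
    obtain ⟨y', w', d, hd, hF⟩ := hF.exists_normalForm hq
    have hcard := hF.card
    rw [A.finrank_eq] at hcard
    refine ⟨some (q, S, d), Set.mem_insert_of_mem _ (Set.mem_image_of_mem _ ?_), y', w', hF⟩
    -- The equality n = q + |S| bounds `q`, and `S` lies in the degrees 1, …, q.
    refine Set.mem_biUnion (x := q) (Set.mem_Iic.2 (by omega)) ⟨rfl, ?_, hd⟩
    rw [Finset.mem_coe, Finset.mem_powerset]
    intro r hr
    have := hF.bounds r hr
    exact Finset.mem_range.2 (by omega)

theorem nonempty_equiv_of_hasCode {n : ℕ} {A B : LinearAlg.{u} n}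
    {d : Option (ℕ × Finset ℕ × (ℕ → ℂ) × (ℕ → ℂ))} (hA : HasCode A d) (hB : HasCode B d) :
    Nonempty (A.carrier ≃ₗ⁅ℂ⁆ B.carrier) := by
  rcases d with _ | d
  · obtain ⟨p, x, y, h⟩ := hA
    obtain ⟨p', x', y', h'⟩ := hB
    exact nonempty_equiv_of_class_two h h' A.nonsplit B.nonsplit
      (A.finrank_eq.trans B.finrank_eq.symm)
  · obtain ⟨y, w, h⟩ := hA
    obtain ⟨y', w', h'⟩ := hB
    exact h.nonempty_equiv h' (fun _ _ _ => rfl) (fun _ _ _ => rfl)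

end NatGraded

end

theorem mainTheorem2 (n : ℕ) (hn : 7 ≤ n) : Finite (NatGraded.IsoClasses.{u} n) := by
  choose d hd hcode using fun A : NatGraded.LinearAlg.{u} n => NatGraded.exists_hasCode A
  have := (NatGraded.finite_codes n).to_subtype
  -- Each class is sent to the code of a chosen representative; equal codes force isomorphic
  -- representatives.
  refine Finite.of_injective
    (fun a : NatGraded.IsoClasses.{u} n => (⟨d a.out, hd a.out⟩ : NatGraded.codes n)) ?_
  intro a b hab
  have e : d (Quotient.out a) = d (Quotient.out b) := congrArg Subtype.val hab
  exact Quotient.out_equiv_out.1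
    (NatGraded.nonempty_equiv_of_hasCode (hcode (Quotient.out a)) (e ▸ hcode (Quotient.out b)))
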